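/- A dyadic interval is $I=[k2^m,(k+1)2^m)$ with $k,m\in\mathbb Z$, with $L^2$-normalised Haar function $h_I=|I|^{-1/2}(\chi_{I_{\mathrm{left}}}-\chi_{I_{\mathrm{right}}})$. For a dyadic rectangle $R=I\times J$ put $h_R(x,y)=h_I(x)h_J(y)$, $f_R=\langle f,h_R\rangle$, and let $\langle f\rangle_R$ be the average of $f$ over $R$. For $0<p<\infty$, $H^p_d(\mathbb R\otimes\mathbb R)$ is the space of bi-parameter dyadic distributions $f$ (real families $(\langle f\rangle_R)_R$ that are consistent under halving $R$ in either variable; a function integrable on dyadic rectangles is identified with its averages) with $\|f\|_{H^p_d}=\|M f\|_{L^p(\mathbb R^2)}<\infty$, where $Mf(z)=\sup_{R\ni z}|\langle f\rangle_R|$. For $1<s<\infty$ and an open set $\Omega\subset\mathbb R^2$ of finite measure, a function $f$ is an $L^s$-atom supported on $\Omega$ if $f=\sum_{R\subseteq\Omega}f_Rh_R$ (unconditionally in $L^s$) and $\|f\|_{L^s}\le|\Omega|^{1/s}$. Lemma. Let $1<s,q<\infty$ and $0<p<q$. There is a constant $C=C(p,s,q)$ such that the following holds. Let $V$ be a linear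 space of measurable functions on $\mathbb R^2$ (modulo a.e. equality) that contains all the $h_R$, and let $T$ be a linear operator from $V$ to the measurable functions which, for every open $\Omega$ of finite measure, maps each $L^s$-atom in $V$ supported on $\Omega$ to an $L^q$-atom supported on $\Omega$. Then $T$ is bounded on $H^p_d(\mathbb R\otimes\mathbb R)$ with constant $C$: for every $f\in V$ that is a multiple of an $L^s$-atom (in particular for all finite linear combinations of the $h_R$), $Tf$ is integrable on every dyadic rectangle and $$\|Tf\|_{H^p_d}\le C\|f\|_{H^p_d},$$ and there is a unique linear operator $\widetilde T:H^p_d\to H^p_d$ that satisfies $\|\widetilde Tf\|_{H^p_d}\le C\|f\|_{H^p_d}$ for all $f\in H^p_d$ and agrees with $T$ on all these $f$ that belong to $H^p_d$. Moreover, if $1<p<q$, the same conclusion holds (with a constant depending only on $p,s,q$) when the hypothesis on $T$ is replaced by the following: for every open $\Omega$ of finite measure and every $L^s$-atom $f\in V$ supported on $\Omega$, $T(f)$ vanishes a.e. outside $\Omega$ and $\|T(f)\|_{L^q(\mathbb R^2)}\le|\Omega|^{1/q}$. -/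

import Mathlib

open MeasureTheory Filter Topology
open scoped ENNReal NNReal

noncomputable section

namespace BiparameterHardy

/-- The pair `(m, k)` encodes the dyadic interval `[k 2^m, (k+1) 2^m)` of the line. -/
abbrev DyadicInterval : Type := ℤ × ℤ

namespace DyadicInterval

/-- The length `2^m`. -/
def length (I : DyadicInterval) : ℝ := (2 : ℝ) ^ I.1

/-- The interval as a set. -/
def toSet (I : DyadicInterval) : Set ℝ :=
  Set.Ico ((I.2 : ℝ) * I.length) (((I.2 : ℝ) + 1) * I.length)

/-- The left half. -/
def left (I : DyadicInterval) : DyadicInterval := (I.1 - 1, 2 * I.2)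

/-- The right half. -/
def right (I : DyadicInterval) : DyadicInterval := (I.1 - 1, 2 * I.2 + 1)

/-- The `L²`-normalised Haar function of a dyadic interval. -/
def haar (I : DyadicInterval) (x : ℝ) : ℝ :=
  (Real.sqrt I.length)⁻¹ *
    (I.left.toSet.indicator (fun _ => (1 : ℝ)) x - I.right.toSet.indicator (fun _ => (1 : ℝ)) x)

theorem measurable_haar (I : DyadicInterval) : Measurable I.haar := by
  unfold haar toSet
  exact measurable_const.mul
    ((measurable_const.indicator measurableSet_Ico).sub
      (measurable_const.indicator measurableSet_Ico))

end DyadicInterval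

/-- A dyadic rectangle `R = I × J`. -/
abbrev DyadicRectangle : Type := DyadicInterval × DyadicInterval

namespace DyadicRectangle

/-- The rectangle as a subset of the plane. -/
def toSet (R : DyadicRectangle) : Set (ℝ × ℝ) :=
  DyadicInterval.toSet R.1 ×ˢ DyadicInterval.toSet R.2

/-- The rectangular Haar function `h_R = h_I ⊗ h_J`. -/
def haar (R : DyadicRectangle) (z : ℝ × ℝ) : ℝ :=
  DyadicInterval.haar R.1 z.1 * DyadicInterval.haar R.2 z.2

theorem measurable_haar (R : DyadicRectangle) : Measurable R.haar :=
  ((DyadicInterval.measurable_haar R.1).comp measurable_fst).mul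
    ((DyadicInterval.measurable_haar R.2).comp measurable_snd)

theorem measurableSet_toSet (R : DyadicRectangle) : MeasurableSet R.toSet :=
  measurableSet_Ico.prod measurableSet_Ico

end DyadicRectangle

/-- Measurable real functions on the plane, modulo equality almost everywhere. -/
abbrev PlaneFun : Type := (ℝ × ℝ) →ₘ[(volume : Measure (ℝ × ℝ))] ℝ

/-- The Haar function `h_R` as an element of `PlaneFun`. -/
def haarFun (R : DyadicRectangle) : PlaneFun :=
  AEEqFun.mk R.haar R.measurable_haar.aestronglyMeasurable

/-- The finite linear combinations of rectangular Haar functions. -/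
def haarSpan : Submodule ℝ PlaneFun := Submodule.span ℝ (Set.range haarFun)

/-- The Haar coefficient `f_R = ⟨f, h_R⟩`. -/
def haarCoeff (f : PlaneFun) (R : DyadicRectangle) : ℝ := ∫ z, f z * R.haar z

/-- `f ∈ L^s` and `f = ∑_{R ⊆ Ω} f_R h_R`, with (unconditional) convergence in `L^s`. -/
def IsHaarSupported (s : ℝ) (Ω : Set (ℝ × ℝ)) (f : PlaneFun) : Prop :=
  MemLp f (ENNReal.ofReal s) volume ∧
  Tendsto
    (fun F : Finset {R : DyadicRectangle // R.toSet ⊆ Ω} =>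
      eLpNorm (fun z => f z - ∑ R ∈ F, haarCoeff f R.1 * R.1.haar z) (ENNReal.ofReal s) volume)
    atTop (𝓝 0)

/-- `f` is an `L^s`-atom supported on `Ω`: `f = ∑_{R ⊆ Ω} f_R h_R` and
`‖f‖_{L^s} ≤ |Ω|^{1/s}`. -/
def IsAtom (s : ℝ) (Ω : Set (ℝ × ℝ)) (f : PlaneFun) : Prop :=
  IsHaarSupported s Ω f ∧ eLpNorm f (ENNReal.ofReal s) volume ≤ volume Ω ^ (1 / s)

/-- `f` is integrable on every dyadic rectangle, so that its averages make sense. -/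
def DyadicLocallyIntegrable (f : PlaneFun) : Prop :=
  ∀ R : DyadicRectangle, IntegrableOn f R.toSet volume

/-- The averages of `f` over the dyadic rectangles. -/
def averages (f : PlaneFun) (R : DyadicRectangle) : ℝ := ⨍ z in R.toSet, f z

/-- The dyadic strong maximal function `M(a)(z) = sup_{R ∋ z} |a_R|` of a family `a` of
(averages over) dyadic rectangles. -/
def maximalFun (a : DyadicRectangle → ℝ) (z : ℝ × ℝ) : ℝ≥0∞ :=
  ⨆ (R : DyadicRectangle) (_ : z ∈ R.toSet), ENNReal.ofReal |a R|

/-- The quasi-norm `‖M(a)‖_{L^p}` of `H^p_d(ℝ ⊗ ℝ)`. -/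
def hardyNorm (p : ℝ) (a : DyadicRectangle → ℝ) : ℝ≥0∞ :=
  (∫⁻ z, maximalFun a z ^ p) ^ (1 / p)

/-- The families `a` that are consistent, as averages over dyadic rectangles are: the value at
`I × J` is the mean of the values at the two halves, in either variable. These are the
bi-parameter dyadic martingales (dyadic distributions); a function that is integrable on dyadic
rectangles is identified with its family of averages. -/
def IsConsistent (a : DyadicRectangle → ℝ) : Prop :=
  ∀ I J : DyadicInterval,
    a (I, J) = (a (I.left, J) + a (I.right, J)) / 2 ∧
    a (I, J) = (a (I, J.left) + a (I, J.right)) / 2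

theorem measurable_maximalFun (a : DyadicRectangle → ℝ) : Measurable (maximalFun a) := by
  have h : maximalFun a = fun z => ⨆ R : DyadicRectangle,
      R.toSet.indicator (fun _ => ENNReal.ofReal |a R|) z := by
    funext z
    unfold maximalFun
    refine iSup_congr fun R => ?_
    by_cases hz : z ∈ R.toSet <;> simp [hz]
  rw [h]
  exact Measurable.iSup fun R => measurable_const.indicator R.measurableSet_toSet

theorem maximalFun_add_le (a b : DyadicRectangle → ℝ) (z : ℝ × ℝ) :
    maximalFun (a + b) z ≤ maximalFun a z + maximalFun b z := by
  refine iSup₂_le fun R hR => ?_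
  calc ENNReal.ofReal |(a + b) R| ≤ ENNReal.ofReal (|a R| + |b R|) :=
        ENNReal.ofReal_le_ofReal (abs_add_le _ _)
    _ = ENNReal.ofReal |a R| + ENNReal.ofReal |b R| :=
        ENNReal.ofReal_add (abs_nonneg _) (abs_nonneg _)
    _ ≤ _ := add_le_add (le_iSup₂_of_le R hR le_rfl) (le_iSup₂_of_le R hR le_rfl)

theorem maximalFun_smul_le (c : ℝ) (a : DyadicRectangle → ℝ) (z : ℝ × ℝ) :
    maximalFun (c • a) z ≤ ENNReal.ofReal |c| * maximalFun a z := by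
  refine iSup₂_le fun R hR => ?_
  rw [Pi.smul_apply, smul_eq_mul, abs_mul, ENNReal.ofReal_mul (abs_nonneg _)]
  gcongr
  exact le_iSup₂_of_le R hR le_rfl

/-- The dyadic product Hardy space `H^p_d(ℝ ⊗ ℝ)`, `0 < p < ∞`: the dyadic distributions whose
strong maximal function is in `L^p`. -/
def Hardy (p : ℝ) (hp : 0 < p) : Submodule ℝ (DyadicRectangle → ℝ) where
  carrier := {a | IsConsistent a ∧ hardyNorm p a < ⊤}
  zero_mem' := by
    refine ⟨fun I J => by simp, ?_⟩
    have h : maximalFun 0 = 0 := by funext z; simp [maximalFun]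
    simp [hardyNorm, h, hp]
  add_mem' := by
    rintro a b ⟨ha, ha'⟩ ⟨hb, hb'⟩
    refine ⟨fun I J => ?_, ?_⟩
    · obtain ⟨h1, h2⟩ := ha I J
      obtain ⟨h3, h4⟩ := hb I J
      simp only [Pi.add_apply]
      constructor <;> linarith
    · have hp' : 0 < 1 / p := by positivity
      simp only [hardyNorm, ENNReal.rpow_lt_top_iff_of_pos hp'] at ha' hb' ⊢
      calc ∫⁻ z, maximalFun (a + b) z ^ p
          ≤ ∫⁻ z, (2 : ℝ≥0∞) ^ p * (maximalFun a z ^ p + maximalFun b z ^ p) := by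
            refine lintegral_mono fun z => ?_
            calc maximalFun (a + b) z ^ p
                ≤ (2 * max (maximalFun a z) (maximalFun b z)) ^ p := by
                  refine ENNReal.rpow_le_rpow ((maximalFun_add_le a b z).trans ?_) hp.le
                  rw [two_mul]
                  exact add_le_add (le_max_left _ _) (le_max_right _ _)
              _ = 2 ^ p * max (maximalFun a z) (maximalFun b z) ^ p :=
                  ENNReal.mul_rpow_of_nonneg _ _ hp.le
              _ ≤ _ := by
                  gcongr
                  rcases le_total (maximalFun a z) (maximalFun b z) with h | h
                  · rw [max_eq_right h]; exact le_add_self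
                  · rw [max_eq_left h]; exact le_self_add
        _ = 2 ^ p * (∫⁻ z, maximalFun a z ^ p + maximalFun b z ^ p) :=
            lintegral_const_mul _
              (((measurable_maximalFun a).pow_const p).add ((measurable_maximalFun b).pow_const p))
        _ = 2 ^ p * ((∫⁻ z, maximalFun a z ^ p) + ∫⁻ z, maximalFun b z ^ p) := by
            rw [lintegral_add_left ((measurable_maximalFun a).pow_const p)]
        _ < ⊤ := ENNReal.mul_lt_top
            (ENNReal.rpow_lt_top_of_nonneg hp.le (by simp)) (ENNReal.add_lt_top.2 ⟨ha', hb'⟩)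
  smul_mem' := by
    rintro c a ⟨ha, ha'⟩
    refine ⟨fun I J => ?_, ?_⟩
    · obtain ⟨h1, h2⟩ := ha I J
      simp only [Pi.smul_apply, smul_eq_mul]
      constructor
      · rw [h1]; ring
      · rw [h2]; ring
    · have hp' : 0 < 1 / p := by positivity
      simp only [hardyNorm, ENNReal.rpow_lt_top_iff_of_pos hp'] at ha' ⊢
      calc ∫⁻ z, maximalFun (c • a) z ^ p
          ≤ ∫⁻ z, ENNReal.ofReal |c| ^ p * maximalFun a z ^ p := by
            refine lintegral_mono fun z => ?_
            rw [← ENNReal.mul_rpow_of_nonneg _ _ hp.le]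
            exact ENNReal.rpow_le_rpow (maximalFun_smul_le c a z) hp.le
        _ = ENNReal.ofReal |c| ^ p * ∫⁻ z, maximalFun a z ^ p :=
            lintegral_const_mul _ ((measurable_maximalFun a).pow_const p)
        _ < ⊤ := ENNReal.mul_lt_top (ENNReal.rpow_lt_top_of_nonneg hp.le (by simp)) ha'

/-- The functions of `V` to which an atomic hypothesis on `T` can be applied: those of the form
`f = ∑_{R ⊆ Ω} f_R h_R` in `L^s` for some open `Ω` of finite measure, that is, the multiples of
`L^s`-atoms. Every finite combination of Haar functions is one. -/
def IsAtomMultiple (s : ℝ) (f : PlaneFun) : Prop :=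
  ∃ Ω : Set (ℝ × ℝ), IsOpen Ω ∧ volume Ω < ⊤ ∧ IsHaarSupported s Ω f

/-- `T` is bounded on `H^p_d(ℝ ⊗ ℝ)` with constant `C`: the estimate `‖T f‖ ≤ C ‖f‖` holds for
all multiples `f` of `L^s`-atoms on which `T` is defined (in particular for finite combinations of
Haar functions), and there is exactly one linear operator on the whole space that satisfies
this estimate and agrees with `T` on these `f`, when they are in the space. -/
def IsBoundedOnHardy (p : ℝ) (hp : 0 < p) (s : ℝ) (C : ℝ≥0) (V : Submodule ℝ PlaneFun)
    (T : V →ₗ[ℝ] PlaneFun) : Prop :=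
  (∀ f : V, IsAtomMultiple s f →
    DyadicLocallyIntegrable (T f) ∧
    hardyNorm p (averages (T f)) ≤ C * hardyNorm p (averages f)) ∧
  ∃! T' : Hardy p hp →ₗ[ℝ] Hardy p hp,
    (∀ a : Hardy p hp, hardyNorm p (T' a) ≤ C * hardyNorm p a) ∧
    ∀ (f : V) (a : Hardy p hp), IsAtomMultiple s f →
      (a : DyadicRectangle → ℝ) = averages f →
      (T' a : DyadicRectangle → ℝ) = averages (T f)

end BiparameterHardy

end

noncomputable section

/-! ### Dyadic intervals: nesting, exhausting finite families, telescoping Haar sums. -/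

namespace BiparameterHardy

namespace DyadicInterval

/-! The proof is an atomic decomposition along the level sets of the maximal function, carried out
for finite Haar sums and then extended by density. For `a` in `H^p_d` put `Ω_k = {Ma > 2^k}`, and
assign to each rectangle `R` with non-zero coefficient the largest `k` for which `Ω_k` fills more
than an eighth of `R`. The rectangles assigned to `k` lie in `U_k`, the union of all rectangles
filled to this extent by `Ω_k`. The `L²` bound for the strong maximal function gives `|U_k| ≲
|Ω_k|`, so `∑ 2^{kp} |U_k| ≲ ‖Ma‖_p^p`.

The size of the piece `f_k` of level `k` comes from a Carleson condition, `sum_coeff_sq_le`: the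
squares of its coefficients at rectangles inside any measurable `W` add up to at most a constant
times `2^{2k} |W|`. Indeed such a rectangle has at least 7/8 of its area outside `Ω_{k+1}`, and an
average over a rectangle that meets the complement of `Ω_{k+1}` is at most `2^{k+1}`. A discrete
integration by parts in both variables, `sum_mixedDiff_sq_mul_sq_le`, with the density of `W \
Ω_{k+1}` as a cutoff, turns this bound for averages into one for coefficients. The Carleson
condition then self-improves to `L^s` for every `1 < s < ∞` (`lintegral_haarSum_rpow_le`): pair the
Haar sum with its dual function, sort the coefficients of the latter by the same kind of levels, and
use Cauchy–Schwarz on each level. No square function is needed. Thus `f_k` is a multiple, of size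
`2^k`, of an `L^s`-atom on an open set little larger than `U_k`.

By hypothesis `T f_k` is the same multiple of an `L^q`-atom, so `M(T f_k)` vanishes off that open
set and its `L^q` norm to the power `q` is at most a constant times `2^{kq} |U_k|`. Since `p < q`,
such pieces can be summed in `L^p` (`lintegral_sum_rpow_le`), for `p ≤ 1` and `p > 1` alike. Under
the second hypothesis only `T f_k` itself is localised; the pieces are summed without the maximal
function, and its boundedness on `L^p` requires `1 < p`.

On functions supported in a fixed `Ω` the hypothesis amounts to continuity from `L^s` to `L^q`; with
Fatou's lemma this gives the estimate for all multiples of atoms. Finally, truncated Haar expansions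
converge in `H^p_d` (`tendsto_lintegral_sub_truncation`): the same decomposition bounds a partial
Haar sum by a power of its part of the convergent series `∑ 2^{k(p-2)} |a_R|²`, where `a_R` is the
Haar coefficient and `k` the level of `R`. The extension is the limit of `T` along truncations, and
density makes it unique. -/

theorem length_pos (I : DyadicInterval) : 0 < I.length := zpow_pos (by norm_num) _

theorem length_left (I : DyadicInterval) : I.left.length = I.length / 2 := by
  simp [length, left, zpow_sub_one₀, div_eq_mul_inv]

theorem length_right (I : DyadicInterval) : I.right.length = I.length / 2 := by
  simp [length, right, zpow_sub_one₀, div_eq_mul_inv]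

theorem mem_toSet {I : DyadicInterval} {x : ℝ} : x ∈ I.toSet ↔ ⌊x / I.length⌋ = I.2 := by
  have h := I.length_pos
  rw [toSet, Set.mem_Ico, Int.floor_eq_iff, le_div_iff₀ h, div_lt_iff₀ h]

theorem nonempty_toSet (I : DyadicInterval) : I.toSet.Nonempty :=
  Set.nonempty_Ico.2 (by have := I.length_pos; nlinarith)

theorem measurableSet_toSet (I : DyadicInterval) : MeasurableSet I.toSet := measurableSet_Ico

theorem volume_toSet (I : DyadicInterval) : volume I.toSet = ENNReal.ofReal I.length := by
  rw [toSet, Real.volume_Ico]; congr 1; ring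

theorem volume_toSet_ne_zero (I : DyadicInterval) : volume I.toSet ≠ 0 := by
  rw [volume_toSet]; simpa using I.length_pos

theorem volume_toSet_ne_top (I : DyadicInterval) : volume I.toSet ≠ ⊤ := by
  rw [volume_toSet]; exact ENNReal.ofReal_ne_top

/-- The index at the scale of `K` of the interval containing `x` is the integer quotient by `2^j` of
the index at the scale of `I`, so it is the same for all `x` in `I`. -/
theorem toSet_subset_or_disjoint {I K : DyadicInterval} (h : I.1 ≤ K.1) :
    I.toSet ⊆ K.toSet ∨ Disjoint I.toSet K.toSet := by
  obtain ⟨j, hj⟩ := Int.le.dest h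
  have key : ∀ x ∈ I.toSet, (x ∈ K.toSet ↔ I.2 / ((2 ^ j : ℕ) : ℤ) = K.2) := by
    intro x hx
    rw [mem_toSet] at hx ⊢
    have : x / K.length = x / I.length / ((2 ^ j : ℕ) : ℝ) := by
      rw [div_div]; congr 1
      simp [length, ← hj, zpow_add₀]
    rw [this, Int.floor_div_natCast, hx]
  by_cases hk : I.2 / ((2 ^ j : ℕ) : ℤ) = K.2
  · exact Or.inl fun x hx => (key x hx).2 hk
  · exact Or.inr (Set.disjoint_left.2 fun x hx hx' => hk ((key x hx).1 hx'))

theorem scale_le_of_subset {I K : DyadicInterval} (h : I.toSet ⊆ K.toSet) : I.1 ≤ K.1 := by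
  have h1 := measure_mono (μ := volume) h
  rw [volume_toSet, volume_toSet, ENNReal.ofReal_le_ofReal_iff K.length_pos.le] at h1
  exact (zpow_le_zpow_iff_right₀ (by norm_num : (1 : ℝ) < 2)).1 h1

theorem toSet_left_union_right (I : DyadicInterval) : I.left.toSet ∪ I.right.toSet = I.toSet := by
  have h := I.length_pos
  rw [toSet, toSet, toSet, length_left, length_right]
  simp only [left, right, Int.cast_mul, Int.cast_add, Int.cast_ofNat, Int.cast_one]
  rw [show (2 * (I.2 : ℝ) + 1) * (I.length / 2) = I.2 * I.length + I.length / 2 by ring,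
    show (2 * (I.2 : ℝ)) * (I.length / 2) = I.2 * I.length by ring,
    show (2 * (I.2 : ℝ) + 1 + 1) * (I.length / 2) = (I.2 + 1) * I.length by ring]
  exact Set.Ico_union_Ico_eq_Ico (by linarith) (by linarith)

theorem disjoint_left_right (I : DyadicInterval) : Disjoint I.left.toSet I.right.toSet := by
  refine Set.disjoint_left.2 fun x h1 h2 => ?_
  rw [mem_toSet] at h1 h2
  rw [length_left] at h1
  rw [length_right, h1] at h2
  simp [left, right] at h2

theorem left_subset (I : DyadicInterval) : I.left.toSet ⊆ I.toSet :=
  I.toSet_left_union_right ▸ Set.subset_union_left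

theorem right_subset (I : DyadicInterval) : I.right.toSet ⊆ I.toSet :=
  I.toSet_left_union_right ▸ Set.subset_union_right

theorem eq_of_subset_of_scale {I K : DyadicInterval} (h : I.toSet ⊆ K.toSet) (h1 : I.1 = K.1) :
    I = K := by
  obtain ⟨x, hx⟩ := I.nonempty_toSet
  have hx' := h hx
  rw [mem_toSet] at hx hx'
  refine Prod.ext h1 ?_
  rw [← hx, ← hx', length, length, h1]

theorem subset_left_or_right {I K : DyadicInterval} (h : I.toSet ⊆ K.toSet) (hne : I ≠ K) :
    I.toSet ⊆ K.left.toSet ∨ I.toSet ⊆ K.right.toSet := by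
  have h1 : I.1 ≤ K.1 - 1 := by
    have := scale_le_of_subset h
    have : I.1 ≠ K.1 := fun h' => hne (eq_of_subset_of_scale h h')
    omega
  rcases toSet_subset_or_disjoint (I := I) (K := K.left) h1 with h2 | h2
  · exact Or.inl h2
  · refine Or.inr fun x hx => ?_
    have := h hx
    rw [← toSet_left_union_right] at this
    exact this.resolve_left (Set.disjoint_left.1 h2 hx)

theorem not_subset_left (I : DyadicInterval) : ¬ I.toSet ⊆ I.left.toSet := fun h => by
  have := scale_le_of_subset h
  simp [left] at this

theorem not_subset_right (I : DyadicInterval) : ¬ I.toSet ⊆ I.right.toSet := fun h => by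
  have := scale_le_of_subset h
  simp [right] at this

theorem not_subset_right_of_left {I K : DyadicInterval} (h : I.toSet ⊆ K.left.toSet) :
    ¬ I.toSet ⊆ K.right.toSet := fun h' => by
  obtain ⟨x, hx⟩ := I.nonempty_toSet
  exact Set.disjoint_left.1 K.disjoint_left_right (h hx) (h' hx)

open Classical in
/-- The descendants of `I` of the first `n` generations, `I` included. -/
def tree : ℕ → DyadicInterval → Finset DyadicInterval
  | 0, _ => ∅
  | n + 1, I => insert I (tree n I.left ∪ tree n I.right)

theorem mem_tree {n : ℕ} {I K : DyadicInterval} :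
    K ∈ tree n I ↔ K.toSet ⊆ I.toSet ∧ I.1 - n < K.1 := by
  induction n generalizing I with
  | zero =>
    simp only [tree, Finset.notMem_empty, false_iff, not_and]
    intro h
    have := scale_le_of_subset h
    push_cast; omega
  | succ n ih =>
    rw [tree, Finset.mem_insert, Finset.mem_union, ih, ih]
    constructor
    · rintro (rfl | ⟨h, h1⟩ | ⟨h, h1⟩)
      · exact ⟨subset_rfl, by push_cast; omega⟩
      · refine ⟨h.trans I.left_subset, ?_⟩
        simp only [left] at h1; push_cast; omega
      · refine ⟨h.trans I.right_subset, ?_⟩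
        simp only [right] at h1; push_cast; omega
    · rintro ⟨h, h1⟩
      by_cases hK : K = I
      · exact Or.inl hK
      · push_cast at h1
        rcases subset_left_or_right h hK with h2 | h2
        · exact Or.inr (Or.inl ⟨h2, by simp only [left]; omega⟩)
        · exact Or.inr (Or.inr ⟨h2, by simp only [right]; omega⟩)

theorem sum_tree_succ {M : Type*} [AddCommMonoid M] (n : ℕ) (I : DyadicInterval)
    (F : DyadicInterval → M) :
    ∑ K ∈ tree (n + 1) I, F K = F I + (∑ K ∈ tree n I.left, F K + ∑ K ∈ tree n I.right, F K) := by
  classical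
  rw [tree, Finset.sum_insert, Finset.sum_union]
  · refine Finset.disjoint_left.2 fun K h1 h2 => ?_
    exact not_subset_right_of_left (mem_tree.1 h1).1 (mem_tree.1 h2).1
  · rw [Finset.mem_union, mem_tree, mem_tree]
    rintro (h | h)
    · exact I.not_subset_left h.1
    · exact I.not_subset_right h.1

/-- The two dyadic intervals of scale `N` adjacent to the origin. -/
def top (N : ℕ) (b : Bool) : DyadicInterval := (N, if b then 0 else -1)

theorem disjoint_top (N : ℕ) : Disjoint (top N true).toSet (top N false).toSet := by
  refine Set.disjoint_left.2 fun x h1 h2 => ?_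
  rw [mem_toSet] at h1 h2
  have : (top N true).length = (top N false).length := rfl
  rw [this, h2] at h1
  simp [top] at h1

open Classical in
/-- A finite set of dyadic intervals; these sets exhaust all dyadic intervals. -/
def box (N : ℕ) : Finset DyadicInterval := tree (2 * N) (top N true) ∪ tree (2 * N) (top N false)

theorem sum_box {M : Type*} [AddCommMonoid M] (N : ℕ) (F : DyadicInterval → M) :
    ∑ K ∈ box N, F K =
      ∑ K ∈ tree (2 * N) (top N true), F K + ∑ K ∈ tree (2 * N) (top N false), F K := by
  classical
  rw [box, Finset.sum_union]
  refine Finset.disjoint_left.2 fun K h1 h2 => ?_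
  obtain ⟨x, hx⟩ := K.nonempty_toSet
  exact Set.disjoint_left.1 (disjoint_top N) ((mem_tree.1 h1).1 hx) ((mem_tree.1 h2).1 hx)

/-- No dyadic interval has `0` in its interior, so each lies in one of the two half-lines, which the
intervals `top N b` exhaust. This is why two top intervals are needed. -/
theorem eventually_subset_top (I : DyadicInterval) :
    ∃ b, ∀ᶠ N in atTop, I.toSet ⊆ (top N b).toSet := by
  have h0 : ∀ᶠ N : ℕ in atTop, |(I.2 : ℝ) + 1| * I.length ≤ (top N true).length ∧
      |(I.2 : ℝ)| * I.length ≤ (top N true).length := by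
    have : Tendsto (fun N : ℕ => (top N true).length) atTop atTop := by
      simpa [length, top] using tendsto_pow_atTop_atTop_of_one_lt (by norm_num : (1 : ℝ) < 2)
    exact (this.eventually_ge_atTop _).and (this.eventually_ge_atTop _)
  have hl := I.length_pos
  rcases lt_or_ge I.2 0 with hI | hI
  · refine ⟨false, h0.mono fun N hN => ?_⟩
    have h1 : (I.2 : ℝ) + 1 ≤ 0 := by exact_mod_cast hI
    have h2 : (top N false).length = (top N true).length := rfl
    refine Set.Ico_subset_Ico ?_ ?_
    · have := (abs_le.1 (le_of_eq rfl : |(I.2 : ℝ)| ≤ |(I.2 : ℝ)|)).1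
      rw [h2]; simp [top]; simp [top] at hN; nlinarith [neg_abs_le (I.2 : ℝ)]
    · simp [top]; nlinarith
  · refine ⟨true, h0.mono fun N hN => ?_⟩
    have h1 : (0 : ℝ) ≤ I.2 := by exact_mod_cast hI
    refine Set.Ico_subset_Ico ?_ ?_
    · simp [top]; positivity
    · simp [top]; simp [top] at hN; nlinarith [le_abs_self ((I.2 : ℝ) + 1)]

theorem eventually_mem_box (I : DyadicInterval) : ∀ᶠ N in atTop, I ∈ box N := by
  classical
  obtain ⟨b, hb⟩ := I.eventually_subset_top
  filter_upwards [hb, eventually_ge_atTop (I.1.natAbs + 1)] with N h1 h2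
  have h3 : I ∈ tree (2 * N) (top N b) := mem_tree.2 ⟨h1, by simp only [top]; push_cast; omega⟩
  rw [box, Finset.mem_union]
  cases b
  · exact Or.inr h3
  · exact Or.inl h3

theorem box_mono {N N' : ℕ} (h : N ≤ N') : box N ⊆ box N' := by
  classical
  intro I hI
  have key : ∀ b, (top N b).toSet ⊆ (top N' b).toSet := by
    have hl : (top N true).length ≤ (top N' true).length :=
      zpow_le_zpow_right₀ (by norm_num) (by simpa [top] using h)
    have hf : ∀ N, (top N false).length = (top N true).length := fun _ => rfl
    intro b
    cases b
    · refine Set.Ico_subset_Ico ?_ ?_ <;> simp [hf] <;> simp [top] at * <;> linarith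
    · refine Set.Ico_subset_Ico ?_ ?_ <;> simp [top] at * <;> linarith
  rw [box, Finset.mem_union, mem_tree, mem_tree] at hI ⊢
  rcases hI with ⟨h1, h2⟩ | ⟨h1, h2⟩
  · exact Or.inl ⟨h1.trans (key _), by simp only [top] at *; push_cast at *; omega⟩
  · exact Or.inr ⟨h1.trans (key _), by simp only [top] at *; push_cast at *; omega⟩

open Classical in
/-- The constant value of `√|K| h_K` on a dyadic interval `I` strictly contained in `K`,
and `0` for other `I`. -/
def haarSign (I K : DyadicInterval) : ℝ :=
  if I.toSet ⊆ K.left.toSet then 1 else if I.toSet ⊆ K.right.toSet then -1 else 0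

theorem subset_of_haarSign_ne_zero {I K : DyadicInterval} (h : haarSign I K ≠ 0) :
    I.toSet ⊆ K.toSet := by
  unfold haarSign at h
  split_ifs at h with h1 h2
  · exact h1.trans K.left_subset
  · exact h2.trans K.right_subset
  · exact absurd rfl h

theorem haarSign_of_subset_left {I K : DyadicInterval} (h : I.toSet ⊆ K.left.toSet) :
    haarSign I K = 1 := if_pos h

theorem haarSign_of_subset_right {I K : DyadicInterval} (h : I.toSet ⊆ K.right.toSet) :
    haarSign I K = -1 := by
  rw [haarSign, if_neg (fun h' => not_subset_right_of_left h' h), if_pos h]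

/-- The half difference of the values on the two halves. -/
def diff (α : DyadicInterval → ℝ) (I : DyadicInterval) : ℝ := (α I.left - α I.right) / 2

/-- One-parameter consistent families (martingales). -/
def Consistent (α : DyadicInterval → ℝ) : Prop := ∀ I, α I = (α I.left + α I.right) / 2

/-- Haar orthogonality in terms of values instead of integrals: both halves of `I` see the same
value unless `I = K`. -/
theorem diff_haarSign (I K : DyadicInterval) :
    diff (fun L => haarSign L K) I = if I = K then 1 else 0 := by
  split_ifs with h
  · subst h
    simp [diff, haarSign_of_subset_left subset_rfl, haarSign_of_subset_right subset_rfl]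
  · by_cases hI : I.toSet ⊆ K.toSet
    · rcases subset_left_or_right hI h with h1 | h1
      · simp [diff, haarSign_of_subset_left (I.left_subset.trans h1),
          haarSign_of_subset_left (I.right_subset.trans h1)]
      · simp [diff, haarSign_of_subset_right (I.left_subset.trans h1),
          haarSign_of_subset_right (I.right_subset.trans h1)]
    -- If a half of `I` lay in a half of `K`, comparison of scales would make `I` either contained
    -- in `K` or disjoint from it, and both are excluded.
    · have aux : ∀ L : DyadicInterval, L.1 = I.1 - 1 → L.toSet ⊆ I.toSet →
          haarSign L K = 0 := by
        intro L hL1 hL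
        by_contra h0
        have h2 := subset_of_haarSign_ne_zero h0
        have h3 : L.1 ≤ K.1 - 1 := by
          unfold haarSign at h0
          split_ifs at h0 with h4 h5
          · exact scale_le_of_subset h4
          · exact scale_le_of_subset h5
          · exact absurd rfl h0
        obtain ⟨x, hx⟩ := L.nonempty_toSet
        rcases toSet_subset_or_disjoint (I := I) (K := K) (by omega) with h6 | h6
        · exact hI h6
        · exact Set.disjoint_left.1 h6 (hL hx) (h2 hx)
      simp [diff, aux I.left rfl I.left_subset, aux I.right rfl I.right_subset]

open Classical in
/-- The dyadic interval between `I` and `K` that is `n` generations below `K`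
(or `I` itself, if that is larger). -/
def proj : ℕ → DyadicInterval → DyadicInterval → DyadicInterval
  | 0, K, _ => K
  | n + 1, K, I =>
    if I.toSet ⊆ K.left.toSet then proj n K.left I
    else if I.toSet ⊆ K.right.toSet then proj n K.right I else K

theorem subset_proj {n : ℕ} {K I : DyadicInterval} (h : I.toSet ⊆ K.toSet) :
    I.toSet ⊆ (proj n K I).toSet := by
  induction n generalizing K with
  | zero => exact h
  | succ n ih =>
    rw [proj]
    split_ifs with h1 h2
    · exact ih h1
    · exact ih h2
    · exact h

theorem proj_eq {n : ℕ} {K I : DyadicInterval} (h : I.toSet ⊆ K.toSet) (hn : K.1 ≤ I.1 + n) :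
    proj n K I = I := by
  induction n generalizing K with
  | zero =>
    exact (eq_of_subset_of_scale h (le_antisymm (scale_le_of_subset h) (by simpa using hn))).symm
  | succ n ih =>
    rw [proj]
    push_cast at hn
    split_ifs with h1 h2
    · exact ih h1 (by simp only [left]; omega)
    · exact ih h2 (by simp only [right]; omega)
    · by_contra h3
      rcases subset_left_or_right h (Ne.symm h3) with h4 | h4
      · exact h1 h4
      · exact h2 h4

theorem sum_tree_of_not_subset {n : ℕ} {K I : DyadicInterval} (h : ¬ I.toSet ⊆ K.toSet)
    (α : DyadicInterval → ℝ) : ∑ L ∈ tree n K, diff α L * haarSign I L = 0 := by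
  refine Finset.sum_eq_zero fun L hL => ?_
  by_contra h0
  exact h ((subset_of_haarSign_ne_zero (right_ne_zero_of_mul h0)).trans (mem_tree.1 hL).1)

/-- Martingale differences along the chain of intervals from `K` down to `I` telescope. The chain
ends after `n` generations or at `I`, whichever comes first, which is what `proj` records. -/
theorem sum_tree_of_subset {n : ℕ} {K I : DyadicInterval} (h : I.toSet ⊆ K.toSet)
    {α : DyadicInterval → ℝ} (hα : Consistent α) :
    ∑ L ∈ tree n K, diff α L * haarSign I L = α (proj n K I) - α K := by
  induction n generalizing K with
  | zero => simp [tree, proj]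
  | succ n ih =>
    rw [sum_tree_succ, proj]
    have hK := hα K
    split_ifs with h1 h2
    · rw [ih h1, sum_tree_of_not_subset (not_subset_right_of_left h1),
        haarSign_of_subset_left h1, diff]
      linarith
    · rw [ih h2, sum_tree_of_not_subset h1, haarSign_of_subset_right h2, diff]
      linarith
    · rw [sum_tree_of_not_subset h1, sum_tree_of_not_subset h2, haarSign, if_neg h1, if_neg h2]
      ring

/-- Valid for every `N`: partial sums are differences of values at two intervals containing `I`,
hence controlled by the maximal function. The two intervals do not depend on `α`, so that the
identity can be used in each variable of a two-parameter family. -/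
theorem exists_sum_box_eq (N : ℕ) (I : DyadicInterval) :
    ∃ K K₀ : DyadicInterval, I.toSet ⊆ K.toSet ∧ I.toSet ⊆ K₀.toSet ∧
      ∀ α, Consistent α → ∑ L ∈ box N, diff α L * haarSign I L = α K - α K₀ := by
  by_cases h1 : I.toSet ⊆ (top N true).toSet
  · refine ⟨_, _, subset_proj (n := 2 * N) h1, h1, fun α hα => ?_⟩
    rw [sum_box, sum_tree_of_subset h1 hα, sum_tree_of_not_subset, add_zero]
    intro h2
    obtain ⟨x, hx⟩ := I.nonempty_toSet
    exact Set.disjoint_left.1 (disjoint_top N) (h1 hx) (h2 hx)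
  · by_cases h2 : I.toSet ⊆ (top N false).toSet
    · refine ⟨_, _, subset_proj (n := 2 * N) h2, h2, fun α hα => ?_⟩
      rw [sum_box, sum_tree_of_subset h2 hα, sum_tree_of_not_subset h1, zero_add]
    · refine ⟨I, I, subset_rfl, subset_rfl, fun α hα => ?_⟩
      rw [sum_box, sum_tree_of_not_subset h1, sum_tree_of_not_subset h2]
      simp

/-- `box N` contains the scales from `N` down to `-N + 1`; as soon as `-N` is at most the scale of
`I`, the telescoping chain reaches `I`. -/
theorem eventually_sum_box_eq (I : DyadicInterval) :
    ∀ᶠ N : ℕ in atTop, ∃ K₀ : DyadicInterval, I.toSet ⊆ K₀.toSet ∧ K₀.1 = N ∧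
      ∀ α, Consistent α → ∑ L ∈ box N, diff α L * haarSign I L = α I - α K₀ := by
  obtain ⟨b, hb⟩ := I.eventually_subset_top
  filter_upwards [hb, eventually_ge_atTop I.1.natAbs] with N h1 h2
  refine ⟨top N b, h1, rfl, fun α hα => ?_⟩
  have h3 : proj (2 * N) (top N b) I = I := proj_eq h1 (by simp only [top]; push_cast; omega)
  have h4 : ¬ I.toSet ⊆ (top N !b).toSet := by
    intro h4
    obtain ⟨x, hx⟩ := I.nonempty_toSet
    cases b
    · exact Set.disjoint_left.1 (disjoint_top N) (h4 hx) (h1 hx)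
    · exact Set.disjoint_left.1 (disjoint_top N) (h1 hx) (h4 hx)
  have h5 := sum_tree_of_subset (n := 2 * N) h1 hα
  have h6 := sum_tree_of_not_subset (n := 2 * N) h4 α
  rw [h3] at h5
  rw [sum_box]
  cases b
  · rw [h5]; simp only [Bool.not_false] at h6; rw [h6]; ring
  · rw [h5]; simp only [Bool.not_true] at h6; rw [h6]; ring

end DyadicInterval

end BiparameterHardy

/-! ### Discrete integration by parts and the two-parameter Carleson embedding. -/

namespace BiparameterHardy

namespace DyadicInterval

open Classical in
/-- The descendants of `I` of generation `n`. -/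
def leaves : ℕ → DyadicInterval → Finset DyadicInterval
  | 0, I => {I}
  | n + 1, I => leaves n I.left ∪ leaves n I.right

theorem subset_of_mem_leaves {n : ℕ} {I K : DyadicInterval} (h : K ∈ leaves n I) :
    K.toSet ⊆ I.toSet := by
  induction n generalizing I with
  | zero => rw [leaves, Finset.mem_singleton] at h; rw [h]
  | succ n ih =>
    rw [leaves, Finset.mem_union] at h
    rcases h with h | h
    · exact (ih h).trans I.left_subset
    · exact (ih h).trans I.right_subset

theorem sum_leaves_succ (n : ℕ) (I : DyadicInterval) (F : DyadicInterval → ℝ) :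
    ∑ K ∈ leaves (n + 1) I, F K = ∑ K ∈ leaves n I.left, F K + ∑ K ∈ leaves n I.right, F K := by
  classical
  rw [leaves, Finset.sum_union]
  exact Finset.disjoint_left.2 fun K h1 h2 =>
    not_subset_right_of_left (subset_of_mem_leaves h1) (subset_of_mem_leaves h2)

/-- A Bellman-type induction: an inequality between an interval and its two halves is summed over
the tree, and the terms in `L` telescope to the leaves. -/
theorem sum_tree_le_sum_leaves {F L H : DyadicInterval → ℝ}
    (h : ∀ I, F I ≤ L I.left + L I.right - L I + H I) (n : ℕ) (I : DyadicInterval) :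
    ∑ K ∈ tree n I, F K ≤ ∑ K ∈ leaves n I, L K - L I + ∑ K ∈ tree n I, H K := by
  induction n generalizing I with
  | zero => simp [tree, leaves]
  | succ n ih =>
    rw [sum_tree_succ, sum_tree_succ, sum_leaves_succ]
    linarith [h I, ih I.left, ih I.right]

theorem sum_leaves_eq {L : DyadicInterval → ℝ} (h : ∀ I, L I = L I.left + L I.right) (n : ℕ)
    (I : DyadicInterval) : ∑ K ∈ leaves n I, L K = L I := by
  induction n generalizing I with
  | zero => simp [leaves]
  | succ n ih => rw [sum_leaves_succ, ih, ih, h I]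

theorem Consistent.left_eq {α : DyadicInterval → ℝ} (h : Consistent α) (I : DyadicInterval) :
    α I.left = α I + diff α I := by rw [diff]; linarith [h I]

theorem Consistent.right_eq {α : DyadicInterval → ℝ} (h : Consistent α) (I : DyadicInterval) :
    α I.right = α I - diff α I := by rw [diff]; linarith [h I]

/-- Integration by parts, moving the difference from `α` to `β`. With `d = diff α K` and `e = diff β
K`, the one-step inequality has as its defect `|K|` times `(d β + 4 α e)² + 2 d² e²`: the cross term
`8 α β d e` is absorbed by completing the square, and `14 = 16 - 2`. -/
theorem sum_diff_sq_mul_sq_le {α β : DyadicInterval → ℝ} (hα : Consistent α) (hβ : Consistent β)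
    (n : ℕ) (I : DyadicInterval) :
    ∑ K ∈ tree n I, K.length * (diff α K ^ 2 * β K ^ 2) ≤
      2 * ∑ K ∈ leaves n I, K.length * (α K ^ 2 * β K ^ 2) +
        14 * ∑ K ∈ tree n I, K.length * (α K ^ 2 * diff β K ^ 2) := by
  have h := sum_tree_le_sum_leaves (F := fun K => K.length * (diff α K ^ 2 * β K ^ 2))
    (L := fun K => 2 * (K.length * (α K ^ 2 * β K ^ 2)))
    (H := fun K => 14 * (K.length * (α K ^ 2 * diff β K ^ 2))) (fun K => by
      rw [length_left, length_right, hα.left_eq, hα.right_eq, hβ.left_eq, hβ.right_eq]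
      have hl := K.length_pos
      have key : 0 ≤ (diff α K * β K + 4 * (α K * diff β K)) ^ 2
        + 2 * (diff α K * diff β K) ^ 2 := by positivity
      nlinarith [mul_nonneg hl.le key]) n I
  rw [← Finset.mul_sum, ← Finset.mul_sum] at h
  have hl := I.length_pos
  have : 0 ≤ 2 * (I.length * (α I ^ 2 * β I ^ 2)) := by positivity
  linarith

theorem sum_diff_sq_le {β : DyadicInterval → ℝ} (hβ : Consistent β) (n : ℕ)
    (I : DyadicInterval) :
    ∑ K ∈ tree n I, K.length * diff β K ^ 2 ≤ ∑ K ∈ leaves n I, K.length * β K ^ 2 := by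
  have h := sum_tree_le_sum_leaves (F := fun K => K.length * diff β K ^ 2)
    (L := fun K => K.length * β K ^ 2) (H := fun _ => 0) (fun K => by
      rw [length_left, length_right, hβ.left_eq, hβ.right_eq]
      exact le_of_eq (by ring)) n I
  have hl := I.length_pos
  have : 0 ≤ I.length * β I ^ 2 := by positivity
  simp only [Finset.sum_const_zero] at h
  linarith

/-- After the integration by parts `α` itself appears only next to `β` or `diff β`, so a bound for
`α` is needed only where one of these is non-zero. Orthogonality controls `diff β`, and `16 = 2 +
14`. -/
theorem sum_diff_sq_mul_sq_le_of_bound {α β : DyadicInterval → ℝ} (hα : Consistent α)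
    (hβ : Consistent β) {c : ℝ} (h : ∀ I, β I ≠ 0 ∨ diff β I ≠ 0 → α I ^ 2 ≤ c)
    (n : ℕ) (I : DyadicInterval) :
    ∑ K ∈ tree n I, K.length * (diff α K ^ 2 * β K ^ 2) ≤
      16 * c * ∑ K ∈ leaves n I, K.length * β K ^ 2 := by
  have h1 : ∑ K ∈ leaves n I, K.length * (α K ^ 2 * β K ^ 2) ≤
      c * ∑ K ∈ leaves n I, K.length * β K ^ 2 := by
    rw [Finset.mul_sum]
    refine Finset.sum_le_sum fun K _ => ?_
    by_cases h0 : β K = 0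
    · simp [h0]
    · have := mul_le_mul_of_nonneg_right (h K (Or.inl h0))
        (mul_nonneg K.length_pos.le (sq_nonneg (β K)))
      linarith
  have h2 : ∑ K ∈ tree n I, K.length * (α K ^ 2 * diff β K ^ 2) ≤
      c * ∑ K ∈ tree n I, K.length * diff β K ^ 2 := by
    rw [Finset.mul_sum]
    refine Finset.sum_le_sum fun K _ => ?_
    by_cases h0 : diff β K = 0
    · simp [h0]
    · have := mul_le_mul_of_nonneg_right (h K (Or.inr h0))
        (mul_nonneg K.length_pos.le (sq_nonneg (diff β K)))
      linarith
  have h3 := sum_diff_sq_le hβ n I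
  by_cases hc : 0 ≤ c
  · have h4 := sum_diff_sq_mul_sq_le hα hβ n I
    have h5 := mul_le_mul_of_nonneg_left h3 hc
    linarith
  · have h0 : ∀ K, β K = 0 := fun K => by
      by_contra h0
      exact hc ((sq_nonneg _).trans (h K (Or.inl h0)))
    simp [h0]

end DyadicInterval

open DyadicInterval

/-- The mixed second difference; `√|R|` times it is the Haar coefficient. -/
def mixedDiff (a : DyadicRectangle → ℝ) (R : DyadicRectangle) : ℝ :=
  diff (fun I => diff (fun J => a (I, J)) R.2) R.1

theorem IsConsistent.fst {a : DyadicRectangle → ℝ} (h : IsConsistent a) (J : DyadicInterval) :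
    Consistent fun I => a (I, J) := fun I => (h I J).1

theorem IsConsistent.snd {a : DyadicRectangle → ℝ} (h : IsConsistent a) (I : DyadicInterval) :
    Consistent fun J => a (I, J) := fun J => (h I J).2

theorem IsConsistent.diff_snd {a : DyadicRectangle → ℝ} (h : IsConsistent a)
    (J : DyadicInterval) : Consistent fun I => diff (fun J => a (I, J)) J := fun I => by
  simp only [diff]
  rw [(h I J.left).1, (h I J.right).1]; ring

theorem IsConsistent.diff_fst {a : DyadicRectangle → ℝ} (h : IsConsistent a)
    (I : DyadicInterval) : Consistent fun J => diff (fun I => a (I, J)) I := fun J => by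
  simp only [diff]
  rw [(h I.left J).2, (h I.right J).2]; ring

/-- A Carleson embedding for families that are bounded where a density `v` does not vanish. -/
theorem sum_mixedDiff_sq_mul_sq_le {u v : DyadicRectangle → ℝ} (hu : IsConsistent u)
    (hv : IsConsistent v) (hv0 : ∀ R, 0 ≤ v R) (hv1 : ∀ R, v R ≤ 1) {c : ℝ}
    (h : ∀ R, v R ≠ 0 → u R ^ 2 ≤ c) (n m : ℕ) (I₀ J₀ : DyadicInterval) :
    ∑ I ∈ tree n I₀, ∑ J ∈ tree m J₀,
        I.length * J.length * (mixedDiff u (I, J) ^ 2 * v (I, J) ^ 2) ≤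
      256 * c * (I₀.length * J₀.length * v (I₀, J₀)) := by
  -- A nonnegative martingale that vanishes on an interval vanishes on both halves, so the bound for
  -- `u` is available wherever some difference of `v` is non-zero.
  have hz1 : ∀ I J, diff (fun I => v (I, J)) I ≠ 0 → v (I, J) ≠ 0 := by
    intro I J h1 h2
    apply h1
    have h3 := (hv I J).1
    have h4 := hv0 (I.left, J)
    have h5 := hv0 (I.right, J)
    rw [diff, show v (I.left, J) = 0 by linarith, show v (I.right, J) = 0 by linarith]; simp
  have hz2 : ∀ I J, diff (fun J => v (I, J)) J ≠ 0 → v (I, J) ≠ 0 := by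
    intro I J h1 h2
    apply h1
    have h3 := (hv I J).2
    have h4 := hv0 (I, J.left)
    have h5 := hv0 (I, J.right)
    rw [diff, show v (I, J.left) = 0 by linarith, show v (I, J.right) = 0 by linarith]; simp
  have hz3 : ∀ I J, diff (fun J => diff (fun I => v (I, J)) I) J ≠ 0 → v (I, J) ≠ 0 := by
    intro I J h1 h2
    have h3 := (hv I J).2
    have h4 := hv0 (I, J.left)
    have h5 := hv0 (I, J.right)
    have h6 : ∀ J', v (I, J') = 0 → diff (fun I => v (I, J')) I = 0 := fun J' h7 => by
      by_contra h8; exact hz1 I J' h8 h7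
    apply h1
    rw [diff, h6 J.left (by linarith), h6 J.right (by linarith)]; simp
  set E : ℝ := ∑ I ∈ leaves n I₀, ∑ J ∈ leaves m J₀, I.length * J.length * v (I, J) ^ 2 with hE
  -- `0 ≤ v ≤ 1` gives `v² ≤ v`, and the integral of the martingale `v` is the same at every
  -- generation.
  have hE1 : E ≤ I₀.length * J₀.length * v (I₀, J₀) := by
    calc E ≤ ∑ I ∈ leaves n I₀, ∑ J ∈ leaves m J₀, I.length * J.length * v (I, J) := by
          refine Finset.sum_le_sum fun I _ => Finset.sum_le_sum fun J _ => ?_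
          have := I.length_pos
          have := J.length_pos
          have h3 : v (I, J) ^ 2 ≤ v (I, J) := by nlinarith [hv0 (I, J), hv1 (I, J)]
          gcongr
      _ = ∑ I ∈ leaves n I₀, I.length * J₀.length * v (I, J₀) := by
          refine Finset.sum_congr rfl fun I _ => ?_
          refine sum_leaves_eq (L := fun J => I.length * J.length * v (I, J)) (fun J => ?_) m J₀
          rw [(hv I J).2, length_left, length_right]; ring
      _ = _ := by
          refine sum_leaves_eq (L := fun I => I.length * J₀.length * v (I, J₀)) (fun I => ?_) n I₀
          rw [(hv I J₀).1, length_left, length_right]; ring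
  have hc : 0 ≤ c ∨ ∀ R, v R = 0 := by
    by_cases hc : 0 ≤ c
    · exact Or.inl hc
    · exact Or.inr fun R => by
        by_contra h0
        exact hc ((sq_nonneg _).trans (h R h0))
  rcases hc with hc | hc
  swap
  · simp [hc]
  -- Integrating by parts in the first variable leaves two sums, one with `v` and one with its
  -- difference in that variable as the cutoff. In both, the one-parameter bound in the second
  -- variable gives `16 c E`; in total `(2 + 14) * 16 = 256`.
  have hA : ∑ I ∈ leaves n I₀, ∑ J ∈ tree m J₀,
      I.length * J.length * (diff (fun J => u (I, J)) J ^ 2 * v (I, J) ^ 2) ≤ 16 * c * E := by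
    rw [hE, Finset.mul_sum]
    refine Finset.sum_le_sum fun I _ => ?_
    have h1 := sum_diff_sq_mul_sq_le_of_bound (hu.snd I) (hv.snd I) (c := c) (fun J hJ =>
      h (I, J) (hJ.elim id (hz2 I J))) m J₀
    have h2 := mul_le_mul_of_nonneg_left h1 I.length_pos.le
    simp only [mul_assoc, Finset.mul_sum] at h2 ⊢
    convert h2 using 2
    ring
  have hB : ∑ I ∈ tree n I₀, ∑ J ∈ tree m J₀, I.length * J.length *
      (diff (fun J => u (I, J)) J ^ 2 * diff (fun I => v (I, J)) I ^ 2) ≤ 16 * c * E := by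
    calc _ ≤ ∑ I ∈ tree n I₀, ∑ J ∈ leaves m J₀, 16 * c * (J.length * (I.length *
          diff (fun I => v (I, J)) I ^ 2)) := by
          refine Finset.sum_le_sum fun I _ => ?_
          have h1 := sum_diff_sq_mul_sq_le_of_bound (hu.snd I) (hv.diff_fst I) (c := c)
            (fun J hJ => h (I, J) (hJ.elim (hz1 I J) (hz3 I J))) m J₀
          have h2 := mul_le_mul_of_nonneg_left h1 I.length_pos.le
          simp only [mul_assoc, Finset.mul_sum] at h2 ⊢
          convert h2 using 2
          ring
      _ = 16 * c * ∑ J ∈ leaves m J₀, J.length * ∑ I ∈ tree n I₀, I.length *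
          diff (fun I => v (I, J)) I ^ 2 := by
          rw [Finset.sum_comm, Finset.mul_sum]
          refine Finset.sum_congr rfl fun J _ => ?_
          rw [Finset.mul_sum, Finset.mul_sum]
      _ ≤ 16 * c * ∑ J ∈ leaves m J₀, J.length * ∑ I ∈ leaves n I₀, I.length * v (I, J) ^ 2 := by
          refine mul_le_mul_of_nonneg_left (Finset.sum_le_sum fun J _ => ?_) (by positivity)
          exact mul_le_mul_of_nonneg_left (sum_diff_sq_le (hv.fst J) n I₀) J.length_pos.le
      _ = 16 * c * E := by
          rw [hE, Finset.sum_comm]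
          congr 1
          refine Finset.sum_congr rfl fun J _ => ?_
          rw [Finset.mul_sum]
          exact Finset.sum_congr rfl fun I _ => by ring
  calc ∑ I ∈ tree n I₀, ∑ J ∈ tree m J₀,
        I.length * J.length * (mixedDiff u (I, J) ^ 2 * v (I, J) ^ 2)
      = ∑ J ∈ tree m J₀, J.length * ∑ I ∈ tree n I₀,
        I.length * (diff (fun I => diff (fun J => u (I, J)) J) I ^ 2 * v (I, J) ^ 2) := by
        rw [Finset.sum_comm]
        refine Finset.sum_congr rfl fun J _ => ?_
        rw [Finset.mul_sum]
        exact Finset.sum_congr rfl fun I _ => by rw [mixedDiff]; ring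
    _ ≤ ∑ J ∈ tree m J₀, J.length *
        (2 * ∑ I ∈ leaves n I₀, I.length * (diff (fun J => u (I, J)) J ^ 2 * v (I, J) ^ 2) +
        14 * ∑ I ∈ tree n I₀, I.length *
          (diff (fun J => u (I, J)) J ^ 2 * diff (fun I => v (I, J)) I ^ 2)) := by
        refine Finset.sum_le_sum fun J _ => mul_le_mul_of_nonneg_left ?_ J.length_pos.le
        exact sum_diff_sq_mul_sq_le (hu.diff_snd J) (hv.fst J) n I₀
    _ = 2 * ∑ I ∈ leaves n I₀, ∑ J ∈ tree m J₀,
          I.length * J.length * (diff (fun J => u (I, J)) J ^ 2 * v (I, J) ^ 2) +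
        14 * ∑ I ∈ tree n I₀, ∑ J ∈ tree m J₀, I.length * J.length *
          (diff (fun J => u (I, J)) J ^ 2 * diff (fun I => v (I, J)) I ^ 2) := by
        rw [Finset.sum_comm (s := leaves n I₀), Finset.sum_comm (s := tree n I₀), Finset.mul_sum,
          Finset.mul_sum, ← Finset.sum_add_distrib]
        refine Finset.sum_congr rfl fun J _ => ?_
        rw [mul_add, Finset.mul_sum, Finset.mul_sum, Finset.mul_sum, Finset.mul_sum,
          Finset.mul_sum, Finset.mul_sum]
        congr 1 <;> exact Finset.sum_congr rfl fun I _ => by ring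
    _ ≤ 256 * c * E := by linarith
    _ ≤ _ := mul_le_mul_of_nonneg_left hE1 (by positivity)

end BiparameterHardy

/-! ### Powers as sums over dyadic levels. -/

namespace BiparameterHardy

/-- The sum of the geometric series with ratio `2^{-p}`. -/
def geomConst (p : ℝ) : ℝ≥0∞ := ∑' n : ℕ, (2 : ℝ≥0∞) ^ (-((n : ℝ) * p))

theorem geomConst_ne_top {p : ℝ} (hp : 0 < p) : geomConst p ≠ ⊤ := by
  have h1 : (2 : ℝ≥0∞) ^ (-p) < 1 := ENNReal.rpow_lt_one_of_one_lt_of_neg (by norm_num) (by linarith)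
  have h2 : geomConst p = ∑' n : ℕ, ((2 : ℝ≥0∞) ^ (-p)) ^ n := by
    refine tsum_congr fun n => ?_
    rw [← ENNReal.rpow_natCast, ← ENNReal.rpow_mul]; congr 1; ring
  rw [h2, ENNReal.tsum_geometric]
  exact ENNReal.inv_ne_top.2 (tsub_pos_of_lt h1).ne'

theorem one_le_geomConst (p : ℝ) : 1 ≤ geomConst p := by
  have := ENNReal.le_tsum (f := fun n : ℕ => (2 : ℝ≥0∞) ^ (-((n : ℝ) * p))) 0
  simpa [geomConst] using this

theorem two_rpow_add (x y : ℝ) : (2 : ℝ≥0∞) ^ (x + y) = 2 ^ x * 2 ^ y :=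
  ENNReal.rpow_add _ _ (by norm_num) (by norm_num)

theorem two_rpow_ne_zero (x : ℝ) : (2 : ℝ≥0∞) ^ x ≠ 0 := by
  simp [ENNReal.rpow_eq_zero_iff]

theorem two_rpow_ne_top (x : ℝ) : (2 : ℝ≥0∞) ^ x ≠ ⊤ := by
  simp [ENNReal.rpow_eq_top_iff]

theorem two_rpow_le {x y : ℝ} (h : x ≤ y) : (2 : ℝ≥0∞) ^ x ≤ 2 ^ y :=
  ENNReal.rpow_le_rpow_of_exponent_le (by norm_num) h

theorem two_rpow_lt_iff {x y : ℝ} : (2 : ℝ≥0∞) ^ x < 2 ^ y ↔ x < y :=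
  ⟨fun h => not_le.1 fun h' => (two_rpow_le h').not_gt h,
    fun h => ENNReal.rpow_lt_rpow_of_exponent_lt (by norm_num) (by norm_num) h⟩

theorem tsum_two_rpow_le (p : ℝ) (K : ℤ) :
    ∑' k : ℤ, (if k ≤ K then (2 : ℝ≥0∞) ^ ((k : ℝ) * p) else 0) =
      geomConst p * 2 ^ ((K : ℝ) * p) := by
  have hinj : Function.Injective fun n : ℕ => K - (n : ℤ) := fun a b h => by
    simp only at h; omega
  rw [← hinj.tsum_eq]
  · rw [geomConst, ← ENNReal.tsum_mul_right]
    refine tsum_congr fun n => ?_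
    rw [if_pos (by omega), ← two_rpow_add]
    congr 1; push_cast; ring
  · intro k hk
    rw [Function.mem_support] at hk
    have : k ≤ K := by by_contra h; simp [h] at hk
    exact ⟨(K - k).toNat, by simp only; omega⟩

theorem exists_dyadic_level {x : ℝ≥0∞} (h0 : x ≠ 0) (h1 : x ≠ ⊤) :
    ∃ K : ℤ, (2 : ℝ≥0∞) ^ (K : ℝ) < x ∧ x ≤ 2 ^ ((K : ℝ) + 1) := by
  obtain ⟨K, hK⟩ := ENNReal.exists_mem_Ioc_zpow h0 h1 (y := 2) (by norm_num) (by norm_num)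
  refine ⟨K, ?_, ?_⟩
  · rw [ENNReal.rpow_intCast]; exact hK.1
  · have h := ENNReal.rpow_intCast 2 (K + 1)
    push_cast at h
    rw [h]; exact hK.2

theorem tsum_level_le {p : ℝ} (hp : 0 < p) (x : ℝ≥0∞) :
    ∑' k : ℤ, (if (2 : ℝ≥0∞) ^ (k : ℝ) < x then (2 : ℝ≥0∞) ^ ((k : ℝ) * p) else 0) ≤
      geomConst p * x ^ p := by
  by_cases h0 : x = 0
  · simp [h0]
  by_cases h1 : x = ⊤
  · rw [h1, ENNReal.top_rpow_of_pos hp, ENNReal.mul_top]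
    · exact le_top
    · exact (zero_lt_one.trans_le (one_le_geomConst p)).ne'
  obtain ⟨K, hK, hK'⟩ := exists_dyadic_level h0 h1
  calc _ ≤ ∑' k : ℤ, (if k ≤ K then (2 : ℝ≥0∞) ^ ((k : ℝ) * p) else 0) := by
        refine ENNReal.tsum_le_tsum fun k => ?_
        split_ifs with h2 h3 h3
        · exact le_rfl
        · exfalso
          apply h3
          have h4 := two_rpow_lt_iff.1 (h2.trans_le hK')
          have h5 : k < K + 1 := by exact_mod_cast h4
          omega
        · exact zero_le
        · exact le_rfl
    _ = geomConst p * 2 ^ ((K : ℝ) * p) := tsum_two_rpow_le p K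
    _ ≤ _ := by
        rw [ENNReal.rpow_mul]
        gcongr

theorem rpow_le_tsum_level {p : ℝ} (hp : 0 < p) (x : ℝ≥0∞) :
    x ^ p ≤ 2 ^ p *
      ∑' k : ℤ, (if (2 : ℝ≥0∞) ^ (k : ℝ) < x then (2 : ℝ≥0∞) ^ ((k : ℝ) * p) else 0) := by
  by_cases h0 : x = 0
  · simp [h0, hp]
  by_cases h1 : x = ⊤
  · have : ∑' k : ℤ, (if (2 : ℝ≥0∞) ^ (k : ℝ) < x then (2 : ℝ≥0∞) ^ ((k : ℝ) * p) else 0) = ⊤ := by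
      rw [← top_le_iff]
      calc (⊤ : ℝ≥0∞) = ∑' _ : ℕ, (1 : ℝ≥0∞) :=
            (ENNReal.tsum_const_eq_top_of_ne_zero one_ne_zero).symm
        _ ≤ ∑' n : ℕ, (if (2 : ℝ≥0∞) ^ (((n : ℤ) : ℝ)) < x then
              (2 : ℝ≥0∞) ^ (((n : ℤ) : ℝ) * p) else 0) := by
            refine ENNReal.tsum_le_tsum fun n => ?_
            rw [if_pos (h1 ▸ (two_rpow_ne_top _).lt_top)]
            rcases n.eq_zero_or_pos with rfl | hn
            · simp
            · exact ENNReal.one_le_rpow (by norm_num) (by push_cast; positivity)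
        _ ≤ _ := ENNReal.tsum_comp_le_tsum_of_injective (f := fun n : ℕ => (n : ℤ))
            Nat.cast_injective _
    rw [this, ENNReal.mul_top (two_rpow_ne_zero p)]
    exact le_top
  obtain ⟨K, hK, hK'⟩ := exists_dyadic_level h0 h1
  calc x ^ p ≤ (2 ^ ((K : ℝ) + 1)) ^ p := by gcongr
    _ = 2 ^ p * (if (2 : ℝ≥0∞) ^ (K : ℝ) < x then (2 : ℝ≥0∞) ^ ((K : ℝ) * p) else 0) := by
        rw [if_pos hK, ← ENNReal.rpow_mul, ← two_rpow_add]; congr 1; ring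
    _ ≤ _ := by
        gcongr
        exact ENNReal.le_tsum (f := fun k : ℤ =>
          (if (2 : ℝ≥0∞) ^ (k : ℝ) < x then (2 : ℝ≥0∞) ^ ((k : ℝ) * p) else 0)) K

/-! ### Dyadic maximal functions on the line and in the plane. -/

open DyadicInterval

/-- The dyadic maximal function on the line. -/
def maximalLine (g : ℝ → ℝ≥0∞) (x : ℝ) : ℝ≥0∞ :=
  ⨆ I : DyadicInterval, I.toSet.indicator (fun _ => (∫⁻ y in I.toSet, g y) / volume I.toSet) x

theorem measurable_maximalLine (g : ℝ → ℝ≥0∞) : Measurable (maximalLine g) :=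
  Measurable.iSup fun I => measurable_const.indicator I.measurableSet_toSet

theorem le_maximalLine {g : ℝ → ℝ≥0∞} {I : DyadicInterval} {x : ℝ} (hx : x ∈ I.toSet) :
    (∫⁻ y in I.toSet, g y) / volume I.toSet ≤ maximalLine g x := by
  refine le_trans (le_of_eq ?_) (le_iSup _ I)
  rw [Set.indicator_of_mem hx]

theorem exists_of_lt_maximalLine {g : ℝ → ℝ≥0∞} {x : ℝ} {c : ℝ≥0∞} (h : c < maximalLine g x) :
    ∃ I : DyadicInterval, x ∈ I.toSet ∧ c < (∫⁻ y in I.toSet, g y) / volume I.toSet := by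
  obtain ⟨I, hI⟩ := lt_iSup_iff.1 h
  by_cases hx : x ∈ I.toSet
  · rw [Set.indicator_of_mem hx] at hI; exact ⟨I, hx, hI⟩
  · rw [Set.indicator_of_notMem hx] at hI; exact absurd hI not_lt_zero

/-- The inclusion-maximal members of a finite family of dyadic intervals are pairwise disjoint and
cover the same set, so no constant is lost. -/
theorem mul_volume_biUnion_le (g : ℝ → ℝ≥0∞) (c : ℝ≥0∞) (F : Finset DyadicInterval)
    (h : ∀ I ∈ F, c * volume I.toSet ≤ ∫⁻ y in I.toSet, g y) :
    c * volume (⋃ I ∈ F, I.toSet) ≤ ∫⁻ y, g y := by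
  classical
  set F' := F.filter fun I => ∀ K ∈ F, I.toSet ⊆ K.toSet → I = K with hF'
  have hsub : ⋃ I ∈ F, I.toSet ⊆ ⋃ I ∈ F', I.toSet := by
    refine Set.iUnion₂_subset fun I hI => ?_
    obtain ⟨K, hK, hmax⟩ := Finset.exists_max_image (F.filter fun K => I.toSet ⊆ K.toSet)
      (fun K => K.1) ⟨I, by simp [hI]⟩
    rw [Finset.mem_filter] at hK
    refine hK.2.trans (Set.subset_biUnion_of_mem (u := fun K : DyadicInterval => K.toSet) ?_)
    refine Finset.mem_coe.2 (Finset.mem_filter.2 ⟨hK.1, fun L hL hKL => ?_⟩)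
    exact eq_of_subset_of_scale hKL (le_antisymm (scale_le_of_subset hKL)
      (hmax L (Finset.mem_filter.2 ⟨hL, hK.2.trans hKL⟩)))
  have hdisj : (F' : Set DyadicInterval).PairwiseDisjoint fun I => I.toSet := by
    intro I hI K hK hne
    have hI' := Finset.mem_filter.1 (Finset.mem_coe.1 hI)
    have hK' := Finset.mem_filter.1 (Finset.mem_coe.1 hK)
    rcases le_total I.1 K.1 with h1 | h1
    · exact (toSet_subset_or_disjoint h1).resolve_left fun h2 => hne (hI'.2 K hK'.1 h2)
    · exact ((toSet_subset_or_disjoint h1).resolve_left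
        fun h2 => hne (hK'.2 I hI'.1 h2).symm).symm
  calc c * volume (⋃ I ∈ F, I.toSet) ≤ c * ∑ I ∈ F', volume I.toSet := by
        gcongr
        exact (measure_mono hsub).trans (measure_biUnion_finset_le _ _)
    _ ≤ ∑ I ∈ F', ∫⁻ y in I.toSet, g y := by
        rw [Finset.mul_sum]
        exact Finset.sum_le_sum fun I hI => h I (Finset.mem_filter.1 hI).1
    _ = ∫⁻ y in ⋃ I ∈ F', I.toSet, g y :=
        (lintegral_biUnion_finset hdisj (fun I _ => I.measurableSet_toSet) g).symm
    _ ≤ _ := setLIntegral_le_lintegral _ _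

/-- The weak type (1,1) inequality, from finite families by continuity of the measure along a
directed union. -/
theorem mul_volume_lt_maximalLine_le (g : ℝ → ℝ≥0∞) (c : ℝ≥0∞) :
    c * volume {x | c < maximalLine g x} ≤ ∫⁻ y, g y := by
  classical
  set A := {I : DyadicInterval // c * volume I.toSet ≤ ∫⁻ y in I.toSet, g y} with hA
  have hsub : {x | c < maximalLine g x} ⊆ ⋃ F : Finset A, ⋃ I ∈ F, I.1.toSet := by
    intro x hx
    obtain ⟨I, hI, h1⟩ := exists_of_lt_maximalLine hx
    have h2 : c * volume I.toSet ≤ ∫⁻ y in I.toSet, g y :=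
      (ENNReal.le_div_iff_mul_le (Or.inl I.volume_toSet_ne_zero)
        (Or.inl I.volume_toSet_ne_top)).1 h1.le
    exact Set.mem_iUnion.2 ⟨{⟨I, h2⟩}, by simpa using hI⟩
  have hdir : Directed (· ⊆ ·) fun F : Finset A => ⋃ I ∈ F, I.1.toSet := by
    intro F G
    exact ⟨F ∪ G, Set.biUnion_subset_biUnion_left fun x hx => Finset.mem_union_left _ hx,
      Set.biUnion_subset_biUnion_left fun x hx => Finset.mem_union_right _ hx⟩
  refine (mul_le_mul_right (measure_mono hsub) c).trans ?_
  rw [hdir.measure_iUnion, ENNReal.mul_iSup]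
  refine iSup_le fun F => ?_
  have h := mul_volume_biUnion_le g c (F.image Subtype.val) (fun I hI => by
    obtain ⟨K, _, rfl⟩ := Finset.mem_image.1 hI
    exact K.2)
  rwa [Finset.set_biUnion_finset_image] at h

/-- The constant in the `L^t` inequality for `maximalLine`. -/
def maximalConst (t : ℝ) : ℝ≥0∞ := 2 ^ t * (2 ^ t * geomConst (t - 1))

theorem maximalConst_ne_top {t : ℝ} (ht : 1 < t) : maximalConst t ≠ ⊤ :=
  ENNReal.mul_ne_top (two_rpow_ne_top _)
    (ENNReal.mul_ne_top (two_rpow_ne_top _) (geomConst_ne_top (by linarith)))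

/-- Marcinkiewicz interpolation between weak type (1,1) and the trivial `L^∞` bound, with `g` cut
off at the dyadic heights `2^k`. -/
theorem lintegral_maximalLine_rpow_le {t : ℝ} (ht : 1 < t) {g : ℝ → ℝ≥0∞} (hg : Measurable g) :
    ∫⁻ x, maximalLine g x ^ t ≤ maximalConst t * ∫⁻ x, g x ^ t := by
  have ht0 : 0 < t := by linarith
  set gk : ℤ → ℝ → ℝ≥0∞ := fun k => {x | (2 : ℝ≥0∞) ^ (k : ℝ) < g x}.indicator g with hgk
  have hset : ∀ k : ℤ, MeasurableSet {x | (2 : ℝ≥0∞) ^ (k : ℝ) < g x} := fun k =>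
    measurableSet_lt measurable_const hg
  -- The part of `g` below `2^k` contributes at most `2^k` to an average, so an average above `2 *
  -- 2^k` stays above `2^k` when this part is dropped.
  have hsplit : ∀ (k : ℤ) x, (2 : ℝ≥0∞) ^ (k : ℝ) < maximalLine g x / 2 →
      (2 : ℝ≥0∞) ^ (k : ℝ) < maximalLine (gk k) x := by
    intro k x hx
    rw [ENNReal.lt_div_iff_mul_lt (Or.inl (by norm_num)) (Or.inl (by norm_num))] at hx
    obtain ⟨I, hI, h1⟩ := exists_of_lt_maximalLine hx
    refine lt_of_lt_of_le ?_ (le_maximalLine hI)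
    have h2 : (∫⁻ y in I.toSet, g y) / volume I.toSet ≤
        (∫⁻ y in I.toSet, gk k y) / volume I.toSet + 2 ^ (k : ℝ) := by
      calc (∫⁻ y in I.toSet, g y) / volume I.toSet
          ≤ (∫⁻ y in I.toSet, (gk k y + 2 ^ (k : ℝ))) / volume I.toSet := by
            gcongr with y
            by_cases hy : (2 : ℝ≥0∞) ^ (k : ℝ) < g y
            · rw [hgk]; simp only
              rw [Set.indicator_of_mem (by exact hy)]; exact le_self_add
            · exact (not_lt.1 hy).trans le_add_self
        _ = _ := by
            rw [lintegral_add_right _ measurable_const, setLIntegral_const, ENNReal.add_div,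
              ENNReal.mul_div_cancel_right I.volume_toSet_ne_zero I.volume_toSet_ne_top]
    have h3 := h1.trans_le h2
    rw [mul_two] at h3
    exact lt_of_add_lt_add_right h3
  calc ∫⁻ x, maximalLine g x ^ t = ∫⁻ x, 2 ^ t * (maximalLine g x / 2) ^ t := by
        refine lintegral_congr fun x => ?_
        rw [← ENNReal.mul_rpow_of_nonneg _ _ ht0.le, ENNReal.mul_div_cancel (by norm_num)
          (by norm_num)]
    _ ≤ ∫⁻ x, 2 ^ t * (2 ^ t * ∑' k : ℤ, {x | (2 : ℝ≥0∞) ^ (k : ℝ) < maximalLine (gk k) x}.indicator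
          (fun _ => (2 : ℝ≥0∞) ^ ((k : ℝ) * t)) x) := by
        refine lintegral_mono fun x => mul_le_mul_right ?_ _
        refine (rpow_le_tsum_level ht0 _).trans (mul_le_mul_right ?_ _)
        refine ENNReal.tsum_le_tsum fun k => ?_
        split_ifs with h
        · rw [Set.indicator_of_mem (by exact hsplit k x h)]
        · exact zero_le
    _ = 2 ^ t * (2 ^ t * ∑' k : ℤ, 2 ^ ((k : ℝ) * t) *
          volume {x | (2 : ℝ≥0∞) ^ (k : ℝ) < maximalLine (gk k) x}) := by
        have hm : ∀ k : ℤ, MeasurableSet {x | (2 : ℝ≥0∞) ^ (k : ℝ) < maximalLine (gk k) x} :=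
          fun k => measurableSet_lt measurable_const (measurable_maximalLine _)
        rw [lintegral_const_mul' _ _ (two_rpow_ne_top _), lintegral_const_mul' _ _
          (two_rpow_ne_top _), lintegral_tsum fun k => (measurable_const.indicator (hm k)).aemeasurable]
        congr 3
        refine funext fun k => ?_
        rw [lintegral_indicator_const (hm k)]
    _ ≤ 2 ^ t * (2 ^ t * ∑' k : ℤ, 2 ^ ((k : ℝ) * (t - 1)) * ∫⁻ x, gk k x) := by
        refine mul_le_mul_right (mul_le_mul_right (ENNReal.tsum_le_tsum fun k => ?_) _) _
        rw [show (k : ℝ) * t = k * (t - 1) + k by ring, two_rpow_add, mul_assoc]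
        exact mul_le_mul_right (mul_volume_lt_maximalLine_le _ _) _
    _ = 2 ^ t * (2 ^ t * ∫⁻ x, g x * ∑' k : ℤ,
          (if (2 : ℝ≥0∞) ^ (k : ℝ) < g x then (2 : ℝ≥0∞) ^ ((k : ℝ) * (t - 1)) else 0)) := by
        congr 2
        simp_rw [← lintegral_const_mul' _ _ (two_rpow_ne_top _)]
        rw [← lintegral_tsum fun k => ((hg.indicator (hset k)).const_mul _).aemeasurable]
        refine lintegral_congr fun x => ?_
        rw [← ENNReal.tsum_mul_left]
        refine tsum_congr fun k => ?_
        by_cases h : (2 : ℝ≥0∞) ^ (k : ℝ) < g x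
        · rw [if_pos h, Set.indicator_of_mem (by exact h), mul_comm]
        · rw [if_neg h, Set.indicator_of_notMem (by exact h), mul_zero, mul_zero]
    _ ≤ 2 ^ t * (2 ^ t * ∫⁻ x, geomConst (t - 1) * g x ^ t) := by
        refine mul_le_mul_right (mul_le_mul_right (lintegral_mono fun x => ?_) _) _
        refine (mul_le_mul_right (tsum_level_le (by linarith : 0 < t - 1) (g x)) _).trans
          (le_of_eq ?_)
        rw [show t = 1 + (t - 1) by ring, ENNReal.rpow_add_of_nonneg _ _ (by norm_num) (by linarith),
          ENNReal.rpow_one]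
        simp only [add_sub_cancel_left]
        ring
    _ = _ := by
        rw [lintegral_const_mul' _ _ (geomConst_ne_top (by linarith)), maximalConst]; ring

/-- The dyadic strong maximal function of a nonnegative function on the plane. -/
def maximalPlane (g : ℝ × ℝ → ℝ≥0∞) (z : ℝ × ℝ) : ℝ≥0∞ :=
  ⨆ (R : DyadicRectangle) (_ : z ∈ R.toSet), (∫⁻ w in R.toSet, g w) / volume R.toSet

theorem DyadicRectangle.volume_toSet (R : DyadicRectangle) :
    volume R.toSet = volume R.1.toSet * volume R.2.toSet := by
  rw [DyadicRectangle.toSet, Measure.volume_eq_prod, Measure.prod_prod]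

theorem DyadicRectangle.volume_toSet_ne_zero (R : DyadicRectangle) : volume R.toSet ≠ 0 := by
  rw [DyadicRectangle.volume_toSet]
  exact mul_ne_zero R.1.volume_toSet_ne_zero R.2.volume_toSet_ne_zero

theorem DyadicRectangle.volume_toSet_ne_top (R : DyadicRectangle) : volume R.toSet ≠ ⊤ := by
  rw [DyadicRectangle.volume_toSet]
  exact ENNReal.mul_ne_top R.1.volume_toSet_ne_top R.2.volume_toSet_ne_top

/-- By Tonelli, the average over a rectangle is an average in the first variable of averages in the
second, and each is bounded by a one-parameter maximal function. -/
theorem maximalPlane_le {g : ℝ × ℝ → ℝ≥0∞} (hg : Measurable g) (z : ℝ × ℝ) :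
    maximalPlane g z ≤ maximalLine (fun x => maximalLine (fun y => g (x, y)) z.2) z.1 := by
  refine iSup₂_le fun R hR => ?_
  refine le_trans ?_ (le_maximalLine hR.1)
  rw [DyadicRectangle.volume_toSet, DyadicRectangle.toSet, Measure.volume_eq_prod,
    ← Measure.prod_restrict, lintegral_prod _ hg.aemeasurable, mul_comm, div_eq_mul_inv,
    ENNReal.mul_inv (Or.inl R.2.volume_toSet_ne_zero) (Or.inl R.2.volume_toSet_ne_top),
    ← mul_assoc, ← div_eq_mul_inv, ← div_eq_mul_inv]
  refine ENNReal.div_le_div_right ?_ _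
  rw [ENNReal.div_le_iff R.2.volume_toSet_ne_zero R.2.volume_toSet_ne_top,
    ← lintegral_mul_const' _ _ R.2.volume_toSet_ne_top]
  refine lintegral_mono fun x => ?_
  rw [← ENNReal.div_le_iff R.2.volume_toSet_ne_zero R.2.volume_toSet_ne_top]
  exact le_maximalLine hR.2

theorem measurable_maximalLine_snd {g : ℝ × ℝ → ℝ≥0∞} (hg : Measurable g) :
    Measurable fun z : ℝ × ℝ => maximalLine (fun y => g (z.1, y)) z.2 := by
  unfold maximalLine
  refine Measurable.iSup fun I => ?_
  have h1 : Measurable fun z : ℝ × ℝ => (∫⁻ y in I.toSet, g (z.1, y)) / volume I.toSet :=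
    (hg.lintegral_prod_right'.comp measurable_fst).div_const _
  have h2 : MeasurableSet {z : ℝ × ℝ | z.2 ∈ I.toSet} := measurable_snd I.measurableSet_toSet
  exact h1.indicator h2

theorem lintegral_maximalPlane_rpow_le {t : ℝ} (ht : 1 < t) {g : ℝ × ℝ → ℝ≥0∞}
    (hg : Measurable g) :
    ∫⁻ z, maximalPlane g z ^ t ≤ maximalConst t ^ 2 * ∫⁻ z, g z ^ t := by
  have hC := maximalConst_ne_top ht
  obtain ⟨h, hh⟩ : ∃ h : ℝ × ℝ → ℝ≥0∞, h = fun z => maximalLine (fun y => g (z.1, y)) z.2 :=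
    ⟨_, rfl⟩
  have hm : Measurable h := hh ▸ measurable_maximalLine_snd hg
  have h1 : ∀ z, maximalPlane g z ≤ maximalLine (fun x => h (x, z.2)) z.1 := by
    rw [hh]; exact maximalPlane_le hg
  have h2 : ∀ x, ∫⁻ y, h (x, y) ^ t ≤ maximalConst t * ∫⁻ y, g (x, y) ^ t := by
    rw [hh]
    exact fun x => lintegral_maximalLine_rpow_le ht (hg.comp measurable_prodMk_left)
  have hm' : Measurable fun z : ℝ × ℝ => maximalLine (fun x => h (x, z.2)) z.1 :=
    (measurable_maximalLine_snd (g := fun z => h z.swap) (hm.comp measurable_swap)).comp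
      measurable_swap
  calc ∫⁻ z, maximalPlane g z ^ t ≤ ∫⁻ z : ℝ × ℝ, maximalLine (fun x => h (x, z.2)) z.1 ^ t := by
        refine lintegral_mono fun z => ?_
        exact ENNReal.rpow_le_rpow (h1 z) (by linarith)
    _ = ∫⁻ y, ∫⁻ x, maximalLine (fun x => h (x, y)) x ^ t := by
        rw [Measure.volume_eq_prod, lintegral_prod_symm _ (hm'.pow_const t).aemeasurable]
    _ ≤ ∫⁻ y, maximalConst t * ∫⁻ x, h (x, y) ^ t :=
        lintegral_mono fun y => lintegral_maximalLine_rpow_le ht (hm.comp measurable_prodMk_right)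
    _ = maximalConst t * ∫⁻ x, ∫⁻ y, h (x, y) ^ t := by
        rw [lintegral_const_mul' _ _ hC, ← lintegral_prod_symm (fun z => h z ^ t)
          (hm.pow_const t).aemeasurable, lintegral_prod _ (hm.pow_const t).aemeasurable]
    _ ≤ maximalConst t * ∫⁻ x, maximalConst t * ∫⁻ y, g (x, y) ^ t := by
        gcongr with x
        exact h2 x
    _ = _ := by
        rw [lintegral_const_mul' _ _ hC, Measure.volume_eq_prod,
          lintegral_prod _ (hg.pow_const t).aemeasurable]
        ring

theorem maximalFun_averages_le (f : PlaneFun) (z : ℝ × ℝ) :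
    maximalFun (averages f) z ≤ maximalPlane (fun w => ‖f w‖ₑ) z := by
  refine iSup₂_mono fun R hR => ?_
  rw [averages, ← Real.enorm_eq_ofReal_abs, setAverage_eq, enorm_smul, mul_comm, div_eq_mul_inv]
  gcongr
  · exact enorm_integral_le_lintegral_enorm _
  · rw [measureReal_def, Real.enorm_eq_ofReal_abs, abs_inv, abs_of_nonneg ENNReal.toReal_nonneg,
      ENNReal.ofReal_inv_of_pos (ENNReal.toReal_pos R.volume_toSet_ne_zero R.volume_toSet_ne_top),
      ENNReal.ofReal_toReal R.volume_toSet_ne_top]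

theorem lintegral_maximalFun_averages_rpow_le {t : ℝ} (ht : 1 < t) (f : PlaneFun) :
    ∫⁻ z, maximalFun (averages f) z ^ t ≤ maximalConst t ^ 2 * ∫⁻ z, ‖f z‖ₑ ^ t :=
  (lintegral_mono fun z => ENNReal.rpow_le_rpow (maximalFun_averages_le f z)
    (by linarith)).trans (lintegral_maximalPlane_rpow_le ht f.measurable.enorm)

end BiparameterHardy

/-! ### Summing pieces of height `2^k` carried by sets `U k`. -/

namespace BiparameterHardy

theorem sum_two_rpow_le {A : Finset ℤ} {K : ℤ} (h : ∀ k ∈ A, k ≤ K) (p : ℝ) :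
    ∑ k ∈ A, (2 : ℝ≥0∞) ^ ((k : ℝ) * p) ≤ geomConst p * 2 ^ ((K : ℝ) * p) := by
  rw [← tsum_two_rpow_le]
  refine le_trans (le_of_eq ?_) (ENNReal.sum_le_tsum A)
  exact Finset.sum_congr rfl fun k hk => by rw [if_pos (h k hk)]

section

variable {α : Type*} [MeasurableSpace α] {μ : Measure α}

theorem tsum_measure_level_le {p : ℝ} (hp : 0 < p) {F : α → ℝ≥0∞} (hF : Measurable F) :
    ∑' k : ℤ, (2 : ℝ≥0∞) ^ ((k : ℝ) * p) * μ {z | (2 : ℝ≥0∞) ^ (k : ℝ) < F z} ≤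
      geomConst p * ∫⁻ z, F z ^ p ∂μ := by
  have hm : ∀ k : ℤ, MeasurableSet {z | (2 : ℝ≥0∞) ^ (k : ℝ) < F z} := fun k =>
    measurableSet_lt measurable_const hF
  calc _ = ∑' k : ℤ, ∫⁻ z, {z | (2 : ℝ≥0∞) ^ (k : ℝ) < F z}.indicator
        (fun _ => (2 : ℝ≥0∞) ^ ((k : ℝ) * p)) z ∂μ :=
        tsum_congr fun k => by rw [lintegral_indicator_const (hm k)]
    _ = ∫⁻ z, ∑' k : ℤ, {z | (2 : ℝ≥0∞) ^ (k : ℝ) < F z}.indicator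
        (fun _ => (2 : ℝ≥0∞) ^ ((k : ℝ) * p)) z ∂μ :=
        (lintegral_tsum fun k => (measurable_const.indicator (hm k)).aemeasurable).symm
    _ ≤ ∫⁻ z, geomConst p * F z ^ p ∂μ := lintegral_mono fun z => by
        refine le_trans (le_of_eq (tsum_congr fun k => ?_)) (tsum_level_le hp (F z))
        simp only [Set.indicator, Set.mem_ofPred_eq]
    _ = _ := lintegral_const_mul' _ _ (geomConst_ne_top hp)

/-- Summation of pieces `F k` of height `2^k` in `L^q` that live on sets `U k`. -/
theorem lintegral_sum_rpow_le {p q : ℝ} (hp : 0 < p) (hpq : p < q) (S : Finset ℤ)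
    {F : ℤ → α → ℝ≥0∞} {U : ℤ → Set α} {m : ℤ → ℝ≥0∞} (hF : ∀ k ∈ S, Measurable (F k))
    (hU : ∀ k ∈ S, MeasurableSet (U k)) (hFU : ∀ k ∈ S, ∀ z ∉ U k, F k z = 0)
    (hm : ∀ k ∈ S, ∫⁻ z, F k z ^ q ∂μ ≤ 2 ^ ((k : ℝ) * q) * m k) :
    ∫⁻ z, (∑ k ∈ S, F k z) ^ p ∂μ ≤ geomConst ((q - p) / q) ^ p *
      ((∑ k ∈ S, 2 ^ ((k : ℝ) * p) * m k) ^ (p / q) *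
        (∑ k ∈ S, 2 ^ ((k : ℝ) * p) * μ (U k)) ^ (1 - p / q)) := by
  classical
  have hq : 0 < q := hp.trans hpq
  have hpq1 : p / q < 1 := (div_lt_one hq).2 hpq
  -- `D` collects the sizes of the pieces and `W` their supports, both weighted so that the
  -- integrals are bounded by the two sums in the conclusion. The claim then follows from a
  -- pointwise bound by `D^{p/q} W^{1-p/q}` and Hölder's inequality.
  set D : α → ℝ≥0∞ := fun z => ∑ k ∈ S, 2 ^ ((k : ℝ) * (p - q)) * F k z ^ q with hD
  set W : α → ℝ≥0∞ := fun z => ∑ k ∈ S, (U k).indicator (fun _ => 2 ^ ((k : ℝ) * p)) z with hW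
  have hDm : Measurable D :=
    Finset.measurable_fun_sum S fun k hk => ((hF k hk).pow_const q).const_mul _
  have hWm : Measurable W :=
    Finset.measurable_fun_sum S fun k hk => measurable_const.indicator (hU k hk)
  have hDi : ∫⁻ z, D z ∂μ ≤ ∑ k ∈ S, 2 ^ ((k : ℝ) * p) * m k := by
    rw [lintegral_finsetSum' S fun k hk => (((hF k hk).pow_const q).const_mul _).aemeasurable]
    refine Finset.sum_le_sum fun k hk => ?_
    rw [lintegral_const_mul' _ _ (two_rpow_ne_top _)]
    refine (mul_le_mul_right (hm k hk) _).trans (le_of_eq ?_)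
    rw [← mul_assoc, ← two_rpow_add]; congr 2; ring
  have hWi : ∫⁻ z, W z ∂μ = ∑ k ∈ S, 2 ^ ((k : ℝ) * p) * μ (U k) := by
    rw [lintegral_finsetSum' S fun k hk => (measurable_const.indicator (hU k hk)).aemeasurable]
    exact Finset.sum_congr rfl fun k hk => by rw [lintegral_indicator_const (hU k hk)]
  have key : ∀ z, (∑ k ∈ S, F k z) ^ p ≤
      geomConst ((q - p) / q) ^ p * (D z ^ (p / q) * W z ^ (1 - p / q)) := by
    intro z
    set A := S.filter fun k => z ∈ U k with hA
    have hsum : ∑ k ∈ S, F k z = ∑ k ∈ A, F k z := by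
      rw [hA, Finset.sum_filter]
      refine Finset.sum_congr rfl fun k hk => ?_
      split_ifs with h
      · rfl
      · exact hFU k hk z h
    rcases A.eq_empty_or_nonempty with hA0 | hA0
    · rw [hsum, hA0]; simp [hp]
    -- Let `K` be the top level present at `z`. The bounds `F_k ≤ 2^{k(q-p)/q} D^{1/q}` grow
    -- geometrically because `p < q`, so their sum is comparable to the term at `K`; and `2^{Kp} ≤
    -- W`.
    obtain ⟨K, hK, hmax⟩ := Finset.exists_max_image A (fun k => k) hA0
    have hKS := Finset.mem_filter.1 hK
    have h1 : ∀ k ∈ A, F k z ≤ 2 ^ ((k : ℝ) * ((q - p) / q)) * D z ^ (1 / q) := by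
      intro k hk
      have hkS := (Finset.mem_filter.1 hk).1
      have h2 : 2 ^ ((k : ℝ) * (p - q)) * F k z ^ q ≤ D z :=
        Finset.single_le_sum (f := fun k : ℤ => (2 : ℝ≥0∞) ^ ((k : ℝ) * (p - q)) * F k z ^ q)
          (fun _ _ => zero_le) hkS
      calc F k z = 2 ^ ((k : ℝ) * ((q - p) / q)) *
            (2 ^ ((k : ℝ) * (p - q)) * F k z ^ q) ^ (1 / q) := by
            rw [ENNReal.mul_rpow_of_nonneg _ _ (by positivity), ← ENNReal.rpow_mul,
              ← ENNReal.rpow_mul, ← mul_assoc, ← two_rpow_add,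
              mul_one_div_cancel hq.ne', ENNReal.rpow_one,
              show (k : ℝ) * ((q - p) / q) + k * (p - q) * (1 / q) = 0 by field_simp; ring]
            simp
        _ ≤ _ := by gcongr
    have h2 : ∑ k ∈ S, F k z ≤
        geomConst ((q - p) / q) * 2 ^ ((K : ℝ) * ((q - p) / q)) * D z ^ (1 / q) := by
      rw [hsum]
      refine (Finset.sum_le_sum h1).trans ?_
      rw [← Finset.sum_mul]
      exact mul_le_mul_left (sum_two_rpow_le hmax _) _
    have h3 : (2 : ℝ≥0∞) ^ ((K : ℝ) * p) ≤ W z := by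
      refine le_trans (le_of_eq ?_) (Finset.single_le_sum (f := fun k : ℤ =>
        (U k).indicator (fun _ => (2 : ℝ≥0∞) ^ ((k : ℝ) * p)) z) (fun _ _ => zero_le) hKS.1)
      rw [Set.indicator_of_mem hKS.2]
    calc (∑ k ∈ S, F k z) ^ p ≤
        (geomConst ((q - p) / q) * 2 ^ ((K : ℝ) * ((q - p) / q)) * D z ^ (1 / q)) ^ p := by
          gcongr
      _ = geomConst ((q - p) / q) ^ p *
          (D z ^ (p / q) * (2 ^ ((K : ℝ) * p)) ^ (1 - p / q)) := by
          rw [ENNReal.mul_rpow_of_nonneg _ _ hp.le, ENNReal.mul_rpow_of_nonneg _ _ hp.le,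
            ← ENNReal.rpow_mul, ← ENNReal.rpow_mul, ← ENNReal.rpow_mul, mul_assoc,
            mul_comm (D z ^ _), show 1 / q * p = p / q by ring,
            show (K : ℝ) * ((q - p) / q) * p = K * p * (1 - p / q) by field_simp]
      _ ≤ _ := by
          have : 0 ≤ 1 - p / q := by linarith
          gcongr
  calc ∫⁻ z, (∑ k ∈ S, F k z) ^ p ∂μ
      ≤ ∫⁻ z, geomConst ((q - p) / q) ^ p * (D z ^ (p / q) * W z ^ (1 - p / q)) ∂μ :=
        lintegral_mono key
    _ = geomConst ((q - p) / q) ^ p * ∫⁻ z, D z ^ (p / q) * W z ^ (1 - p / q) ∂μ :=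
        lintegral_const_mul' _ _ (ENNReal.rpow_ne_top_of_nonneg hp.le
          (geomConst_ne_top (div_pos (by linarith) hq)))
    _ ≤ geomConst ((q - p) / q) ^ p *
        ((∫⁻ z, D z ∂μ) ^ (p / q) * (∫⁻ z, W z ∂μ) ^ (1 - p / q)) := by
        gcongr
        exact ENNReal.lintegral_mul_norm_pow_le hDm.aemeasurable hWm.aemeasurable
          (by positivity) (by linarith) (by ring)
    _ ≤ _ := by
        rw [hWi]
        gcongr

/-- A weighted sum of measures of sets inside `W`, when the sum of the `2^{kt} |U k|`
is controlled. -/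
theorem sum_two_rpow_mul_measure_inter_le {s t : ℝ} (hst : s.HolderConjugate t) (S : Finset ℤ)
    {U : ℤ → Set α} (hU : ∀ k ∈ S, MeasurableSet (U k)) {W : Set α} (hW : MeasurableSet W) :
    ∑ k ∈ S, (2 : ℝ≥0∞) ^ (k : ℝ) * μ (W ∩ U k) ≤
      geomConst 1 * (μ W ^ (1 / s) *
        (∑ k ∈ S, (2 : ℝ≥0∞) ^ ((k : ℝ) * t) * μ (U k)) ^ (1 / t)) := by
  classical
  have ht : 0 < t := hst.symm.pos
  set H : α → ℝ≥0∞ := fun z => ∑ k ∈ S, (U k).indicator (fun _ => 2 ^ ((k : ℝ) * t)) z with hH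
  have hHm : Measurable H :=
    Finset.measurable_fun_sum S fun k hk => measurable_const.indicator (hU k hk)
  have hHi : ∫⁻ z, H z ∂μ = ∑ k ∈ S, 2 ^ ((k : ℝ) * t) * μ (U k) := by
    rw [lintegral_finsetSum' S fun k hk => (measurable_const.indicator (hU k hk)).aemeasurable]
    exact Finset.sum_congr rfl fun k hk => by rw [lintegral_indicator_const (hU k hk)]
  have key : ∀ z, ∑ k ∈ S, (W ∩ U k).indicator (fun _ => (2 : ℝ≥0∞) ^ (k : ℝ)) z ≤
      geomConst 1 * (W.indicator (fun _ => 1) z ^ (1 / s) * H z ^ (1 / t)) := by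
    intro z
    by_cases hz : z ∈ W
    swap
    · rw [Finset.sum_eq_zero]
      · exact zero_le
      · intro k _
        exact Set.indicator_of_notMem (fun h => hz h.1) _
    rw [Set.indicator_of_mem hz, ENNReal.one_rpow, one_mul]
    set A := S.filter fun k => z ∈ U k with hA
    have hsum : ∑ k ∈ S, (W ∩ U k).indicator (fun _ => (2 : ℝ≥0∞) ^ (k : ℝ)) z =
        ∑ k ∈ A, (2 : ℝ≥0∞) ^ ((k : ℝ) * 1) := by
      rw [hA, Finset.sum_filter]
      refine Finset.sum_congr rfl fun k hk => ?_
      simp [Set.indicator, hz]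
    rcases A.eq_empty_or_nonempty with hA0 | hA0
    · rw [hsum, hA0]; simp
    -- Again a geometric sum comparable to its top term `2^K`, which is at most `H^{1/t}`.
    obtain ⟨K, hK, hmax⟩ := Finset.exists_max_image A (fun k => k) hA0
    have hKS := Finset.mem_filter.1 hK
    rw [hsum]
    refine (sum_two_rpow_le hmax 1).trans (mul_le_mul_right ?_ _)
    have h3 : (2 : ℝ≥0∞) ^ ((K : ℝ) * t) ≤ H z := by
      refine le_trans (le_of_eq ?_) (Finset.single_le_sum (f := fun k : ℤ =>
        (U k).indicator (fun _ => (2 : ℝ≥0∞) ^ ((k : ℝ) * t)) z) (fun _ _ => zero_le) hKS.1)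
      rw [Set.indicator_of_mem hKS.2]
    calc (2 : ℝ≥0∞) ^ ((K : ℝ) * 1) = (2 ^ ((K : ℝ) * t)) ^ (1 / t) := by
          rw [← ENNReal.rpow_mul]; congr 1; field_simp
      _ ≤ _ := by gcongr
  calc ∑ k ∈ S, (2 : ℝ≥0∞) ^ (k : ℝ) * μ (W ∩ U k)
      = ∫⁻ z, ∑ k ∈ S, (W ∩ U k).indicator (fun _ => (2 : ℝ≥0∞) ^ (k : ℝ)) z ∂μ := by
        rw [lintegral_finsetSum' S fun k hk =>
          (measurable_const.indicator (hW.inter (hU k hk))).aemeasurable]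
        exact Finset.sum_congr rfl fun k hk => by
          rw [lintegral_indicator_const (hW.inter (hU k hk))]
    _ ≤ ∫⁻ z, geomConst 1 * (W.indicator (fun _ => 1) z ^ (1 / s) * H z ^ (1 / t)) ∂μ :=
        lintegral_mono key
    _ = geomConst 1 * ∫⁻ z, W.indicator (fun _ => 1) z ^ (1 / s) * H z ^ (1 / t) ∂μ :=
        lintegral_const_mul' _ _ (geomConst_ne_top one_pos)
    _ ≤ geomConst 1 * ((∫⁻ z, W.indicator (fun _ => 1) z ∂μ) ^ (1 / s) *
          (∫⁻ z, H z ∂μ) ^ (1 / t)) := by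
        gcongr
        refine ENNReal.lintegral_mul_norm_pow_le (measurable_const.indicator hW).aemeasurable
          hHm.aemeasurable (one_div_nonneg.2 hst.pos.le) (one_div_nonneg.2 ht.le) ?_
        rw [one_div, one_div]; exact hst.inv_add_inv_eq_one
    _ = _ := by rw [hHi, lintegral_indicator_const hW, one_mul]

end

end BiparameterHardy

/-! ### Haar functions, averages and coefficients as algebra of consistent families. -/

namespace BiparameterHardy

open DyadicInterval

theorem DyadicInterval.haar_of_subset_left {I K : DyadicInterval} (h : I.toSet ⊆ K.left.toSet)
    {x : ℝ} (hx : x ∈ I.toSet) : K.haar x = (√K.length)⁻¹ := by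
  have h2 : x ∉ K.right.toSet := Set.disjoint_left.1 K.disjoint_left_right (h hx)
  simp [DyadicInterval.haar, h hx, h2]

theorem DyadicInterval.haar_of_subset_right {I K : DyadicInterval} (h : I.toSet ⊆ K.right.toSet)
    {x : ℝ} (hx : x ∈ I.toSet) : K.haar x = -(√K.length)⁻¹ := by
  have h2 : x ∉ K.left.toSet := Set.disjoint_right.1 K.disjoint_left_right (h hx)
  simp [DyadicInterval.haar, h hx, h2]

theorem DyadicInterval.haar_of_notMem {K : DyadicInterval} {x : ℝ} (hx : x ∉ K.toSet) :
    K.haar x = 0 := by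
  have h1 : x ∉ K.left.toSet := fun h => hx (K.left_subset h)
  have h2 : x ∉ K.right.toSet := fun h => hx (K.right_subset h)
  simp [DyadicInterval.haar, h1, h2]

theorem DyadicInterval.abs_haar_le (K : DyadicInterval) (x : ℝ) :
    |K.haar x| ≤ (√K.length)⁻¹ := by
  by_cases h1 : x ∈ K.left.toSet
  · have h2 : x ∉ K.right.toSet := Set.disjoint_left.1 K.disjoint_left_right h1
    simp [DyadicInterval.haar, h1, h2, abs_of_nonneg (Real.sqrt_nonneg _)]
  · by_cases h2 : x ∈ K.right.toSet <;>
      simp [DyadicInterval.haar, h1, h2, abs_of_nonneg (Real.sqrt_nonneg _)]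

theorem DyadicInterval.volume_real_toSet (I : DyadicInterval) :
    volume.real I.toSet = I.length := by
  rw [measureReal_def, volume_toSet, ENNReal.toReal_ofReal I.length_pos.le]

/-- An interval inside no half of `K` either contains `K`, and the two halves cancel, or misses `K`.
-/
theorem DyadicInterval.setIntegral_haar (I K : DyadicInterval) :
    ∫ x in I.toSet, K.haar x = I.length * ((√K.length)⁻¹ * haarSign I K) := by
  by_cases h1 : I.toSet ⊆ K.left.toSet
  · rw [setIntegral_congr_fun I.measurableSet_toSet
      (fun x hx => haar_of_subset_left h1 hx), setIntegral_const, volume_real_toSet,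
      haarSign_of_subset_left h1]
    simp
  by_cases h2 : I.toSet ⊆ K.right.toSet
  · rw [setIntegral_congr_fun I.measurableSet_toSet
      (fun x hx => haar_of_subset_right h2 hx), setIntegral_const, volume_real_toSet,
      haarSign_of_subset_right h2]
    simp
  rw [haarSign, if_neg h1, if_neg h2, mul_zero, mul_zero]
  have h3 : K.toSet ⊆ I.toSet ∨ Disjoint I.toSet K.toSet := by
    rcases le_total K.1 I.1 with h | h
    · exact (toSet_subset_or_disjoint h).imp id fun h' => h'.symm
    · rcases toSet_subset_or_disjoint h with h4 | h4
      · by_cases h5 : I = K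
        · exact Or.inl (by rw [h5])
        · exact ((subset_left_or_right h4 h5).elim h1 h2).elim
      · exact Or.inr h4
  rcases h3 with h3 | h3
  · have hi : ∀ L : DyadicInterval, L.toSet ⊆ I.toSet →
        ∫ x in I.toSet, L.toSet.indicator (fun _ => (1 : ℝ)) x = L.length := by
      intro L hL
      rw [setIntegral_indicator L.measurableSet_toSet, Set.inter_eq_right.2 hL, setIntegral_const,
        volume_real_toSet]
      simp
    have hint : ∀ L : DyadicInterval, IntegrableOn (L.toSet.indicator fun _ => (1 : ℝ)) I.toSet :=
      fun L => (integrableOn_const I.volume_toSet_ne_top).indicator L.measurableSet_toSet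
    unfold DyadicInterval.haar
    rw [integral_const_mul, integral_sub (hint _) (hint _), hi _ (K.left_subset.trans h3),
      hi _ (K.right_subset.trans h3), length_left, length_right]
    simp
  · rw [setIntegral_congr_fun I.measurableSet_toSet
      (fun x hx => haar_of_notMem (Set.disjoint_left.1 h3 hx))]
    simp

namespace DyadicRectangle

/-- The area of a dyadic rectangle. -/
def area (R : DyadicRectangle) : ℝ := DyadicInterval.length R.1 * DyadicInterval.length R.2

theorem area_pos (R : DyadicRectangle) : 0 < R.area := mul_pos R.1.length_pos R.2.length_pos

theorem volume_toSet_eq (R : DyadicRectangle) : volume R.toSet = ENNReal.ofReal R.area := by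
  rw [volume_toSet, DyadicInterval.volume_toSet, DyadicInterval.volume_toSet, area,
    ENNReal.ofReal_mul R.1.length_pos.le]

theorem volume_real_toSet (R : DyadicRectangle) : volume.real R.toSet = R.area := by
  rw [measureReal_def, volume_toSet_eq, ENNReal.toReal_ofReal R.area_pos.le]

theorem haar_of_notMem {R : DyadicRectangle} {z : ℝ × ℝ} (hz : z ∉ R.toSet) : R.haar z = 0 := by
  by_cases h1 : z.1 ∈ DyadicInterval.toSet R.1
  · have h2 : z.2 ∉ DyadicInterval.toSet R.2 := fun h2 => hz ⟨h1, h2⟩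
    rw [DyadicRectangle.haar, DyadicInterval.haar_of_notMem h2, mul_zero]
  · rw [DyadicRectangle.haar, DyadicInterval.haar_of_notMem h1, zero_mul]

theorem abs_haar_le (R : DyadicRectangle) (z : ℝ × ℝ) : |R.haar z| ≤ (√R.area)⁻¹ := by
  rw [DyadicRectangle.haar, abs_mul, area, Real.sqrt_mul R.1.length_pos.le, mul_inv]
  exact mul_le_mul (DyadicInterval.abs_haar_le _ _) (DyadicInterval.abs_haar_le _ _)
    (abs_nonneg _) (by positivity)

theorem toSet_mono {I I' J J' : DyadicInterval} (hI : I.toSet ⊆ I'.toSet)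
    (hJ : J.toSet ⊆ J'.toSet) : DyadicRectangle.toSet (I, J) ⊆ DyadicRectangle.toSet (I', J') :=
  Set.prod_mono hI hJ

/-- The value on `R` of `√|K| h_K` for `R` strictly smaller than `K` in both variables, and `0`
for other `R`. -/
def haarSign (R K : DyadicRectangle) : ℝ :=
  DyadicInterval.haarSign R.1 K.1 * DyadicInterval.haarSign R.2 K.2

theorem subset_of_haarSign_ne_zero {R K : DyadicRectangle} (h : haarSign R K ≠ 0) :
    R.toSet ⊆ K.toSet :=
  Set.prod_mono (DyadicInterval.subset_of_haarSign_ne_zero (left_ne_zero_of_mul h))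
    (DyadicInterval.subset_of_haarSign_ne_zero (right_ne_zero_of_mul h))

end DyadicRectangle

theorem haarFun_coe (R : DyadicRectangle) : haarFun R =ᵐ[volume] R.haar :=
  AEEqFun.coeFn_mk _ _

theorem averages_haarFun (K R : DyadicRectangle) :
    averages (haarFun K) R = (√K.area)⁻¹ * R.haarSign K := by
  rw [averages, setAverage_eq, DyadicRectangle.volume_real_toSet,
    setIntegral_congr_ae R.measurableSet_toSet ((haarFun_coe K).mono fun z hz _ => hz)]
  have h := setIntegral_prod_mul (μ := volume) (ν := volume) (DyadicInterval.haar K.1)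
    (DyadicInterval.haar K.2) (DyadicInterval.toSet R.1) (DyadicInterval.toSet R.2)
  rw [← Measure.volume_eq_prod] at h
  change R.area⁻¹ • (∫ z in R.1.toSet ×ˢ R.2.toSet, K.1.haar z.1 * K.2.haar z.2) = _
  rw [h, DyadicInterval.setIntegral_haar, DyadicInterval.setIntegral_haar, DyadicRectangle.area,
    DyadicRectangle.area, Real.sqrt_mul K.1.length_pos.le, DyadicRectangle.haarSign, smul_eq_mul]
  have h1 := R.1.length_pos.ne'
  have h2 := R.2.length_pos.ne'
  field_simp

theorem memLp_haarFun (K : DyadicRectangle) (p : ℝ≥0∞) : MemLp (haarFun K) p volume := by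
  rw [memLp_congr_ae (haarFun_coe K)]
  have h : K.haar = K.toSet.indicator K.haar := by
    funext z
    by_cases hz : z ∈ K.toSet
    · rw [Set.indicator_of_mem hz]
    · rw [Set.indicator_of_notMem hz, K.haar_of_notMem hz]
  rw [h, memLp_indicator_iff_restrict K.measurableSet_toSet]
  have : IsFiniteMeasure (volume.restrict K.toSet) :=
    ⟨by simpa using K.volume_toSet_ne_top.lt_top⟩
  exact MemLp.of_bound K.measurable_haar.aestronglyMeasurable (√K.area)⁻¹
    (Eventually.of_forall fun z => by rw [Real.norm_eq_abs]; exact K.abs_haar_le z)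

theorem MemLp.dyadicLocallyIntegrable {f : PlaneFun} {p : ℝ≥0∞} (hp : 1 ≤ p)
    (hf : MemLp f p volume) : DyadicLocallyIntegrable f := fun R =>
  have : IsFiniteMeasure (volume.restrict R.toSet) :=
    ⟨by simpa using R.volume_toSet_ne_top.lt_top⟩
  MemLp.integrable hp (MeasureTheory.MemLp.restrict R.toSet hf)

theorem averages_add {f g : PlaneFun} (hf : DyadicLocallyIntegrable f)
    (hg : DyadicLocallyIntegrable g) : averages (f + g) = averages f + averages g := by
  funext R
  rw [Pi.add_apply, averages, averages, averages, setAverage_eq, setAverage_eq, setAverage_eq,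
    ← smul_add, ← integral_add (hf R) (hg R),
    setIntegral_congr_ae R.measurableSet_toSet ((AEEqFun.coeFn_add f g).mono fun z hz _ => hz)]
  rfl

theorem averages_smul (c : ℝ) (f : PlaneFun) : averages (c • f) = c • averages f := by
  funext R
  rw [Pi.smul_apply, averages, averages, setAverage_eq, setAverage_eq, smul_comm,
    setIntegral_congr_ae R.measurableSet_toSet ((AEEqFun.coeFn_smul c f).mono fun z hz _ => hz),
    ← integral_smul c]
  rfl

theorem DyadicLocallyIntegrable.add {f g : PlaneFun} (hf : DyadicLocallyIntegrable f)
    (hg : DyadicLocallyIntegrable g) : DyadicLocallyIntegrable (f + g) := fun R =>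
  ((hf R).add (hg R)).congr (ae_restrict_of_ae (AEEqFun.coeFn_add f g).symm)

theorem DyadicLocallyIntegrable.smul (c : ℝ) {f : PlaneFun} (hf : DyadicLocallyIntegrable f) :
    DyadicLocallyIntegrable (c • f) := fun R =>
  ((hf R).smul c).congr (ae_restrict_of_ae (AEEqFun.coeFn_smul c f).symm)

theorem dyadicLocallyIntegrable_zero : DyadicLocallyIntegrable 0 := fun _ =>
  (integrable_zero _ _ _).congr (ae_restrict_of_ae AEEqFun.coeFn_zero.symm)

theorem averages_zero : averages 0 = 0 := by
  simpa using averages_smul 0 (0 : PlaneFun)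

theorem averages_sub {f g : PlaneFun} (hf : DyadicLocallyIntegrable f)
    (hg : DyadicLocallyIntegrable g) : averages (f - g) = averages f - averages g := by
  have h := averages_add hf (hg.smul (-1))
  rw [averages_smul, neg_one_smul, neg_one_smul, ← sub_eq_add_neg, ← sub_eq_add_neg] at h
  exact h

theorem DyadicLocallyIntegrable.sum {ι : Type*} (F : Finset ι) {f : ι → PlaneFun}
    (hf : ∀ i ∈ F, DyadicLocallyIntegrable (f i)) : DyadicLocallyIntegrable (∑ i ∈ F, f i) := by
  classical
  induction F using Finset.induction_on with
  | empty => simpa using dyadicLocallyIntegrable_zero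
  | insert i F hi ih =>
    rw [Finset.sum_insert hi]
    exact (hf i (Finset.mem_insert_self _ _)).add
      (ih fun j hj => hf j (Finset.mem_insert_of_mem hj))

theorem averages_sum {ι : Type*} (F : Finset ι) {f : ι → PlaneFun}
    (hf : ∀ i ∈ F, DyadicLocallyIntegrable (f i)) :
    averages (∑ i ∈ F, f i) = ∑ i ∈ F, averages (f i) := by
  classical
  induction F using Finset.induction_on with
  | empty => simpa using averages_zero
  | insert i F hi ih =>
    have h1 : ∀ j ∈ F, DyadicLocallyIntegrable (f j) := fun j hj => hf j (Finset.mem_insert_of_mem hj)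
    rw [Finset.sum_insert hi, Finset.sum_insert hi, averages_add
      (hf i (Finset.mem_insert_self _ _)) (DyadicLocallyIntegrable.sum F h1), ih h1]

theorem DyadicRectangle.toSet_fst_halves (I J : DyadicInterval) :
    DyadicRectangle.toSet (I, J) =
      DyadicRectangle.toSet (I.left, J) ∪ DyadicRectangle.toSet (I.right, J) := by
  unfold DyadicRectangle.toSet
  rw [← Set.union_prod, toSet_left_union_right]

theorem DyadicRectangle.toSet_snd_halves (I J : DyadicInterval) :
    DyadicRectangle.toSet (I, J) =
      DyadicRectangle.toSet (I, J.left) ∪ DyadicRectangle.toSet (I, J.right) := by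
  unfold DyadicRectangle.toSet
  rw [← Set.prod_union, toSet_left_union_right]

theorem DyadicRectangle.disjoint_fst_halves (I J : DyadicInterval) :
    Disjoint (DyadicRectangle.toSet (I.left, J)) (DyadicRectangle.toSet (I.right, J)) :=
  Set.disjoint_left.2 fun _ h1 h2 => Set.disjoint_left.1 I.disjoint_left_right h1.1 h2.1

theorem DyadicRectangle.disjoint_snd_halves (I J : DyadicInterval) :
    Disjoint (DyadicRectangle.toSet (I, J.left)) (DyadicRectangle.toSet (I, J.right)) :=
  Set.disjoint_left.2 fun _ h1 h2 => Set.disjoint_left.1 J.disjoint_left_right h1.2 h2.2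

theorem setIntegral_fst_halves {f : PlaneFun} (hf : DyadicLocallyIntegrable f)
    (I J : DyadicInterval) :
    ∫ z in DyadicRectangle.toSet (I, J), f z =
      (∫ z in DyadicRectangle.toSet (I.left, J), f z) +
        ∫ z in DyadicRectangle.toSet (I.right, J), f z := by
  rw [DyadicRectangle.toSet_fst_halves, setIntegral_union
    (DyadicRectangle.disjoint_fst_halves I J) (DyadicRectangle.measurableSet_toSet _) (hf _) (hf _)]

theorem setIntegral_snd_halves {f : PlaneFun} (hf : DyadicLocallyIntegrable f)
    (I J : DyadicInterval) :
    ∫ z in DyadicRectangle.toSet (I, J), f z =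
      (∫ z in DyadicRectangle.toSet (I, J.left), f z) +
        ∫ z in DyadicRectangle.toSet (I, J.right), f z := by
  rw [DyadicRectangle.toSet_snd_halves, setIntegral_union
    (DyadicRectangle.disjoint_snd_halves I J) (DyadicRectangle.measurableSet_toSet _) (hf _) (hf _)]

theorem averages_eq (f : PlaneFun) (R : DyadicRectangle) :
    averages f R = R.area⁻¹ * ∫ z in R.toSet, f z := by
  rw [averages, setAverage_eq, DyadicRectangle.volume_real_toSet, smul_eq_mul]

theorem setIntegral_eq_area_mul (f : PlaneFun) (R : DyadicRectangle) :
    ∫ z in R.toSet, f z = R.area * averages f R := by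
  rw [averages_eq, mul_inv_cancel_left₀ R.area_pos.ne']

theorem isConsistent_averages {f : PlaneFun} (hf : DyadicLocallyIntegrable f) :
    IsConsistent (averages f) := by
  intro I J
  have hI := I.length_pos.ne'
  have hJ := J.length_pos.ne'
  constructor
  · rw [averages_eq, averages_eq, averages_eq, setIntegral_fst_halves hf]
    simp only [DyadicRectangle.area, length_left, length_right]
    field_simp
  · rw [averages_eq, averages_eq, averages_eq, setIntegral_snd_halves hf]
    simp only [DyadicRectangle.area, length_left, length_right]
    field_simp

/-- The Haar coefficients of a consistent family. -/
def coeff (a : DyadicRectangle → ℝ) (R : DyadicRectangle) : ℝ := √R.area * mixedDiff a R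

/-- `h_R` is a signed sum of the indicators of the four quarters of `R`, so the pairing is a mixed
difference of averages. In this form coefficients make sense for dyadic distributions. -/
theorem haarCoeff_eq {f : PlaneFun} (hf : DyadicLocallyIntegrable f) (R : DyadicRectangle) :
    haarCoeff f R = coeff (averages f) R := by
  obtain ⟨I, J⟩ := R
  have hind : ∀ R' : DyadicRectangle, ∫ z, R'.toSet.indicator f z = R'.area * averages f R' :=
    fun R' => by rw [integral_indicator R'.measurableSet_toSet, setIntegral_eq_area_mul]
  have hint : ∀ R' : DyadicRectangle, Integrable (R'.toSet.indicator f) := fun R' =>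
    (hf R').integrable_indicator R'.measurableSet_toSet
  have h1 : ∀ z, f z * DyadicRectangle.haar (I, J) z =
      (√(DyadicRectangle.area (I, J)))⁻¹ *
        (((DyadicRectangle.toSet (I.left, J.left)).indicator f z -
          (DyadicRectangle.toSet (I.left, J.right)).indicator f z) -
        ((DyadicRectangle.toSet (I.right, J.left)).indicator f z -
          (DyadicRectangle.toSet (I.right, J.right)).indicator f z)) := by
    intro z
    have h2 : ∀ K L : DyadicInterval, (DyadicRectangle.toSet (K, L)).indicator f z =
        f z * (K.toSet.indicator (fun _ => (1 : ℝ)) z.1 *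
          L.toSet.indicator (fun _ => (1 : ℝ)) z.2) := by
      intro K L
      by_cases hK : z.1 ∈ K.toSet <;> by_cases hL : z.2 ∈ L.toSet <;>
        simp [Set.indicator, DyadicRectangle.toSet, hK, hL]
    rw [h2, h2, h2, h2, DyadicRectangle.haar, DyadicRectangle.area,
      Real.sqrt_mul I.length_pos.le, DyadicInterval.haar, DyadicInterval.haar]
    simp only [mul_inv]
    ring
  have hsub : ∀ A B C D : DyadicRectangle,
      ∫ z, (A.toSet.indicator f z - B.toSet.indicator f z) -
        (C.toSet.indicator f z - D.toSet.indicator f z) =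
      (∫ z, A.toSet.indicator f z - B.toSet.indicator f z) -
        ∫ z, C.toSet.indicator f z - D.toSet.indicator f z := fun A B C D =>
    integral_sub ((hint A).sub (hint B)) ((hint C).sub (hint D))
  rw [haarCoeff, integral_congr_ae (Eventually.of_forall h1), integral_const_mul,
    hsub, integral_sub (hint _) (hint _),
    integral_sub (hint _) (hint _), hind, hind, hind, hind, coeff, mixedDiff]
  simp only [diff, DyadicRectangle.area, length_left, length_right]
  have hp := mul_pos I.length_pos J.length_pos
  have hs := Real.sqrt_pos.2 hp
  have h3 := Real.mul_self_sqrt hp.le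
  set r := √(I.length * J.length) with hr
  have h4 : I.length / 2 * (J.length / 2) = r * r / 4 := by rw [h3]; ring
  rw [h4]
  field_simp
  ring

/-- Finite sums of multiples of Haar functions. -/
def haarSum (c : DyadicRectangle → ℝ) (F : Finset DyadicRectangle) : PlaneFun :=
  ∑ R ∈ F, c R • haarFun R

theorem haarSum_mem_haarSpan (c : DyadicRectangle → ℝ) (F : Finset DyadicRectangle) :
    haarSum c F ∈ haarSpan :=
  Submodule.sum_mem _ fun R _ => Submodule.smul_mem _ _ (Submodule.subset_span ⟨R, rfl⟩)

theorem haarSum_coe (c : DyadicRectangle → ℝ) (F : Finset DyadicRectangle) :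
    haarSum c F =ᵐ[volume] fun z => ∑ R ∈ F, c R * R.haar z := by
  classical
  unfold haarSum
  induction F using Finset.induction_on with
  | empty =>
    filter_upwards [AEEqFun.coeFn_zero (α := ℝ × ℝ) (β := ℝ) (μ := volume)] with z hz
    simp [hz]
  | insert R F hR ih =>
    rw [Finset.sum_insert hR]
    filter_upwards [ih, AEEqFun.coeFn_add (c R • haarFun R) (∑ R ∈ F, c R • haarFun R),
      AEEqFun.coeFn_smul (c R) (haarFun R), haarFun_coe R] with z h1 h2 h3 h4
    rw [h2, Pi.add_apply, h1, h3, Pi.smul_apply, h4, Finset.sum_insert hR, smul_eq_mul]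

theorem memLp_haarSum (c : DyadicRectangle → ℝ) (F : Finset DyadicRectangle) (p : ℝ≥0∞) :
    MemLp (haarSum c F) p volume := by
  rw [memLp_congr_ae (haarSum_coe c F)]
  exact memLp_finsetSum F fun R _ =>
    ((memLp_congr_ae (haarFun_coe R)).1 (memLp_haarFun R p)).const_mul (c R)

theorem dyadicLocallyIntegrable_haarSum (c : DyadicRectangle → ℝ) (F : Finset DyadicRectangle) :
    DyadicLocallyIntegrable (haarSum c F) :=
  MemLp.dyadicLocallyIntegrable le_rfl (memLp_haarSum c F 1)

theorem averages_haarSum (c : DyadicRectangle → ℝ) (F : Finset DyadicRectangle)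
    (R : DyadicRectangle) :
    averages (haarSum c F) R = ∑ K ∈ F, c K * ((√K.area)⁻¹ * R.haarSign K) := by
  rw [haarSum, averages_sum F fun K _ => DyadicLocallyIntegrable.smul _
    (MemLp.dyadicLocallyIntegrable le_rfl (memLp_haarFun K 1)), Finset.sum_apply]
  refine Finset.sum_congr rfl fun K _ => ?_
  rw [averages_smul, Pi.smul_apply, averages_haarFun, smul_eq_mul]

/-- Orthonormality of the rectangular Haar system, as the product of two copies of `diff_haarSign`.
-/
theorem coeff_averages_haarSum (c : DyadicRectangle → ℝ) (F : Finset DyadicRectangle)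
    (R : DyadicRectangle) [Decidable (R ∈ F)] :
    coeff (averages (haarSum c F)) R = if R ∈ F then c R else 0 := by
  classical
  have h0 : ∀ K : DyadicRectangle, mixedDiff (fun R => R.haarSign K) R = if R = K then 1 else 0 := by
    intro K
    have h1 := diff_haarSign R.1 K.1
    have h2 := diff_haarSign R.2 K.2
    have h3 : mixedDiff (fun R => R.haarSign K) R =
        diff (fun L => haarSign L K.1) R.1 * diff (fun L => haarSign L K.2) R.2 := by
      simp only [mixedDiff, diff, DyadicRectangle.haarSign]; ring
    rw [h3, h1, h2]
    by_cases h4 : R.1 = K.1 <;> by_cases h5 : R.2 = K.2 <;> simp [Prod.ext_iff (x := R), h4, h5]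
  have h1 : mixedDiff (averages (haarSum c F)) R =
      ∑ K ∈ F, c K * ((√K.area)⁻¹ * mixedDiff (fun R => R.haarSign K) R) := by
    simp only [mixedDiff, diff, averages_haarSum, ← Finset.sum_sub_distrib, Finset.sum_div]
    exact Finset.sum_congr rfl fun K _ => by ring
  rw [coeff, h1]
  simp only [h0, mul_ite, mul_one, mul_zero, Finset.sum_ite_eq]
  split_ifs
  · have := (Real.sqrt_pos.2 R.area_pos).ne'
    field_simp
  · rfl

/-- A finite set of dyadic rectangles; these sets exhaust all dyadic rectangles. -/
def boxes (N : ℕ) : Finset DyadicRectangle := box N ×ˢ box N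

theorem boxes_mono : Monotone boxes := fun _ _ h => Finset.product_subset_product
  (box_mono h) (box_mono h)

theorem eventually_mem_boxes (R : DyadicRectangle) : ∀ᶠ N in atTop, R ∈ boxes N := by
  filter_upwards [eventually_mem_box R.1, eventually_mem_box R.2] with N h1 h2
  exact Finset.mem_product.2 ⟨h1, h2⟩

/-- The finite part of the Haar expansion of a consistent family over `boxes N`. -/
def truncation (N : ℕ) (a : DyadicRectangle → ℝ) : PlaneFun := haarSum (coeff a) (boxes N)

/-- Telescoping in one variable at a time. The two hypotheses are for all martingales, because they
are applied to differences of `a` in the first variable and then to `a(·, L) - a(·, L₀)`. -/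
theorem averages_truncation_eq {N : ℕ} {a : DyadicRectangle → ℝ} (ha : IsConsistent a)
    {I J K K₀ L L₀ : DyadicInterval}
    (hK : ∀ α, Consistent α → ∑ M ∈ box N, diff α M * haarSign I M = α K - α K₀)
    (hL : ∀ α, Consistent α → ∑ M ∈ box N, diff α M * haarSign J M = α L - α L₀) :
    averages (truncation N a) (I, J) = a (K, L) - a (K, L₀) - (a (K₀, L) - a (K₀, L₀)) := by
  rw [truncation, averages_haarSum, boxes, Finset.sum_product]
  have h1 : ∀ M ∈ box N, ∑ M' ∈ box N, coeff a (M, M') *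
      ((√(DyadicRectangle.area (M, M')))⁻¹ * DyadicRectangle.haarSign (I, J) (M, M')) =
      diff (fun I => a (I, L) - a (I, L₀)) M * haarSign I M := by
    intro M _
    have h2 := hL _ (ha.diff_fst M)
    have h3 : diff (fun I => a (I, L) - a (I, L₀)) M =
        diff (fun I => a (I, L)) M - diff (fun I => a (I, L₀)) M := by simp only [diff]; ring
    rw [h3, ← h2, Finset.sum_mul]
    refine Finset.sum_congr rfl fun M' _ => ?_
    have h4 := (Real.sqrt_pos.2 (DyadicRectangle.area_pos (M, M'))).ne'
    rw [coeff, DyadicRectangle.haarSign]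
    field_simp
    simp only [mixedDiff, diff]
    ring
  rw [Finset.sum_congr rfl h1, hK (fun I => a (I, L) - a (I, L₀))]
  intro M
  simp only
  rw [(ha M L).1, (ha M L₀).1]; ring

/-- An average of a truncation is an alternating sum of four values of `a` at rectangles that
contain the given one, hence `z` as well. -/
theorem maximalFun_truncation_le {a : DyadicRectangle → ℝ} (ha : IsConsistent a) (N : ℕ)
    (z : ℝ × ℝ) : maximalFun (averages (truncation N a)) z ≤ 4 * maximalFun a z := by
  refine iSup₂_le fun R hR => ?_
  obtain ⟨I, J⟩ := R
  obtain ⟨K, K₀, h1, h2, h3⟩ := exists_sum_box_eq N I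
  obtain ⟨L, L₀, h4, h5, h6⟩ := exists_sum_box_eq N J
  rw [averages_truncation_eq ha h3 h6]
  have hb : ∀ I' J' : DyadicInterval, I.toSet ⊆ I'.toSet → J.toSet ⊆ J'.toSet →
      ENNReal.ofReal |a (I', J')| ≤ maximalFun a z := fun I' J' hI hJ =>
    le_iSup₂_of_le (I', J') (DyadicRectangle.toSet_mono hI hJ hR) le_rfl
  calc _ ≤ ENNReal.ofReal (|a (K, L)| + |a (K, L₀)| + |a (K₀, L)| + |a (K₀, L₀)|) := by
        refine ENNReal.ofReal_le_ofReal ?_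
        have := abs_sub (a (K, L) - a (K, L₀)) (a (K₀, L) - a (K₀, L₀))
        have := abs_sub (a (K, L)) (a (K, L₀))
        have := abs_sub (a (K₀, L)) (a (K₀, L₀))
        linarith
    _ ≤ maximalFun a z + maximalFun a z + maximalFun a z + maximalFun a z := by
        rw [ENNReal.ofReal_add (by positivity) (by positivity),
          ENNReal.ofReal_add (by positivity) (by positivity),
          ENNReal.ofReal_add (by positivity) (by positivity)]
        exact add_le_add (add_le_add (add_le_add (hb _ _ h1 h4) (hb _ _ h1 h5)) (hb _ _ h2 h4))
          (hb _ _ h2 h5)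
    _ = _ := by ring

end BiparameterHardy

/-! ### Functions whose Haar expansion is supported in a set. -/

namespace BiparameterHardy

open DyadicInterval

theorem enorm_averages_le (R : DyadicRectangle) {r : ℝ≥0∞} (hr : 1 ≤ r) :
    ∃ C : ℝ≥0∞, C ≠ ⊤ ∧ ∀ g : PlaneFun, ‖averages g R‖ₑ ≤ C * eLpNorm g r volume := by
  refine ⟨‖R.area⁻¹‖ₑ * volume R.toSet ^ (1 / (1 : ℝ≥0∞).toReal - 1 / r.toReal), ?_, fun g => ?_⟩
  · refine ENNReal.mul_ne_top enorm_ne_top (ENNReal.rpow_ne_top_of_ne_zero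
      R.volume_toSet_ne_zero R.volume_toSet_ne_top)
  · rw [averages_eq, enorm_mul, mul_assoc]
    gcongr
    calc ‖∫ z in R.toSet, g z‖ₑ ≤ ∫⁻ z in R.toSet, ‖g z‖ₑ := enorm_integral_le_lintegral_enorm _
      _ = eLpNorm g 1 (volume.restrict R.toSet) := eLpNorm_one_eq_lintegral_enorm.symm
      _ ≤ eLpNorm g r (volume.restrict R.toSet) *
          (volume.restrict R.toSet) Set.univ ^ (1 / (1 : ℝ≥0∞).toReal - 1 / r.toReal) :=
          eLpNorm_le_eLpNorm_mul_rpow_measure_univ hr g.aestronglyMeasurable.restrict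
      _ ≤ _ := by
          rw [Measure.restrict_apply_univ, mul_comm]
          gcongr
          exact Measure.restrict_le_self

theorem tendsto_averages {ι : Type*} {l : Filter ι} {g : ι → PlaneFun} {f : PlaneFun} {r : ℝ≥0∞}
    (hr : 1 ≤ r) (hf : MemLp f r volume) (hg : ∀ i, MemLp (g i) r volume)
    (h : Tendsto (fun i => eLpNorm (f - g i : PlaneFun) r volume) l (𝓝 0)) (R : DyadicRectangle) :
    Tendsto (fun i => averages (g i) R) l (𝓝 (averages f R)) := by
  obtain ⟨C, hC, hb⟩ := enorm_averages_le R hr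
  rw [tendsto_iff_edist_tendsto_0]
  have h1 : Tendsto (fun i => C * eLpNorm (f - g i : PlaneFun) r volume) l (𝓝 0) := by
    simpa using ENNReal.Tendsto.const_mul h (Or.inr hC)
  refine tendsto_of_tendsto_of_tendsto_of_le_of_le tendsto_const_nhds h1 (fun _ => zero_le)
    fun i => ?_
  simp only
  rw [edist_comm, edist_eq_enorm_sub]
  have := hb (f - g i)
  rwa [averages_sub (MemLp.dyadicLocallyIntegrable hr hf)
    (MemLp.dyadicLocallyIntegrable hr (hg i))] at this

theorem coeff_sub (a b : DyadicRectangle → ℝ) (R : DyadicRectangle) :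
    coeff (a - b) R = coeff a R - coeff b R := by
  simp only [coeff, mixedDiff, diff, Pi.sub_apply]; ring

theorem coeff_smul (c : ℝ) (a : DyadicRectangle → ℝ) (R : DyadicRectangle) :
    coeff (c • a) R = c * coeff a R := by
  simp only [coeff, mixedDiff, diff, Pi.smul_apply, smul_eq_mul]; ring

theorem coeff_add (a b : DyadicRectangle → ℝ) (R : DyadicRectangle) :
    coeff (a + b) R = coeff a R + coeff b R := by
  simp only [coeff, mixedDiff, diff, Pi.add_apply]; ring

theorem tendsto_coeff {ι : Type*} {l : Filter ι} {a : ι → DyadicRectangle → ℝ}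
    {b : DyadicRectangle → ℝ} (h : ∀ R, Tendsto (fun i => a i R) l (𝓝 (b R)))
    (R : DyadicRectangle) : Tendsto (fun i => coeff (a i) R) l (𝓝 (coeff b R)) := by
  simp only [coeff, mixedDiff, diff]
  exact (((((h _).sub (h _)).div_const 2).sub (((h _).sub (h _)).div_const 2)).div_const 2).const_mul _

open Classical in
theorem haarSum_map_coe {Ω : Set (ℝ × ℝ)} (c : DyadicRectangle → ℝ)
    (F : Finset {R : DyadicRectangle // R.toSet ⊆ Ω}) (f : PlaneFun) :
    (f - haarSum c (F.map (Function.Embedding.subtype _)) : PlaneFun) =ᵐ[volume]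
      fun z => f z - ∑ R ∈ F, c R.1 * R.1.haar z := by
  filter_upwards [AEEqFun.coeFn_sub f (haarSum c (F.map (Function.Embedding.subtype _))),
    haarSum_coe c (F.map (Function.Embedding.subtype _))] with z h1 h2
  rw [h1, Pi.sub_apply, h2, Finset.sum_map]
  rfl

section

variable {s : ℝ} {Ω : Set (ℝ × ℝ)} {f g : PlaneFun}

theorem IsHaarSupported.locallyIntegrable (hs : 1 < s) (hf : IsHaarSupported s Ω f) :
    DyadicLocallyIntegrable f :=
  MemLp.dyadicLocallyIntegrable (by simpa using hs.le) hf.1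

theorem IsHaarSupported.tendsto_averages (hs : 1 < s) (hf : IsHaarSupported s Ω f)
    (R : DyadicRectangle) :
    Tendsto (fun F : Finset {R : DyadicRectangle // R.toSet ⊆ Ω} =>
      averages (haarSum (haarCoeff f) (F.map (Function.Embedding.subtype _))) R) atTop
      (𝓝 (averages f R)) := by
  refine BiparameterHardy.tendsto_averages (r := ENNReal.ofReal s) (by simpa using hs.le) hf.1
    (fun F => memLp_haarSum _ _ _) ?_ R
  refine hf.2.congr fun F => ?_
  exact eLpNorm_congr_ae (haarSum_map_coe _ F f).symm

/-- `h_K` has mean zero over every rectangle not contained in `K`; pass to the limit in the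
expansion. Consequently the maximal function of an atom vanishes outside `Ω`, and this localisation
is what makes `p ≤ 1` accessible. -/
theorem IsHaarSupported.averages_eq_zero (hs : 1 < s) (hf : IsHaarSupported s Ω f)
    {R : DyadicRectangle} (hR : ¬ R.toSet ⊆ Ω) : averages f R = 0 := by
  refine tendsto_nhds_unique (hf.tendsto_averages hs R) (tendsto_const_nhds.congr fun F => ?_)
  rw [averages_haarSum, Finset.sum_eq_zero]
  intro K hK
  obtain ⟨K', _, rfl⟩ := Finset.mem_map.1 hK
  by_contra h0
  exact hR ((DyadicRectangle.subset_of_haarSign_ne_zero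
    (right_ne_zero_of_mul (right_ne_zero_of_mul h0))).trans K'.2)

theorem IsHaarSupported.coeff_eq_zero (hs : 1 < s) (hf : IsHaarSupported s Ω f)
    {R : DyadicRectangle} (hR : ¬ R.toSet ⊆ Ω) : coeff (averages f) R = 0 := by
  classical
  refine tendsto_nhds_unique (tendsto_coeff (hf.tendsto_averages hs) R)
    (tendsto_const_nhds.congr fun F => ?_)
  rw [coeff_averages_haarSum, if_neg]
  intro hK
  obtain ⟨K', _, rfl⟩ := Finset.mem_map.1 hK
  exact hR K'.2

theorem IsHaarSupported.sub (hs : 1 < s) (hf : IsHaarSupported s Ω f)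
    (hg : IsHaarSupported s Ω g) : IsHaarSupported s Ω (f - g) := by
  have hs1 : 1 ≤ ENNReal.ofReal s := by simpa using hs.le
  have hfi := hf.locallyIntegrable hs
  have hgi := hg.locallyIntegrable hs
  have hm : MemLp (f - g : PlaneFun) (ENNReal.ofReal s) volume :=
    (memLp_congr_ae (AEEqFun.coeFn_sub f g)).2 (hf.1.sub hg.1)
  refine ⟨hm, ?_⟩
  have h0 := hf.2.add hg.2
  rw [add_zero] at h0
  refine tendsto_of_tendsto_of_tendsto_of_le_of_le tendsto_const_nhds h0 (fun _ => zero_le)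
    fun F => ?_
  simp only
  have hmeas : ∀ f : PlaneFun, AEStronglyMeasurable
      (fun z => f z - ∑ R ∈ F, haarCoeff f R.1 * R.1.haar z) volume := fun f =>
    f.aestronglyMeasurable.sub (Finset.measurable_fun_sum F fun R _ =>
      R.1.measurable_haar.const_mul _).aestronglyMeasurable
  refine le_trans (le_of_eq ?_) (eLpNorm_sub_le (hmeas f) (hmeas g) hs1)
  refine eLpNorm_congr_ae ?_
  filter_upwards [AEEqFun.coeFn_sub f g] with z hz
  have hc : ∀ R, haarCoeff (f - g) R = haarCoeff f R - haarCoeff g R := fun R => by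
    rw [haarCoeff_eq (MemLp.dyadicLocallyIntegrable hs1 hm), haarCoeff_eq hfi, haarCoeff_eq hgi,
      averages_sub hfi hgi, coeff_sub]
  simp only [hz, hc, Pi.sub_apply, sub_mul, Finset.sum_sub_distrib]
  ring

theorem IsHaarSupported.smul (hs : 1 < s) (c : ℝ) (hf : IsHaarSupported s Ω f) :
    IsHaarSupported s Ω (c • f) := by
  have hs1 : 1 ≤ ENNReal.ofReal s := by simpa using hs.le
  have hfi := hf.locallyIntegrable hs
  refine ⟨(memLp_congr_ae (AEEqFun.coeFn_smul c f)).2 (hf.1.const_smul c), ?_⟩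
  have h0 := ENNReal.Tendsto.const_mul (a := ‖c‖ₑ) hf.2 (Or.inr enorm_ne_top)
  rw [mul_zero] at h0
  refine h0.congr fun F => ?_
  rw [← eLpNorm_const_smul]
  refine eLpNorm_congr_ae ?_
  filter_upwards [AEEqFun.coeFn_smul c f] with z hz
  have hc : ∀ R, haarCoeff (c • f) R = c * haarCoeff f R := fun R => by
    rw [haarCoeff_eq (hfi.smul c), haarCoeff_eq hfi, averages_smul, coeff_smul]
  simp only [hz, hc, Pi.smul_apply, smul_eq_mul, mul_sub, Finset.mul_sum, mul_assoc]

/-- By orthonormality the partial sums are eventually equal to the function. -/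
theorem isHaarSupported_haarSum (s : ℝ) {c : DyadicRectangle → ℝ} {F : Finset DyadicRectangle}
    (h : ∀ R ∈ F, c R ≠ 0 → R.toSet ⊆ Ω) : IsHaarSupported s Ω (haarSum c F) := by
  classical
  refine ⟨memLp_haarSum _ _ _, ?_⟩
  refine tendsto_const_nhds.congr' ?_
  filter_upwards [eventually_ge_atTop (F.subtype fun R => R.toSet ⊆ Ω)] with G hG
  symm
  have hz : (fun z => haarSum c F z - ∑ R ∈ G, haarCoeff (haarSum c F) R.1 * R.1.haar z)
      =ᵐ[volume] 0 := by
    filter_upwards [haarSum_coe c F] with z hz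
    rw [hz, Pi.zero_apply, sub_eq_zero]
    have h1 : ∑ R ∈ F, c R * R.haar z =
        ∑ R ∈ F.filter (fun R => R.toSet ⊆ Ω), c R * R.haar z := by
      refine (Finset.sum_filter_of_ne fun R hR h0 => ?_).symm
      exact h R hR (left_ne_zero_of_mul h0)
    rw [h1, ← Finset.sum_subtype_eq_sum_filter]
    refine Finset.sum_subset_zero_on_sdiff hG (fun R hR => ?_) fun R hR => ?_
    · rw [Finset.mem_sdiff, Finset.mem_subtype] at hR
      rw [haarCoeff_eq (dyadicLocallyIntegrable_haarSum _ _), coeff_averages_haarSum,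
        if_neg hR.2, zero_mul]
    · rw [Finset.mem_subtype] at hR
      rw [haarCoeff_eq (dyadicLocallyIntegrable_haarSum _ _), coeff_averages_haarSum, if_pos hR]
  rw [eLpNorm_congr_ae hz, eLpNorm_zero]

theorem IsHaarSupported.truncation (hs : 1 < s) (hf : IsHaarSupported s Ω f) (N : ℕ) :
    IsHaarSupported s Ω (truncation N (averages f)) :=
  isHaarSupported_haarSum s fun R _ h0 => by
    by_contra hR
    exact h0 (hf.coeff_eq_zero hs hR)

/-- The members of `boxes N` inside `Ω` form a cofinal sequence of finite sets, and those not inside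
`Ω` have coefficient zero, so this is the unconditional limit along a sequence. -/
theorem IsHaarSupported.tendsto_truncation (hs : 1 < s) (hf : IsHaarSupported s Ω f) :
    Tendsto (fun N => eLpNorm (f - BiparameterHardy.truncation N (averages f) : PlaneFun)
      (ENNReal.ofReal s) volume) atTop (𝓝 0) := by
  classical
  have hfi := hf.locallyIntegrable hs
  have h1 : Tendsto (fun N => (boxes N).subtype fun R => R.toSet ⊆ Ω) atTop atTop := by
    refine tendsto_atTop_finset_of_monotone
      (fun N N' h R hR => Finset.mem_subtype.2 (boxes_mono h (Finset.mem_subtype.1 hR)))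
      fun R => ?_
    obtain ⟨N, hN⟩ := (eventually_mem_boxes R.1).exists
    exact ⟨N, Finset.mem_subtype.2 hN⟩
  refine (hf.2.comp h1).congr fun N => ?_
  refine eLpNorm_congr_ae ?_
  filter_upwards [AEEqFun.coeFn_sub f (BiparameterHardy.truncation N (averages f)),
    haarSum_coe (coeff (averages f)) (boxes N)] with z hz1 hz2
  rw [hz1, Pi.sub_apply, BiparameterHardy.truncation, hz2]
  congr 1
  rw [Finset.sum_subtype_eq_sum_filter (f := fun R => haarCoeff f R * R.haar z),
    Finset.sum_filter_of_ne]
  · exact Finset.sum_congr rfl fun R _ => by rw [haarCoeff_eq hfi]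
  · intro R _ h0
    by_contra hR
    rw [haarCoeff_eq hfi, hf.coeff_eq_zero hs hR, zero_mul] at h0
    exact h0 rfl

end

theorem IsHaarSupported.maximalFun_eq_zero {s : ℝ} (hs : 1 < s) {Ω : Set (ℝ × ℝ)} {f : PlaneFun}
    (hf : IsHaarSupported s Ω f) {z : ℝ × ℝ} (hz : z ∉ Ω) : maximalFun (averages f) z = 0 := by
  rw [← nonpos_iff_eq_zero]
  refine iSup₂_le fun R hR => ?_
  rw [hf.averages_eq_zero hs fun h => hz (h hR)]
  simp

end BiparameterHardy

/-! ### Level sets of the maximal function and the Carleson condition. -/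

namespace BiparameterHardy

open DyadicInterval

/-- The level sets of the maximal function of a family. -/
def levelSet (a : DyadicRectangle → ℝ) (k : ℤ) : Set (ℝ × ℝ) :=
  {z | (2 : ℝ≥0∞) ^ (k : ℝ) < maximalFun a z}

theorem measurableSet_levelSet (a : DyadicRectangle → ℝ) (k : ℤ) :
    MeasurableSet (levelSet a k) :=
  measurableSet_lt measurable_const (measurable_maximalFun a)

theorem levelSet_anti (a : DyadicRectangle → ℝ) {k l : ℤ} (h : k ≤ l) :
    levelSet a l ⊆ levelSet a k := fun _ hz =>
  (two_rpow_le (by exact_mod_cast h : (k : ℝ) ≤ l)).trans_lt hz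

/-- The level set occupies more than an eighth of the rectangle. -/
def IsThick (a : DyadicRectangle → ℝ) (k : ℤ) (R : DyadicRectangle) : Prop :=
  volume R.toSet < 8 * volume (R.toSet ∩ levelSet a k)

theorem IsThick.anti {a : DyadicRectangle → ℝ} {k l : ℤ} (h : k ≤ l) {R : DyadicRectangle}
    (hR : IsThick a l R) : IsThick a k R :=
  hR.trans_le (mul_le_mul_right (measure_mono (Set.inter_subset_inter_right _
    (levelSet_anti a h))) _)

/-- The union of the rectangles of which the level set occupies more than an eighth. -/
def enlargement (a : DyadicRectangle → ℝ) (k : ℤ) : Set (ℝ × ℝ) :=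
  ⋃ R : {R : DyadicRectangle // IsThick a k R}, R.1.toSet

theorem measurableSet_enlargement (a : DyadicRectangle → ℝ) (k : ℤ) :
    MeasurableSet (enlargement a k) :=
  MeasurableSet.iUnion fun R => R.1.measurableSet_toSet

theorem IsThick.subset_enlargement {a : DyadicRectangle → ℝ} {k : ℤ} {R : DyadicRectangle}
    (h : IsThick a k R) : R.toSet ⊆ enlargement a k :=
  Set.subset_iUnion (fun R : {R : DyadicRectangle // IsThick a k R} => R.1.toSet) ⟨R, h⟩

/-- The constant in `volume_enlargement_le`. -/
def enlargementConst : ℝ≥0∞ := 8 ^ (2 : ℝ) * maximalConst 2 ^ 2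

theorem enlargementConst_ne_top : enlargementConst ≠ ⊤ :=
  ENNReal.mul_ne_top (ENNReal.rpow_ne_top_of_nonneg (by norm_num) (by norm_num))
    (ENNReal.pow_ne_top (maximalConst_ne_top (by norm_num)))

/-- On the enlargement the strong maximal function of the indicator of the level set is at least
1/8; apply Chebyshev's inequality and the `L²` bound. -/
theorem volume_enlargement_le (a : DyadicRectangle → ℝ) (k : ℤ) :
    volume (enlargement a k) ≤ enlargementConst * volume (levelSet a k) := by
  set g : ℝ × ℝ → ℝ≥0∞ := (levelSet a k).indicator fun _ => 1 with hg
  have hgm : Measurable g := measurable_const.indicator (measurableSet_levelSet a k)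
  have h1 : ∀ z ∈ enlargement a k, 1 ≤ 8 * maximalPlane g z := by
    intro z hz
    obtain ⟨⟨R, hR⟩, hzR⟩ := Set.mem_iUnion.1 hz
    have h2 : (∫⁻ w in R.toSet, g w) / volume R.toSet ≤ maximalPlane g z :=
      le_iSup₂_of_le R hzR le_rfl
    refine le_trans ?_ (mul_le_mul_right h2 8)
    rw [hg, lintegral_indicator_const (measurableSet_levelSet a k), one_mul,
      Measure.restrict_apply (measurableSet_levelSet a k), Set.inter_comm, ← mul_div_assoc]
    rw [ENNReal.le_div_iff_mul_le (Or.inl R.volume_toSet_ne_zero)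
      (Or.inl R.volume_toSet_ne_top), one_mul]
    exact hR.le
  calc volume (enlargement a k) = ∫⁻ z, (enlargement a k).indicator (fun _ => 1) z := by
        rw [lintegral_indicator_const (measurableSet_enlargement a k), one_mul]
    _ ≤ ∫⁻ z, 8 ^ (2 : ℝ) * maximalPlane g z ^ (2 : ℝ) := by
        refine lintegral_mono fun z => ?_
        by_cases hz : z ∈ enlargement a k
        · rw [Set.indicator_of_mem hz, ← ENNReal.mul_rpow_of_nonneg _ _ (by norm_num)]
          exact ENNReal.one_le_rpow (h1 z hz) (by norm_num)
        · rw [Set.indicator_of_notMem hz]; exact zero_le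
    _ = 8 ^ (2 : ℝ) * ∫⁻ z, maximalPlane g z ^ (2 : ℝ) := lintegral_const_mul' _ _
        (ENNReal.rpow_ne_top_of_nonneg (by norm_num) (by norm_num))
    _ ≤ 8 ^ (2 : ℝ) * (maximalConst 2 ^ 2 * ∫⁻ z, g z ^ (2 : ℝ)) := by
        gcongr
        exact lintegral_maximalPlane_rpow_le (by norm_num) hgm
    _ = _ := by
        have : ∀ z, g z ^ (2 : ℝ) = (levelSet a k).indicator (fun _ => 1) z := fun z => by
          by_cases hz : z ∈ levelSet a k <;> simp [hg, hz]
        simp_rw [this]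
        rw [lintegral_indicator_const (measurableSet_levelSet a k), one_mul, enlargementConst,
          mul_assoc]

theorem tsum_volume_enlargement_le (a : DyadicRectangle → ℝ) {p : ℝ} (hp : 0 < p) :
    ∑' k : ℤ, (2 : ℝ≥0∞) ^ ((k : ℝ) * p) * volume (enlargement a k) ≤
      enlargementConst * geomConst p * ∫⁻ z, maximalFun a z ^ p := by
  calc _ ≤ ∑' k : ℤ, enlargementConst * ((2 : ℝ≥0∞) ^ ((k : ℝ) * p) * volume (levelSet a k)) := by
        refine ENNReal.tsum_le_tsum fun k => ?_
        rw [mul_left_comm]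
        exact mul_le_mul_right (volume_enlargement_le a k) _
    _ ≤ _ := by
        rw [ENNReal.tsum_mul_left, mul_assoc]
        exact mul_le_mul_right (tsum_measure_level_le hp (measurable_maximalFun a)) _

open Classical in
/-- The largest `k` for which `R` is thick. -/
def level (a : DyadicRectangle → ℝ) (R : DyadicRectangle) : ℤ :=
  if h : ∃ k, IsThick a k R ∧ ¬ IsThick a (k + 1) R then h.choose else 0

theorem level_spec {a : DyadicRectangle → ℝ} {p : ℝ} (hp : 0 < p)
    (ha : ∫⁻ z, maximalFun a z ^ p < ⊤) {R : DyadicRectangle} (hR : coeff a R ≠ 0) :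
    IsThick a (level a R) R ∧ ¬ IsThick a (level a R + 1) R := by
  classical
  suffices h : ∃ k, IsThick a k R ∧ ¬ IsThick a (k + 1) R by
    rw [level, dif_pos h]; exact h.choose_spec
  obtain ⟨I, J⟩ := R
  -- A non-zero coefficient forces `a ≠ 0` on one of the four quarters of `R`. That quarter lies in
  -- every sufficiently low level set, and a quarter is more than the eighth required for thickness.
  have hne : ∃ I' J' : DyadicInterval, I'.toSet ⊆ I.toSet ∧ J'.toSet ⊆ J.toSet ∧
      I'.length = I.length / 2 ∧ J'.length = J.length / 2 ∧ a (I', J') ≠ 0 := by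
    by_contra! hcon
    apply hR
    rw [coeff, mixedDiff]
    simp only [diff]
    rw [hcon I.left J.left I.left_subset J.left_subset I.length_left J.length_left,
      hcon I.left J.right I.left_subset J.right_subset I.length_left J.length_right,
      hcon I.right J.left I.right_subset J.left_subset I.length_right J.length_left,
      hcon I.right J.right I.right_subset J.right_subset I.length_right J.length_right]
    simp
  obtain ⟨I', J', hI, hJ, hI', hJ', h0⟩ := hne
  have hthick : ∃ k, IsThick a k (I, J) := by
    obtain ⟨k, hk, -⟩ := exists_dyadic_level (x := ENNReal.ofReal |a (I', J')|)
      (by simpa using h0) ENNReal.ofReal_ne_top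
    refine ⟨k, ?_⟩
    have hsub : DyadicRectangle.toSet (I', J') ⊆
        DyadicRectangle.toSet (I, J) ∩ levelSet a k := fun z hz =>
      ⟨DyadicRectangle.toSet_mono hI hJ hz, hk.trans_le (le_iSup₂_of_le (I', J') hz le_rfl)⟩
    refine lt_of_lt_of_le ?_ (mul_le_mul_right (measure_mono hsub) 8)
    rw [DyadicRectangle.volume_toSet_eq, DyadicRectangle.volume_toSet_eq,
      show (8 : ℝ≥0∞) = ENNReal.ofReal 8 by norm_num, ← ENNReal.ofReal_mul (by norm_num)]
    have hpos := DyadicRectangle.area_pos (I, J)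
    refine (ENNReal.ofReal_lt_ofReal_iff ?_).2 ?_
    · exact mul_pos (by norm_num) (DyadicRectangle.area_pos _)
    · simp only [DyadicRectangle.area] at hpos ⊢
      rw [hI', hJ']; linarith
  -- Thickness at level `n` would give `|R| < 8 |Ω_n| ≤ 8 * 2^{-np} ‖Ma‖_p^p`, which fails for large
  -- `n`.
  have hbdd : ∃ b, ¬ IsThick a b (I, J) := by
    set A := ∫⁻ z, maximalFun a z ^ p with hA
    have hV0 := DyadicRectangle.volume_toSet_ne_zero (I, J)
    set V := volume (DyadicRectangle.toSet (I, J)) with hV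
    have h8 : 8 * A / V ≠ ⊤ := ENNReal.div_ne_top (ENNReal.mul_ne_top (by norm_num) ha.ne) hV0
    have htend : Tendsto (fun n : ℕ => (2 : ℝ≥0∞) ^ ((n : ℝ) * p)) atTop (𝓝 ⊤) := by
      have h1 : ∀ n : ℕ, (2 : ℝ≥0∞) ^ ((n : ℝ) * p) = ((2 : ℝ≥0∞) ^ p) ^ n := fun n => by
        rw [mul_comm, ENNReal.rpow_mul, ENNReal.rpow_natCast]
      simp_rw [h1]
      exact ENNReal.tendsto_pow_atTop_nhds_top_iff.2 (ENNReal.one_lt_rpow (by norm_num) hp)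
    obtain ⟨n, hn⟩ := (htend.eventually (lt_mem_nhds h8.lt_top)).exists
    refine ⟨n, fun hthick => ?_⟩
    have h1 : (2 : ℝ≥0∞) ^ ((n : ℝ) * p) * volume (levelSet a n) ≤ A := by
      calc _ = ∫⁻ z, (levelSet a n).indicator (fun _ => (2 : ℝ≥0∞) ^ ((n : ℝ) * p)) z := by
            rw [lintegral_indicator_const (measurableSet_levelSet a n)]
        _ ≤ A := by
            refine lintegral_mono fun z => ?_
            by_cases hz : z ∈ levelSet a n
            · rw [Set.indicator_of_mem hz, ENNReal.rpow_mul]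
              have hz' : (2 : ℝ≥0∞) ^ (((n : ℤ) : ℝ)) < maximalFun a z := hz
              push_cast at hz'
              gcongr
            · rw [Set.indicator_of_notMem hz]; exact zero_le
    have h2 : V < 8 * volume (levelSet a n) :=
      hthick.trans_le (mul_le_mul_right (measure_mono Set.inter_subset_right) _)
    have h3 : 8 * A < 2 ^ ((n : ℝ) * p) * V := by
      rwa [ENNReal.div_lt_iff (Or.inl hV0) (Or.inl (DyadicRectangle.volume_toSet_ne_top _))] at hn
    have h4 : (2 : ℝ≥0∞) ^ ((n : ℝ) * p) * V ≤ 8 * A := by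
      calc _ ≤ 2 ^ ((n : ℝ) * p) * (8 * volume (levelSet a n)) := by gcongr
        _ = 8 * (2 ^ ((n : ℝ) * p) * volume (levelSet a n)) := by ring
        _ ≤ _ := by gcongr
    exact h3.not_ge h4
  obtain ⟨b, hb⟩ := hbdd
  obtain ⟨k, hk, hmax⟩ := Int.exists_greatest_of_bdd (P := fun k => IsThick a k (I, J))
    ⟨b, fun k hk => by
      by_contra hlt
      exact hb (hk.anti (by omega))⟩ hthick
  exact ⟨k, hk, fun h => by have := hmax _ h; omega⟩

theorem measureReal_inter_fst_halves {G : Set (ℝ × ℝ)} (hG : MeasurableSet G)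
    (I J : DyadicInterval) :
    volume.real (DyadicRectangle.toSet (I, J) ∩ G) =
      volume.real (DyadicRectangle.toSet (I.left, J) ∩ G) +
        volume.real (DyadicRectangle.toSet (I.right, J) ∩ G) := by
  rw [DyadicRectangle.toSet_fst_halves, Set.union_inter_distrib_right]
  exact measureReal_union
    ((DyadicRectangle.disjoint_fst_halves I J).mono Set.inter_subset_left Set.inter_subset_left)
    ((DyadicRectangle.measurableSet_toSet _).inter hG)
    (measure_ne_top_of_subset Set.inter_subset_left (DyadicRectangle.volume_toSet_ne_top _))
    (measure_ne_top_of_subset Set.inter_subset_left (DyadicRectangle.volume_toSet_ne_top _))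

theorem measureReal_inter_snd_halves {G : Set (ℝ × ℝ)} (hG : MeasurableSet G)
    (I J : DyadicInterval) :
    volume.real (DyadicRectangle.toSet (I, J) ∩ G) =
      volume.real (DyadicRectangle.toSet (I, J.left) ∩ G) +
        volume.real (DyadicRectangle.toSet (I, J.right) ∩ G) := by
  rw [DyadicRectangle.toSet_snd_halves, Set.union_inter_distrib_right]
  exact measureReal_union
    ((DyadicRectangle.disjoint_snd_halves I J).mono Set.inter_subset_left Set.inter_subset_left)
    ((DyadicRectangle.measurableSet_toSet _).inter hG)
    (measure_ne_top_of_subset Set.inter_subset_left (DyadicRectangle.volume_toSet_ne_top _))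
    (measure_ne_top_of_subset Set.inter_subset_left (DyadicRectangle.volume_toSet_ne_top _))

/-- The Carleson embedding with the density of `G` as cutoff, once for each of the four products of
top intervals: `1024 = 4 * 256`. -/
theorem sum_boxes_le {u : DyadicRectangle → ℝ} (hu : IsConsistent u) {G : Set (ℝ × ℝ)}
    (hG : MeasurableSet G) (hG' : volume G ≠ ⊤) {c : ℝ}
    (h : ∀ R : DyadicRectangle, (R.toSet ∩ G).Nonempty → u R ^ 2 ≤ c) (hc : 0 ≤ c) (N : ℕ) :
    ∑ R ∈ boxes N, R.area * (mixedDiff u R ^ 2 * (volume.real (R.toSet ∩ G) / R.area) ^ 2) ≤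
      1024 * c * volume.real G := by
  set v : DyadicRectangle → ℝ := fun R => volume.real (R.toSet ∩ G) / R.area with hv
  have hv0 : ∀ R, 0 ≤ v R := fun R => div_nonneg measureReal_nonneg R.area_pos.le
  have hv1 : ∀ R, v R ≤ 1 := fun R => by
    rw [hv]; simp only
    rw [div_le_one R.area_pos, ← R.volume_real_toSet]
    exact measureReal_mono Set.inter_subset_left R.volume_toSet_ne_top
  have hvc : IsConsistent v := by
    intro I J
    have hI := I.length_pos.ne'
    have hJ := J.length_pos.ne'
    simp only [hv]
    constructor
    · rw [measureReal_inter_fst_halves hG]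
      simp only [DyadicRectangle.area, length_left, length_right]
      field_simp
    · rw [measureReal_inter_snd_halves hG]
      simp only [DyadicRectangle.area, length_left, length_right]
      field_simp
  have hb : ∀ R, v R ≠ 0 → u R ^ 2 ≤ c := by
    intro R hR
    refine h R (Set.nonempty_iff_ne_empty.2 fun h0 => hR ?_)
    simp [hv, h0]
  have hpiece : ∀ b b', ∑ I ∈ tree (2 * N) (top N b), ∑ J ∈ tree (2 * N) (top N b'),
      I.length * J.length * (mixedDiff u (I, J) ^ 2 * v (I, J) ^ 2) ≤
        256 * c * volume.real G := by
    intro b b'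
    refine (sum_mixedDiff_sq_mul_sq_le hu hvc hv0 hv1 hb _ _ _ _).trans ?_
    refine mul_le_mul_of_nonneg_left ?_ (by positivity)
    have h1 : (top N b).length * (top N b').length * v (top N b, top N b') =
        volume.real (DyadicRectangle.toSet (top N b, top N b') ∩ G) :=
      mul_div_cancel₀ _ (DyadicRectangle.area_pos (top N b, top N b')).ne'
    rw [h1]
    exact measureReal_mono Set.inter_subset_right hG'
  have h2 : ∑ R ∈ boxes N, R.area * (mixedDiff u R ^ 2 * v R ^ 2) =
      ∑ I ∈ box N, ∑ J ∈ box N, I.length * J.length * (mixedDiff u (I, J) ^ 2 * v (I, J) ^ 2) := by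
    rw [boxes, Finset.sum_product]; rfl
  rw [h2, sum_box]
  simp only [sum_box, Finset.sum_add_distrib]
  linarith [hpiece true true, hpiece true false, hpiece false true, hpiece false false]

/-- The Carleson condition for the coefficients at rectangles that are not thick at the
next level. -/
theorem sum_coeff_sq_le {a : DyadicRectangle → ℝ} (ha : IsConsistent a) {k : ℤ}
    {F : Finset DyadicRectangle} {W : Set (ℝ × ℝ)} (hW : MeasurableSet W)
    (hF : ∀ R ∈ F, R.toSet ⊆ W ∧ ¬ IsThick a (k + 1) R) :
    ∑ R ∈ F, ENNReal.ofReal (coeff a R ^ 2) ≤ 8192 * 2 ^ ((k : ℝ) * 2) * volume W := by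
  classical
  by_cases hWt : volume W = ⊤
  · rw [hWt, ENNReal.mul_top (mul_ne_zero (by norm_num) (two_rpow_ne_zero _))]
    exact le_top
  -- A rectangle that meets `G` contains a point with `Ma ≤ 2^{k+1}`, so the value of `a` there is
  -- at most `l = 2^{k+1}` in modulus.
  set G := W \ levelSet a (k + 1) with hG
  have hGm : MeasurableSet G := hW.diff (measurableSet_levelSet a _)
  have hGt : volume G ≠ ⊤ := measure_ne_top_of_subset Set.sdiff_subset hWt
  set l : ℝ := ((2 : ℝ≥0∞) ^ ((k : ℝ) + 1)).toReal with hl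
  have hb : ∀ R : DyadicRectangle, (R.toSet ∩ G).Nonempty → a R ^ 2 ≤ l ^ 2 := by
    rintro R ⟨z, hz, hzG⟩
    have h1 : ¬ (2 : ℝ≥0∞) ^ (((k + 1 : ℤ) : ℝ)) < maximalFun a z := hzG.2
    push_cast at h1
    have h2 : ENNReal.ofReal |a R| ≤ 2 ^ ((k : ℝ) + 1) :=
      (le_iSup₂_of_le R hz le_rfl).trans (not_lt.1 h1)
    have h3 := (ENNReal.ofReal_le_iff_le_toReal (two_rpow_ne_top _)).1 h2
    exact sq_le_sq' (by linarith [neg_abs_le (a R)]) ((le_abs_self _).trans h3)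
  obtain ⟨N, hN⟩ : ∃ N, F ⊆ boxes N := by
    have h1 : ∀ᶠ N in atTop, ∀ R ∈ F, R ∈ boxes N :=
      (Filter.eventually_all_finset F).2 fun R _ => eventually_mem_boxes R
    exact h1.exists
  -- A rectangle in `W` that is not thick keeps at least 7/8 of its area in `G`, and `2 (7/8)² ≥ 1`,
  -- so the cutoff is inserted at the cost of a factor `2`. With `1024` from `sum_boxes_le` and `l²
  -- = 4 * 2^{2k}` this makes `8192`.
  have hv : ∀ R ∈ F, coeff a R ^ 2 ≤
      2 * (R.area * (mixedDiff a R ^ 2 * (volume.real (R.toSet ∩ G) / R.area) ^ 2)) := by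
    intro R hR
    have h1 : volume.real R.toSet = volume.real (R.toSet ∩ levelSet a (k + 1)) +
        volume.real (R.toSet ∩ G) := by
      rw [← measureReal_inter_add_sdiff (s := R.toSet) (measurableSet_levelSet a (k + 1))
        R.volume_toSet_ne_top, hG]
      congr 2
      ext z
      exact ⟨fun hz => ⟨hz.1, (hF R hR).1 hz.1, hz.2⟩, fun hz => ⟨hz.1, hz.2.2⟩⟩
    have h2 : 8 * volume.real (R.toSet ∩ levelSet a (k + 1)) ≤ volume.real R.toSet := by
      have h3 := not_lt.1 (hF R hR).2
      have h4 := ENNReal.toReal_mono R.volume_toSet_ne_top h3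
      rw [ENNReal.toReal_mul] at h4
      simpa [measureReal_def] using h4
    rw [R.volume_real_toSet] at h1 h2
    have hA := R.area_pos
    have h3 : 7 / 8 ≤ volume.real (R.toSet ∩ G) / R.area := by
      rw [le_div_iff₀ hA]; linarith
    have h4 : 1 ≤ 2 * (volume.real (R.toSet ∩ G) / R.area) ^ 2 := by nlinarith
    have h5 : 0 ≤ R.area * mixedDiff a R ^ 2 := by positivity
    rw [coeff, mul_pow, Real.sq_sqrt hA.le]
    nlinarith
  have hmain := sum_boxes_le ha hGm hGt hb (sq_nonneg l) N
  have h6 : ∑ R ∈ F, coeff a R ^ 2 ≤ 2048 * l ^ 2 * volume.real W := by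
    calc ∑ R ∈ F, coeff a R ^ 2 ≤ ∑ R ∈ F,
          2 * (R.area * (mixedDiff a R ^ 2 * (volume.real (R.toSet ∩ G) / R.area) ^ 2)) :=
          Finset.sum_le_sum hv
      _ ≤ ∑ R ∈ boxes N,
          2 * (R.area * (mixedDiff a R ^ 2 * (volume.real (R.toSet ∩ G) / R.area) ^ 2)) :=
          Finset.sum_le_sum_of_subset_of_nonneg hN fun R _ _ => by
            have := R.area_pos; positivity
      _ ≤ 2 * (1024 * l ^ 2 * volume.real G) := by
          rw [← Finset.mul_sum]; exact mul_le_mul_of_nonneg_left hmain (by norm_num)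
      _ ≤ 2 * (1024 * l ^ 2 * volume.real W) := by
          have := measureReal_mono (μ := volume) (Set.sdiff_subset : G ⊆ W) hWt
          gcongr
      _ = _ := by ring
  rw [← ENNReal.ofReal_sum_of_nonneg fun R _ => sq_nonneg _]
  refine (ENNReal.ofReal_le_ofReal h6).trans (le_of_eq ?_)
  rw [ENNReal.ofReal_mul (by positivity), ENNReal.ofReal_mul (by norm_num),
    ENNReal.ofReal_pow ENNReal.toReal_nonneg, ENNReal.ofReal_toReal (two_rpow_ne_top _),
    measureReal_def, ENNReal.ofReal_toReal hWt, ← ENNReal.rpow_natCast, ← ENNReal.rpow_mul,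
    show ((k : ℝ) + 1) * ((2 : ℕ) : ℝ) = k * 2 + (2 : ℕ) by push_cast; ring, two_rpow_add,
    ENNReal.rpow_natCast]
  rw [show ENNReal.ofReal 2048 = 2048 by norm_num]
  ring

end BiparameterHardy

/-! ### From the Carleson condition to `L^s` by duality. -/

namespace BiparameterHardy

open DyadicInterval

theorem eLpNorm_ofReal_eq {s : ℝ} (hs : 0 < s) (f : PlaneFun) :
    eLpNorm f (ENNReal.ofReal s) volume = (∫⁻ z, ‖f z‖ₑ ^ s) ^ (1 / s) := by
  rw [eLpNorm_eq_lintegral_rpow_enorm_toReal (by simpa using hs) ENNReal.ofReal_ne_top,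
    ENNReal.toReal_ofReal hs.le]

theorem lintegral_rpow_lt_top_of_memLp {s : ℝ} (hs : 0 < s) {f : PlaneFun}
    (hf : MemLp f (ENNReal.ofReal s) volume) : ∫⁻ z, ‖f z‖ₑ ^ s < ⊤ := by
  have h := lintegral_rpow_enorm_lt_top_of_eLpNorm_lt_top (by simpa using hs)
    ENNReal.ofReal_ne_top hf.2
  rwa [ENNReal.toReal_ofReal hs.le] at h

theorem enorm_mul_abs_rpow {s : ℝ} (hs : 1 < s) (x : ℝ) :
    ‖x * |x| ^ (s - 2)‖ₑ = ‖x‖ₑ ^ (s - 1) := by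
  by_cases hx : x = 0
  · rw [hx, zero_mul, enorm_zero, ENNReal.zero_rpow_of_pos (by linarith)]
  · have hx' : 0 < |x| := abs_pos.2 hx
    rw [Real.enorm_eq_ofReal_abs, Real.enorm_eq_ofReal_abs, ENNReal.ofReal_rpow_of_pos hx', abs_mul,
      abs_of_nonneg (Real.rpow_nonneg hx'.le _), show s - 1 = 1 + (s - 2) by ring,
      Real.rpow_add hx', Real.rpow_one]

theorem ofReal_mul_mul_abs_rpow {s : ℝ} (hs : 1 < s) (x : ℝ) :
    ENNReal.ofReal (x * (x * |x| ^ (s - 2))) = ‖x‖ₑ ^ s := by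
  have h0 : 0 ≤ x * (x * |x| ^ (s - 2)) := by
    rw [← mul_assoc]
    exact mul_nonneg (mul_self_nonneg x) (Real.rpow_nonneg (abs_nonneg x) _)
  rw [← abs_of_nonneg h0, ← Real.enorm_eq_ofReal_abs, enorm_mul, enorm_mul_abs_rpow hs]
  nth_rewrite 1 [← ENNReal.rpow_one ‖x‖ₑ]
  rw [← ENNReal.rpow_add_of_nonneg _ _ (by norm_num) (by linarith)]
  congr 1; ring

/-- The constant in `lintegral_haarSum_rpow_le`. -/
def dualityConst (s : ℝ) : ℝ≥0∞ :=
  8192 ^ (1 / 2 : ℝ) * (geomConst 1 * (enlargementConst * geomConst s.conjExponent *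
    maximalConst s.conjExponent ^ 2) ^ (1 / s.conjExponent))

theorem dualityConst_ne_top {s : ℝ} (hs : 1 < s) : dualityConst s ≠ ⊤ := by
  have hst := Real.HolderConjugate.conjExponent hs
  have ht := hst.symm.lt
  refine ENNReal.mul_ne_top (ENNReal.rpow_ne_top_of_nonneg (by norm_num) (by norm_num))
    (ENNReal.mul_ne_top (geomConst_ne_top one_pos) (ENNReal.rpow_ne_top_of_nonneg
      (one_div_nonneg.2 (by linarith)) ?_))
  exact ENNReal.mul_ne_top (ENNReal.mul_ne_top enlargementConst_ne_top
    (geomConst_ne_top (by linarith))) (ENNReal.pow_ne_top (maximalConst_ne_top ht))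

theorem ofReal_abs_rpow_two (x : ℝ) : ENNReal.ofReal |x| ^ (2 : ℝ) = ENNReal.ofReal (x ^ 2) := by
  rw [ENNReal.ofReal_rpow_of_nonneg (abs_nonneg x) (by norm_num)]
  congr 1
  rw [Real.rpow_two, sq_abs]

open Classical in
/-- The pairing of a sequence satisfying a Carleson condition with the coefficients of a
consistent family. -/
theorem sum_mul_coeff_le {s t : ℝ} (hst : s.HolderConjugate t)
    {c : DyadicRectangle → ℝ} {F : Finset DyadicRectangle} {W₀ : Set (ℝ × ℝ)}
    (hW₀ : MeasurableSet W₀) (hF : ∀ R ∈ F, R.toSet ⊆ W₀) {B : ℝ≥0∞}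
    (hB : ∀ W, MeasurableSet W →
      ∑ R ∈ F with R.toSet ⊆ W, ENNReal.ofReal (c R ^ 2) ≤ B * volume W)
    {u : DyadicRectangle → ℝ} (hu : IsConsistent u) (hut : ∫⁻ z, maximalFun u z ^ t < ⊤) :
    ∑ R ∈ F, ENNReal.ofReal |c R| * ENNReal.ofReal |coeff u R| ≤
      8192 ^ (1 / 2 : ℝ) * B ^ (1 / 2 : ℝ) * (geomConst 1 * (volume W₀ ^ (1 / s) *
        (enlargementConst * geomConst t * ∫⁻ z, maximalFun u z ^ t) ^ (1 / t))) := by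
  have ht0 : 0 < t := hst.symm.pos
  set F' := F.filter fun R => coeff u R ≠ 0 with hF'
  set S := F'.image (level u) with hS
  have hlev : ∀ R ∈ F', IsThick u (level u R) R ∧ ¬ IsThick u (level u R + 1) R := fun R hR =>
    level_spec ht0 hut (Finset.mem_filter.1 hR).2
  -- The rectangles of level `j` for `u` lie in `W = W₀ ∩ enlargement u j`. Cauchy–Schwarz applies
  -- with a Carleson bound on the same `W` for both sequences: for `c` by hypothesis, for the
  -- coefficients of `u` because the rectangles are not thick at level `j + 1`.
  have hpiece : ∀ j ∈ S, ∑ R ∈ F' with level u R = j,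
      ENNReal.ofReal |c R| * ENNReal.ofReal |coeff u R| ≤
      8192 ^ (1 / 2 : ℝ) * B ^ (1 / 2 : ℝ) * (2 ^ (j : ℝ) * volume (W₀ ∩ enlargement u j)) := by
    intro j _
    set W := W₀ ∩ enlargement u j with hW
    have hWm : MeasurableSet W := hW₀.inter (measurableSet_enlargement u j)
    have hsub : ∀ R ∈ F'.filter fun R => level u R = j,
        R ∈ F ∧ R.toSet ⊆ W ∧ ¬ IsThick u (j + 1) R := by
      intro R hR
      obtain ⟨h1, rfl⟩ := Finset.mem_filter.1 hR
      have h2 := (Finset.mem_filter.1 h1).1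
      exact ⟨h2, Set.subset_inter (hF R h2) (hlev R h1).1.subset_enlargement, (hlev R h1).2⟩
    have h1 : ∑ R ∈ F' with level u R = j, ENNReal.ofReal (c R ^ 2) ≤ B * volume W :=
      (Finset.sum_le_sum_of_subset fun R hR =>
        Finset.mem_filter.2 ⟨(hsub R hR).1, (hsub R hR).2.1⟩).trans (hB W hWm)
    have h2 : ∑ R ∈ F' with level u R = j, ENNReal.ofReal (coeff u R ^ 2) ≤
        8192 * 2 ^ ((j : ℝ) * 2) * volume W :=
      sum_coeff_sq_le hu hWm fun R hR => (hsub R hR).2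
    refine (ENNReal.inner_le_Lp_mul_Lq _ _ _ Real.HolderConjugate.two_two).trans ?_
    simp_rw [ofReal_abs_rpow_two]
    calc _ ≤ (B * volume W) ^ (1 / 2 : ℝ) * (8192 * 2 ^ ((j : ℝ) * 2) * volume W) ^ (1 / 2 : ℝ) := by
          gcongr
      _ = _ := by
          rw [ENNReal.mul_rpow_of_nonneg _ _ (by norm_num), ENNReal.mul_rpow_of_nonneg _ _
            (by norm_num), ENNReal.mul_rpow_of_nonneg _ _ (by norm_num), ← ENNReal.rpow_mul,
            show (j : ℝ) * 2 * (1 / 2) = j by ring]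
          have h3 : volume W ^ (1 / 2 : ℝ) * volume W ^ (1 / 2 : ℝ) = volume W := by
            rw [← ENNReal.rpow_add_of_nonneg _ _ (by norm_num) (by norm_num)]
            norm_num
          calc _ = 8192 ^ (1 / 2 : ℝ) * B ^ (1 / 2 : ℝ) * (2 ^ (j : ℝ) *
                (volume W ^ (1 / 2 : ℝ) * volume W ^ (1 / 2 : ℝ))) := by ring
            _ = _ := by rw [h3]
  calc ∑ R ∈ F, ENNReal.ofReal |c R| * ENNReal.ofReal |coeff u R|
      = ∑ R ∈ F', ENNReal.ofReal |c R| * ENNReal.ofReal |coeff u R| := by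
        rw [hF', Finset.sum_filter_of_ne]
        intro R _ h0 h1
        exact h0 (by simp [h1])
    _ = ∑ j ∈ S, ∑ R ∈ F' with level u R = j,
          ENNReal.ofReal |c R| * ENNReal.ofReal |coeff u R| :=
        (Finset.sum_fiberwise_of_maps_to (fun R hR => Finset.mem_image_of_mem _ hR) _).symm
    _ ≤ ∑ j ∈ S, 8192 ^ (1 / 2 : ℝ) * B ^ (1 / 2 : ℝ) *
          (2 ^ (j : ℝ) * volume (W₀ ∩ enlargement u j)) := Finset.sum_le_sum hpiece
    _ ≤ 8192 ^ (1 / 2 : ℝ) * B ^ (1 / 2 : ℝ) * (geomConst 1 * (volume W₀ ^ (1 / s) *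
          (∑ j ∈ S, (2 : ℝ≥0∞) ^ ((j : ℝ) * t) * volume (enlargement u j)) ^ (1 / t))) := by
        rw [← Finset.mul_sum]
        gcongr
        exact sum_two_rpow_mul_measure_inter_le hst S
          (fun j _ => measurableSet_enlargement u j) hW₀
    _ ≤ _ := by
        gcongr
        exact (ENNReal.sum_le_tsum S).trans (tsum_volume_enlargement_le u ht0)

open Classical in
/-- A Haar sum whose coefficients satisfy a Carleson condition is in every `L^s`. -/
theorem lintegral_haarSum_rpow_le {s : ℝ} (hs : 1 < s) {c : DyadicRectangle → ℝ}
    {F : Finset DyadicRectangle} {W₀ : Set (ℝ × ℝ)} (hW₀ : MeasurableSet W₀)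
    (hF : ∀ R ∈ F, R.toSet ⊆ W₀) {B : ℝ≥0∞}
    (hB : ∀ W, MeasurableSet W →
      ∑ R ∈ F with R.toSet ⊆ W, ENNReal.ofReal (c R ^ 2) ≤ B * volume W) :
    (∫⁻ z, ‖haarSum c F z‖ₑ ^ s) ^ (1 / s) ≤
      dualityConst s * (B ^ (1 / 2 : ℝ) * volume W₀ ^ (1 / s)) := by
  have hst := Real.HolderConjugate.conjExponent hs
  set t := s.conjExponent with ht
  have ht1 : 1 < t := hst.symm.lt
  have hs0 : 0 < s := by linarith
  have ht0 : 0 < t := by linarith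
  obtain ⟨f, hf⟩ : ∃ f, f = haarSum c F := ⟨_, rfl⟩
  have hfm : Measurable f := f.measurable
  have hfs : MemLp f (ENNReal.ofReal s) volume := hf ▸ memLp_haarSum c F _
  have hst' : (s - 1) * t = s := hst.sub_one_mul_conj
  rw [← hf]
  obtain ⟨X, hX⟩ : ∃ X, X = ∫⁻ z, ‖f z‖ₑ ^ s := ⟨_, rfl⟩
  have hXt : X ≠ ⊤ := hX ▸ (lintegral_rpow_lt_top_of_memLp hs0 hfs).ne
  -- The dual function `g = f |f|^{s-2}`, for which `f g = |f|^s = |g|^t`.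
  have hg₀m : Measurable fun z => f z * |f z| ^ (s - 2) := by fun_prop
  obtain ⟨g, hg⟩ : ∃ g : PlaneFun, g =ᵐ[volume] fun z => f z * |f z| ^ (s - 2) :=
    ⟨AEEqFun.mk _ hg₀m.aestronglyMeasurable, AEEqFun.coeFn_mk _ _⟩
  have hgX : ∫⁻ z, ‖g z‖ₑ ^ t = X := by
    rw [hX]
    refine lintegral_congr_ae (hg.mono fun z hz => ?_)
    simp only
    rw [hz, enorm_mul_abs_rpow hs, ← ENNReal.rpow_mul, hst']
  have hgt : MemLp g (ENNReal.ofReal t) volume :=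
    ⟨g.aestronglyMeasurable, by
      rw [eLpNorm_ofReal_eq ht0, hgX]
      exact ENNReal.rpow_lt_top_of_nonneg (by positivity) hXt⟩
  have hgl : DyadicLocallyIntegrable g :=
    MemLp.dyadicLocallyIntegrable (by simpa using ht1.le) hgt
  have hM : ∫⁻ z, maximalFun (averages g) z ^ t ≤ maximalConst t ^ 2 * X := by
    rw [← hgX]; exact lintegral_maximalFun_averages_rpow_le ht1 g
  have hM' : ∫⁻ z, maximalFun (averages g) z ^ t < ⊤ :=
    hM.trans_lt (ENNReal.mul_lt_top (ENNReal.pow_ne_top (maximalConst_ne_top ht1)).lt_top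
      hXt.lt_top)
  have : (ENNReal.ofReal s).HolderTriple (ENNReal.ofReal t) 1 := by
    have := hst.ennrealOfReal
    exact this
  have hint : ∀ R, Integrable (fun z => c R * (g z * R.haar z)) := fun R => by
    refine Integrable.const_mul ?_ _
    have h1 := (memLp_haarFun R (ENNReal.ofReal s)).integrable_mul hgt
    refine h1.congr ((haarFun_coe R).mono fun z hz => ?_)
    rw [Pi.mul_apply, hz, mul_comm]
  have hpair : X ≤ ∑ R ∈ F, ENNReal.ofReal |c R| * ENNReal.ofReal |coeff (averages g) R| := by
    have h1 : ∫ z, f z * g z = ∑ R ∈ F, c R * coeff (averages g) R := by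
      have h2 : ∀ᵐ z, f z * g z = ∑ R ∈ F, c R * (g z * R.haar z) := by
        filter_upwards [haarSum_coe c F] with z hz
        rw [hf, hz, Finset.sum_mul]
        exact Finset.sum_congr rfl fun R _ => by ring
      rw [integral_congr_ae h2, integral_finsetSum F fun R _ => hint R]
      refine Finset.sum_congr rfl fun R _ => ?_
      rw [integral_const_mul, ← haarCoeff_eq hgl, haarCoeff]
    have h3 : ∀ᵐ z, ENNReal.ofReal (f z * g z) = ‖f z‖ₑ ^ s := hg.mono fun z hz => by
      rw [hz, ofReal_mul_mul_abs_rpow hs]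
    have h4 : 0 ≤ᵐ[volume] fun z => f z * g z := hg.mono fun z hz => by
      simp only [Pi.zero_apply]
      rw [hz, ← mul_assoc]
      exact mul_nonneg (mul_self_nonneg _) (Real.rpow_nonneg (abs_nonneg _) _)
    have h5 : Integrable fun z => f z * g z := hfs.integrable_mul hgt
    rw [hX, ← lintegral_congr_ae h3, ← ofReal_integral_eq_lintegral_ofReal h5 h4, h1]
    refine (ENNReal.ofReal_le_ofReal ((le_abs_self _).trans
      (Finset.abs_sum_le_sum_abs _ _))).trans (le_of_eq ?_)
    rw [ENNReal.ofReal_sum_of_nonneg fun R _ => abs_nonneg _]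
    exact Finset.sum_congr rfl fun R _ => by rw [abs_mul, ENNReal.ofReal_mul (abs_nonneg _)]
  -- This has the form `X ≤ C X^{1/t}`. As `f` is a finite Haar sum, `X` is finite and the factor
  -- `X^{1/t}` can be cancelled, leaving `X^{1/s} ≤ C`.
  have hfin : X ≤ dualityConst s * (B ^ (1 / 2 : ℝ) * volume W₀ ^ (1 / s)) * X ^ (1 / t) := by
    refine hpair.trans ((sum_mul_coeff_le hst hW₀ hF hB (isConsistent_averages hgl) hM').trans ?_)
    calc _ ≤ 8192 ^ (1 / 2 : ℝ) * B ^ (1 / 2 : ℝ) * (geomConst 1 * (volume W₀ ^ (1 / s) *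
          (enlargementConst * geomConst t * (maximalConst t ^ 2 * X)) ^ (1 / t))) := by gcongr
      _ = _ := by
          rw [← mul_assoc _ _ X, ENNReal.mul_rpow_of_nonneg _ X (by positivity), dualityConst, ← ht]
          ring
  rw [← hX]
  by_cases hX0 : X = 0
  · rw [hX0, ENNReal.zero_rpow_of_pos (by positivity)]; exact zero_le
  have hX1 : X ^ (1 / t) ≠ 0 := by simp [ENNReal.rpow_eq_zero_iff, hX0, hXt]
  have hX2 : X ^ (1 / t) ≠ ⊤ := ENNReal.rpow_ne_top_of_nonneg (by positivity) hXt
  rw [← ENNReal.mul_le_mul_iff_left hX1 hX2]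
  refine le_trans (le_of_eq ?_) hfin
  rw [← ENNReal.rpow_add_of_nonneg _ _ (by positivity) (by positivity), one_div, one_div,
    hst.inv_add_inv_eq_one, ENNReal.rpow_one]

/-- The `L^s` bound for the pieces of the atomic decomposition. -/
theorem lintegral_piece_rpow_le {s : ℝ} (hs : 1 < s) {a : DyadicRectangle → ℝ}
    (ha : IsConsistent a) {k : ℤ} {F : Finset DyadicRectangle}
    (hF : ∀ R ∈ F, IsThick a k R ∧ ¬ IsThick a (k + 1) R) :
    (∫⁻ z, ‖haarSum (coeff a) F z‖ₑ ^ s) ^ (1 / s) ≤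
      dualityConst s * 8192 ^ (1 / 2 : ℝ) * (2 ^ (k : ℝ) * volume (enlargement a k) ^ (1 / s)) := by
  classical
  refine (lintegral_haarSum_rpow_le hs (measurableSet_enlargement a k)
    (fun R hR => (hF R hR).1.subset_enlargement) (B := 8192 * 2 ^ ((k : ℝ) * 2))
    fun W hW => ?_).trans (le_of_eq ?_)
  · exact sum_coeff_sq_le ha hW fun R hR =>
      ⟨(Finset.mem_filter.1 hR).2, (hF R (Finset.mem_filter.1 hR).1).2⟩
  · rw [ENNReal.mul_rpow_of_nonneg _ _ (by norm_num), ← ENNReal.rpow_mul,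
      show (k : ℝ) * 2 * (1 / 2) = k by ring]
    ring

end BiparameterHardy

/-! ### Atomic decomposition and the estimate for finite Haar sums. -/

namespace BiparameterHardy

open DyadicInterval

theorem coeFn_sum {ι : Type*} (F : Finset ι) (g : ι → PlaneFun) :
    (∑ i ∈ F, g i : PlaneFun) =ᵐ[volume] fun z => ∑ i ∈ F, g i z := by
  classical
  induction F using Finset.induction_on with
  | empty =>
    filter_upwards [AEEqFun.coeFn_zero (α := ℝ × ℝ) (β := ℝ) (μ := volume)] with z hz
    simp [hz]
  | insert i F hi ih =>
    rw [Finset.sum_insert hi]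
    filter_upwards [ih, AEEqFun.coeFn_add (g i) (∑ i ∈ F, g i)] with z h1 h2
    rw [h2, Pi.add_apply, h1, Finset.sum_insert hi]

open Classical in
/-- The rectangles of level `k` with nonzero coefficient. -/
def piece (a : DyadicRectangle → ℝ) (F : Finset DyadicRectangle) (k : ℤ) :
    Finset DyadicRectangle :=
  (F.filter fun R => coeff a R ≠ 0).filter fun R => level a R = k

open Classical in
/-- The levels of the rectangles of a finite set with nonzero coefficient. -/
def levels (a : DyadicRectangle → ℝ) (F : Finset DyadicRectangle) : Finset ℤ :=
  (F.filter fun R => coeff a R ≠ 0).image (level a)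

theorem sum_piece {M : Type*} [AddCommMonoid M] (a : DyadicRectangle → ℝ)
    (F : Finset DyadicRectangle) (g : DyadicRectangle → M) (hg : ∀ R, coeff a R = 0 → g R = 0) :
    ∑ k ∈ levels a F, ∑ R ∈ piece a F k, g R = ∑ R ∈ F, g R := by
  classical
  unfold piece levels
  rw [Finset.sum_fiberwise_of_maps_to (fun R hR => Finset.mem_image_of_mem _ hR),
    Finset.sum_filter_of_ne]
  exact fun R _ h0 h1 => h0 (hg R h1)

theorem haarSum_eq_sum_piece (a : DyadicRectangle → ℝ) (F : Finset DyadicRectangle) :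
    haarSum (coeff a) F = ∑ k ∈ levels a F, haarSum (coeff a) (piece a F k) :=
  (sum_piece a F (fun R => coeff a R • haarFun R) fun R hR => by rw [hR, zero_smul]).symm

theorem level_spec_of_mem_piece {a : DyadicRectangle → ℝ} {p : ℝ} (hp : 0 < p)
    (ha : ∫⁻ z, maximalFun a z ^ p < ⊤) {F : Finset DyadicRectangle} {k : ℤ}
    {R : DyadicRectangle} (hR : R ∈ piece a F k) : IsThick a k R ∧ ¬ IsThick a (k + 1) R := by
  classical
  obtain ⟨h1, rfl⟩ := Finset.mem_filter.1 hR
  exact level_spec hp ha (Finset.mem_filter.1 h1).2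

theorem exists_mem_piece {a : DyadicRectangle → ℝ} {F : Finset DyadicRectangle} {k : ℤ}
    (hk : k ∈ levels a F) : ∃ R, R ∈ piece a F k := by
  classical
  obtain ⟨R, hR, rfl⟩ := Finset.mem_image.1 hk
  exact ⟨R, Finset.mem_filter.2 ⟨hR, rfl⟩⟩

theorem volume_enlargement_lt_top {a : DyadicRectangle → ℝ} {p : ℝ} (hp : 0 < p)
    (ha : ∫⁻ z, maximalFun a z ^ p < ⊤) (k : ℤ) : volume (enlargement a k) < ⊤ := by
  have h1 := (ENNReal.le_tsum (f := fun k : ℤ => (2 : ℝ≥0∞) ^ ((k : ℝ) * p) *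
    volume (enlargement a k)) k).trans (tsum_volume_enlargement_le a hp)
  have h2 := h1.trans_lt (ENNReal.mul_lt_top (ENNReal.mul_lt_top
    enlargementConst_ne_top.lt_top (geomConst_ne_top hp).lt_top) ha)
  exact lt_top_iff_ne_top.2 fun h3 => by
    rw [h3, ENNReal.mul_top (two_rpow_ne_zero _)] at h2; exact lt_irrefl _ h2

/-- The enlargement is a union of half-open rectangles, whereas atoms live on open sets. Outer
regularity supplies one with room of a factor `2`; this needs positive measure, which holds because
a level that occurs has a thick rectangle. -/
theorem exists_open_enlargement {a : DyadicRectangle → ℝ} {p : ℝ} (hp : 0 < p)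
    (ha : ∫⁻ z, maximalFun a z ^ p < ⊤) {F : Finset DyadicRectangle} {k : ℤ}
    (hk : k ∈ levels a F) : ∃ U, IsOpen U ∧ enlargement a k ⊆ U ∧
      volume U ≤ 2 * volume (enlargement a k) := by
  obtain ⟨R, hR⟩ := exists_mem_piece hk
  have h0 : volume (enlargement a k) ≠ 0 := fun h0 => R.volume_toSet_ne_zero
    (measure_mono_null (level_spec_of_mem_piece hp ha hR).1.subset_enlargement h0)
  have h1 : volume (enlargement a k) < 2 * volume (enlargement a k) := by
    rw [two_mul]
    exact ENNReal.lt_add_right (volume_enlargement_lt_top hp ha k).ne h0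
  obtain ⟨U, hU, hUo, hUv⟩ := Set.exists_isOpen_lt_of_lt _ _ h1
  exact ⟨U, hUo, hU, hUv.le⟩

/-- The constant in `lintegral_sum_levels_rpow_le`. -/
def synthesisConst (p q : ℝ) (A : ℝ≥0∞) : ℝ≥0∞ :=
  geomConst ((q - p) / q) ^ p * A ^ (p / q) * (2 * (enlargementConst * geomConst p))

theorem synthesisConst_ne_top {p q : ℝ} (hp : 0 < p) (hpq : p < q) {A : ℝ≥0∞} (hA : A ≠ ⊤) :
    synthesisConst p q A ≠ ⊤ := by
  have hq : 0 < q := hp.trans hpq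
  refine ENNReal.mul_ne_top (ENNReal.mul_ne_top ?_ ?_) (ENNReal.mul_ne_top (by norm_num)
    (ENNReal.mul_ne_top enlargementConst_ne_top (geomConst_ne_top hp)))
  · exact ENNReal.rpow_ne_top_of_nonneg hp.le (geomConst_ne_top (div_pos (by linarith) hq))
  · exact ENNReal.rpow_ne_top_of_nonneg (by positivity) hA

/-- Both factors in `lintegral_sum_rpow_le` become powers of the same sum `Y = ∑ 2^{kp} |U_k|`, with
exponents adding up to `1`, and `Y` is bounded by the maximal function of `a`. -/
theorem lintegral_sum_levels_rpow_le {p q : ℝ} (hp : 0 < p) (hpq : p < q)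
    (a : DyadicRectangle → ℝ) (S : Finset ℤ) {G : ℤ → ℝ × ℝ → ℝ≥0∞} {U : ℤ → Set (ℝ × ℝ)}
    {A : ℝ≥0∞} (hG : ∀ k ∈ S, Measurable (G k)) (hU : ∀ k ∈ S, MeasurableSet (U k))
    (hGU : ∀ k ∈ S, ∀ z ∉ U k, G k z = 0)
    (hm : ∀ k ∈ S, ∫⁻ z, G k z ^ q ≤ 2 ^ ((k : ℝ) * q) * (A * volume (U k)))
    (hUv : ∀ k ∈ S, volume (U k) ≤ 2 * volume (enlargement a k)) :
    ∫⁻ z, (∑ k ∈ S, G k z) ^ p ≤ synthesisConst p q A * ∫⁻ z, maximalFun a z ^ p := by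
  have hq : 0 < q := hp.trans hpq
  have hpq1 : p / q < 1 := (div_lt_one hq).2 hpq
  set Y := ∑ k ∈ S, (2 : ℝ≥0∞) ^ ((k : ℝ) * p) * volume (U k) with hY
  have hY1 : Y ≤ 2 * (enlargementConst * geomConst p * ∫⁻ z, maximalFun a z ^ p) := by
    calc Y ≤ ∑ k ∈ S, 2 * ((2 : ℝ≥0∞) ^ ((k : ℝ) * p) * volume (enlargement a k)) := by
          refine Finset.sum_le_sum fun k hk => ?_
          rw [mul_left_comm]
          exact mul_le_mul_right (hUv k hk) _
      _ ≤ _ := by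
          rw [← Finset.mul_sum]
          exact mul_le_mul_right ((ENNReal.sum_le_tsum S).trans
            (tsum_volume_enlargement_le a hp)) _
  have hA : ∑ k ∈ S, (2 : ℝ≥0∞) ^ ((k : ℝ) * p) * (A * volume (U k)) = A * Y := by
    rw [hY, Finset.mul_sum]
    exact Finset.sum_congr rfl fun k _ => by ring
  refine (lintegral_sum_rpow_le hp hpq S hG hU hGU hm).trans ?_
  rw [hA, ENNReal.mul_rpow_of_nonneg _ _ (by positivity), mul_assoc, ← hY,
    ← ENNReal.rpow_add_of_nonneg _ _ (by positivity) (by linarith), add_sub_cancel, ENNReal.rpow_one,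
    synthesisConst]
  calc _ ≤ geomConst ((q - p) / q) ^ p * (A ^ (p / q) *
        (2 * (enlargementConst * geomConst p * ∫⁻ z, maximalFun a z ^ p))) := by gcongr
    _ = _ := by ring

section

variable {s q : ℝ} {V : Submodule ℝ PlaneFun} {T : V →ₗ[ℝ] PlaneFun}
  {Φ : Set (ℝ × ℝ) → PlaneFun → Prop}

/-- The hypothesis on atoms, applied to multiples of atoms. -/
theorem bound_of_isHaarSupported (hs : 1 < s) (hΦ : ∀ Ω (c : ℝ) g, Φ Ω g → Φ Ω (c • g))
    (hT : ∀ Ω : Set (ℝ × ℝ), IsOpen Ω → volume Ω < ⊤ → ∀ f : V, IsAtom s Ω f →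
      Φ Ω (T f) ∧ eLpNorm (T f) (ENNReal.ofReal q) volume ≤ volume Ω ^ (1 / q))
    {Ω : Set (ℝ × ℝ)} (hΩ : IsOpen Ω) (hΩ' : volume Ω < ⊤) {f : V}
    (hf : IsHaarSupported s Ω f) {κ : ℝ≥0∞} (hκ : κ ≠ 0) (hκ' : κ ≠ ⊤)
    (hfκ : eLpNorm (f : PlaneFun) (ENNReal.ofReal s) volume ≤ κ * volume Ω ^ (1 / s)) :
    Φ Ω (T f) ∧ eLpNorm (T f) (ENNReal.ofReal q) volume ≤ κ * volume Ω ^ (1 / q) := by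
  set c : ℝ := κ.toReal with hc
  have hc0 : 0 < c := ENNReal.toReal_pos hκ hκ'
  have hce : ‖c‖ₑ = κ := by
    rw [Real.enorm_eq_ofReal_abs, abs_of_pos hc0, hc, ENNReal.ofReal_toReal hκ']
  have hcie : ‖c⁻¹‖ₑ = κ⁻¹ := by
    rw [Real.enorm_eq_ofReal_abs, abs_of_pos (inv_pos.2 hc0), ENNReal.ofReal_inv_of_pos hc0, hc,
      ENNReal.ofReal_toReal hκ']
  have hatom : IsAtom s Ω ((c⁻¹ • f : V) : PlaneFun) := by
    refine ⟨hf.smul hs c⁻¹, ?_⟩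
    rw [Submodule.coe_smul, eLpNorm_congr_ae (AEEqFun.coeFn_smul c⁻¹ (f : PlaneFun)),
      eLpNorm_const_smul, hcie]
    calc κ⁻¹ * eLpNorm (f : PlaneFun) (ENNReal.ofReal s) volume
        ≤ κ⁻¹ * (κ * volume Ω ^ (1 / s)) := by gcongr
      _ = _ := by rw [← mul_assoc, ENNReal.inv_mul_cancel hκ hκ', one_mul]
  have heq : T f = c • T (c⁻¹ • f) := by
    rw [map_smul, smul_smul, mul_inv_cancel₀ hc0.ne', one_smul]
  obtain ⟨h1, h2⟩ := hT Ω hΩ hΩ' _ hatom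
  refine ⟨heq ▸ hΦ Ω c _ h1, ?_⟩
  rw [heq, eLpNorm_congr_ae (AEEqFun.coeFn_smul c _), eLpNorm_const_smul, hce]
  gcongr

/-- The atomic decomposition of a finite Haar sum and the bounds for its image. -/
theorem exists_atomic_decomposition (hs : 1 < s) (hq : 1 < q) (hV : haarSpan ≤ V)
    (hΦ : ∀ Ω (c : ℝ) g, Φ Ω g → Φ Ω (c • g))
    (hT : ∀ Ω : Set (ℝ × ℝ), IsOpen Ω → volume Ω < ⊤ → ∀ f : V, IsAtom s Ω f →
      Φ Ω (T f) ∧ eLpNorm (T f) (ENNReal.ofReal q) volume ≤ volume Ω ^ (1 / q))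
    {p : ℝ} (hp : 0 < p) {a : DyadicRectangle → ℝ} (ha : IsConsistent a)
    (ha' : ∫⁻ z, maximalFun a z ^ p < ⊤) (F : Finset DyadicRectangle) :
    ∃ (g : ℤ → PlaneFun) (U : ℤ → Set (ℝ × ℝ)),
      T ⟨haarSum (coeff a) F, hV (haarSum_mem_haarSpan _ _)⟩ = ∑ k ∈ levels a F, g k ∧
      ∀ k ∈ levels a F, IsOpen (U k) ∧ volume (U k) ≤ 2 * volume (enlargement a k) ∧
        Φ (U k) (g k) ∧ MemLp (g k) (ENNReal.ofReal q) volume ∧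
        ∫⁻ z, ‖g k z‖ₑ ^ q ≤ 2 ^ ((k : ℝ) * q) *
          ((dualityConst s * 8192 ^ (1 / 2 : ℝ) + 1) ^ q * volume (U k)) := by
  classical
  have hs0 : 0 < s := by linarith
  have hq0 : 0 < q := by linarith
  have hU : ∀ k, ∃ U, k ∈ levels a F → IsOpen U ∧ enlargement a k ⊆ U ∧
      volume U ≤ 2 * volume (enlargement a k) := fun k => by
    by_cases hk : k ∈ levels a F
    · obtain ⟨U, hU⟩ := exists_open_enlargement hp ha' hk
      exact ⟨U, fun _ => hU⟩
    · exact ⟨∅, fun h => absurd h hk⟩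
  choose U hU using hU
  let f : ℤ → V := fun k => ⟨haarSum (coeff a) (piece a F k), hV (haarSum_mem_haarSpan _ _)⟩
  refine ⟨fun k => T (f k), U, ?_, fun k hk => ?_⟩
  · rw [← map_sum]
    congr 1
    refine Subtype.ext ?_
    rw [Submodule.coe_sum]
    exact haarSum_eq_sum_piece a F
  obtain ⟨hUo, hUe, hUv⟩ := hU k hk
  have hUt : volume (U k) < ⊤ := hUv.trans_lt
    (ENNReal.mul_lt_top (by norm_num) (volume_enlargement_lt_top hp ha' k))
  have hsup : IsHaarSupported s (U k) (f k : PlaneFun) := isHaarSupported_haarSum s fun R hR _ =>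
    (level_spec_of_mem_piece hp ha' hR).1.subset_enlargement.trans hUe
  have hK : dualityConst s * 8192 ^ (1 / 2 : ℝ) ≠ ⊤ := ENNReal.mul_ne_top (dualityConst_ne_top hs)
    (ENNReal.rpow_ne_top_of_nonneg (by norm_num) (by norm_num))
  set K := dualityConst s * 8192 ^ (1 / 2 : ℝ) with hKdef
  -- The summand `1` guarantees a non-zero factor, by which the piece can be divided to give an
  -- atom.
  have hκ0 : (K + 1) * 2 ^ (k : ℝ) ≠ 0 := mul_ne_zero (by simp) (two_rpow_ne_zero _)
  have hκt : (K + 1) * 2 ^ (k : ℝ) ≠ ⊤ :=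
    ENNReal.mul_ne_top (ENNReal.add_ne_top.2 ⟨hK, by norm_num⟩) (two_rpow_ne_top _)
  have hfκ : eLpNorm (f k : PlaneFun) (ENNReal.ofReal s) volume ≤
      (K + 1) * 2 ^ (k : ℝ) * volume (U k) ^ (1 / s) := by
    rw [eLpNorm_ofReal_eq hs0]
    calc _ ≤ K * (2 ^ (k : ℝ) * volume (enlargement a k) ^ (1 / s)) :=
          lintegral_piece_rpow_le hs ha fun R hR => level_spec_of_mem_piece hp ha' hR
      _ ≤ (K + 1) * (2 ^ (k : ℝ) * volume (U k) ^ (1 / s)) :=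
          mul_le_mul' le_self_add (mul_le_mul_right
            (ENNReal.rpow_le_rpow (measure_mono hUe) (by positivity)) _)
      _ = _ := (mul_assoc _ _ _).symm
  obtain ⟨h1, h2⟩ := bound_of_isHaarSupported hs hΦ hT hUo hUt hsup hκ0 hκt hfκ
  refine ⟨hUo, hUv, h1, ⟨(T (f k)).aestronglyMeasurable, h2.trans_lt (ENNReal.mul_lt_top
    hκt.lt_top (ENNReal.rpow_lt_top_of_nonneg (by positivity) hUt.ne))⟩, ?_⟩
  rw [eLpNorm_ofReal_eq hq0] at h2
  have h3 := ENNReal.rpow_le_rpow h2 hq0.le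
  rw [← ENNReal.rpow_mul, one_div_mul_cancel hq0.ne', ENNReal.rpow_one] at h3
  refine h3.trans (le_of_eq ?_)
  rw [ENNReal.mul_rpow_of_nonneg _ _ hq0.le, ENNReal.mul_rpow_of_nonneg _ _ hq0.le,
    ← ENNReal.rpow_mul, ← ENNReal.rpow_mul, one_div_mul_cancel hq0.ne', ENNReal.rpow_one]
  ring

/-- The constant in `lintegral_maximalFun_le_of_isAtom`. -/
def atomConst (p s q : ℝ) : ℝ≥0∞ := synthesisConst p q
  (maximalConst q ^ 2 * (dualityConst s * 8192 ^ (1 / 2 : ℝ) + 1) ^ q)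

theorem pieceConst_ne_top (hs : 1 < s) (hq : 1 < q) :
    (dualityConst s * 8192 ^ (1 / 2 : ℝ) + 1) ^ q ≠ ⊤ :=
  ENNReal.rpow_ne_top_of_nonneg (by linarith) (ENNReal.add_ne_top.2
    ⟨ENNReal.mul_ne_top (dualityConst_ne_top hs)
      (ENNReal.rpow_ne_top_of_nonneg (by norm_num) (by norm_num)), by norm_num⟩)

theorem atomConst_ne_top {p : ℝ} (hp : 0 < p) (hs : 1 < s) (hq : 1 < q) (hpq : p < q) :
    atomConst p s q ≠ ⊤ :=
  synthesisConst_ne_top hp hpq (ENNReal.mul_ne_top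
    (ENNReal.pow_ne_top (maximalConst_ne_top hq)) (pieceConst_ne_top hs hq))

theorem lintegral_maximalFun_le_of_isAtom {p : ℝ} (hp : 0 < p) (hs : 1 < s) (hq : 1 < q)
    (hpq : p < q) (hV : haarSpan ≤ V)
    (hT : ∀ Ω : Set (ℝ × ℝ), IsOpen Ω → volume Ω < ⊤ → ∀ f : V, IsAtom s Ω f → IsAtom q Ω (T f))
    {a : DyadicRectangle → ℝ} (ha : IsConsistent a) (ha' : ∫⁻ z, maximalFun a z ^ p < ⊤)
    (F : Finset DyadicRectangle) :
    ∫⁻ z, maximalFun (averages (T ⟨haarSum (coeff a) F, hV (haarSum_mem_haarSpan _ _)⟩)) z ^ p ≤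
      atomConst p s q * ∫⁻ z, maximalFun a z ^ p := by
  -- `Φ` is the localisation of the images that the hypothesis on `T` provides. Here it is support
  -- of the Haar expansion, so that the maximal functions of the `g k` vanish off `U k`.
  obtain ⟨g, U, hg, hgU⟩ := exists_atomic_decomposition (Φ := IsHaarSupported q) hs hq hV
    (fun Ω c g h => h.smul hq c) (fun Ω hΩ hΩ' f hf => hT Ω hΩ hΩ' f hf) hp ha ha' F
  have hsum : ∀ (S : Finset ℤ) z, maximalFun (∑ k ∈ S, averages (g k)) z ≤
      ∑ k ∈ S, maximalFun (averages (g k)) z := by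
    intro S z
    induction S using Finset.induction_on with
    | empty => simp [maximalFun]
    | insert k S hk ih =>
      rw [Finset.sum_insert hk, Finset.sum_insert hk]
      exact (maximalFun_add_le _ _ z).trans (by gcongr)
  rw [hg, averages_sum _ fun k hk =>
    MemLp.dyadicLocallyIntegrable (by simpa using hq.le) (hgU k hk).2.2.2.1]
  refine (lintegral_mono fun z => ENNReal.rpow_le_rpow (hsum _ z) hp.le).trans ?_
  refine lintegral_sum_levels_rpow_le hp hpq a _ (U := U)
    (fun k _ => measurable_maximalFun _) (fun k hk => (hgU k hk).1.measurableSet)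
    (fun k hk z hz => (hgU k hk).2.2.1.maximalFun_eq_zero hq hz) (fun k hk => ?_)
    (fun k hk => (hgU k hk).2.1)
  refine (lintegral_maximalFun_averages_rpow_le hq (g k)).trans ?_
  refine (mul_le_mul_right (hgU k hk).2.2.2.2 _).trans (le_of_eq ?_)
  ring

/-- The constant in `lintegral_maximalFun_le_of_support`. -/
def supportConst (p s q : ℝ) : ℝ≥0∞ := maximalConst p ^ 2 *
  synthesisConst p q ((dualityConst s * 8192 ^ (1 / 2 : ℝ) + 1) ^ q)

theorem supportConst_ne_top {p : ℝ} (hp : 1 < p) (hs : 1 < s) (hq : 1 < q) (hpq : p < q) :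
    supportConst p s q ≠ ⊤ :=
  ENNReal.mul_ne_top (ENNReal.pow_ne_top (maximalConst_ne_top hp))
    (synthesisConst_ne_top (by linarith) hpq (pieceConst_ne_top hs hq))

/-- Only the images themselves, not their maximal functions, are known to vanish off the sets. The
maximal function is therefore removed first, by its boundedness on `L^p`, and this is where `1 < p`
enters. -/
theorem lintegral_maximalFun_le_of_support {p : ℝ} (hp : 1 < p) (hs : 1 < s) (hq : 1 < q)
    (hpq : p < q) (hV : haarSpan ≤ V)
    (hT : ∀ Ω : Set (ℝ × ℝ), IsOpen Ω → volume Ω < ⊤ → ∀ f : V, IsAtom s Ω f →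
      (∀ᵐ z : ℝ × ℝ, z ∉ Ω → T f z = 0) ∧
        eLpNorm (T f) (ENNReal.ofReal q) volume ≤ volume Ω ^ (1 / q))
    {a : DyadicRectangle → ℝ} (ha : IsConsistent a) (ha' : ∫⁻ z, maximalFun a z ^ p < ⊤)
    (F : Finset DyadicRectangle) :
    ∫⁻ z, maximalFun (averages (T ⟨haarSum (coeff a) F, hV (haarSum_mem_haarSpan _ _)⟩)) z ^ p ≤
      supportConst p s q * ∫⁻ z, maximalFun a z ^ p := by
  have hp0 : 0 < p := by linarith
  obtain ⟨g, U, hg, hgU⟩ := exists_atomic_decomposition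
    (Φ := fun Ω g => ∀ᵐ z : ℝ × ℝ, z ∉ Ω → g z = 0) hs hq hV
    (fun Ω c g h => by
      filter_upwards [h, AEEqFun.coeFn_smul c g] with z h1 h2 hz
      rw [h2, Pi.smul_apply, h1 hz, smul_zero]) hT hp0 ha ha' F
  refine (lintegral_maximalFun_averages_rpow_le hp _).trans ?_
  rw [supportConst, mul_assoc]
  refine mul_le_mul_right ?_ _
  have hall : ∀ᵐ z : ℝ × ℝ, ∀ k ∈ levels a F, z ∉ U k → g k z = 0 :=
    (ae_ball_iff (levels a F).countable_toSet).2 fun k hk => (hgU k hk).2.2.1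
  calc _ ≤ ∫⁻ z, (∑ k ∈ levels a F, (U k).indicator (fun z => ‖g k z‖ₑ) z) ^ p := by
        refine lintegral_mono_ae ?_
        filter_upwards [coeFn_sum (levels a F) g, hall] with z h1 h2
        refine ENNReal.rpow_le_rpow ?_ hp0.le
        rw [hg, h1]
        refine (enorm_sum_le _ _).trans (Finset.sum_le_sum fun k hk => ?_)
        by_cases hz : z ∈ U k
        · rw [Set.indicator_of_mem hz]
        · rw [h2 k hk hz, enorm_zero]; exact zero_le
    _ ≤ _ := by
        refine lintegral_sum_levels_rpow_le hp0 hpq a _ (U := U)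
          (fun k hk => (g k).measurable.enorm.indicator (hgU k hk).1.measurableSet)
          (fun k hk => (hgU k hk).1.measurableSet)
          (fun k hk z hz => Set.indicator_of_notMem hz _) (fun k hk => ?_)
          (fun k hk => (hgU k hk).2.1)
        refine (lintegral_mono fun z => ?_).trans (hgU k hk).2.2.2.2
        exact ENNReal.rpow_le_rpow (Set.indicator_le_self _ _ z) (by linarith)

end

end BiparameterHardy

/-! ### Density of finite Haar sums in `H^p_d`. -/

namespace BiparameterHardy

open DyadicInterval

theorem lintegral_haarSum_sq (c : DyadicRectangle → ℝ) (F : Finset DyadicRectangle) :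
    ∫⁻ z, ‖haarSum c F z‖ₑ ^ (2 : ℝ) = ∑ R ∈ F, ENNReal.ofReal (c R ^ 2) := by
  classical
  obtain ⟨f, hf⟩ : ∃ f, f = haarSum c F := ⟨_, rfl⟩
  have hfs : MemLp f 2 volume := hf ▸ memLp_haarSum c F _
  have hfl : DyadicLocallyIntegrable f := hf ▸ dyadicLocallyIntegrable_haarSum c F
  have h1 : ∫ z, f z * f z = ∑ R ∈ F, c R ^ 2 := by
    have h2 : ∀ᵐ z, f z * f z = ∑ R ∈ F, c R * (f z * R.haar z) := by
      filter_upwards [haarSum_coe c F] with z hz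
      nth_rewrite 1 [hf]
      rw [hz, Finset.sum_mul]
      exact Finset.sum_congr rfl fun R _ => by ring
    have hint : ∀ R, Integrable (fun z => c R * (f z * R.haar z)) := fun R => by
      refine Integrable.const_mul ?_ _
      have h1 := (memLp_haarFun R 2).integrable_mul hfs
      refine h1.congr ((haarFun_coe R).mono fun z hz => ?_)
      rw [Pi.mul_apply, hz, mul_comm]
    rw [integral_congr_ae h2, integral_finsetSum F fun R _ => hint R]
    refine Finset.sum_congr rfl fun R hR => ?_
    have h3 : ∫ z, f z * R.haar z = c R := by
      change haarCoeff f R = c R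
      rw [haarCoeff_eq hfl, hf, coeff_averages_haarSum, if_pos hR]
    rw [integral_const_mul, h3, sq]
  have h5 : Integrable fun z => f z * f z := hfs.integrable_mul hfs
  rw [← hf, ← ENNReal.ofReal_sum_of_nonneg fun R _ => sq_nonneg _, ← h1,
    ofReal_integral_eq_lintegral_ofReal h5 (Eventually.of_forall fun z => mul_self_nonneg (f z))]
  refine lintegral_congr fun z => ?_
  rw [Real.enorm_eq_ofReal_abs, ofReal_abs_rpow_two, sq]

/-- The contribution of a rectangle to the size of a family in `H^p`. -/
def weight (p : ℝ) (a : DyadicRectangle → ℝ) (R : DyadicRectangle) : ℝ≥0∞ :=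
  2 ^ ((level a R : ℝ) * (p - 2)) * ENNReal.ofReal (coeff a R ^ 2)

theorem sum_levels_eq_sum_weight (p : ℝ) (a : DyadicRectangle → ℝ) (F : Finset DyadicRectangle) :
    ∑ k ∈ levels a F, (2 : ℝ≥0∞) ^ ((k : ℝ) * (p - 2)) *
      ∑ R ∈ piece a F k, ENNReal.ofReal (coeff a R ^ 2) = ∑ R ∈ F, weight p a R := by
  classical
  rw [← sum_piece a F (weight p a) fun R hR => by simp [weight, hR]]
  refine Finset.sum_congr rfl fun k _ => ?_
  rw [Finset.mul_sum]
  refine Finset.sum_congr rfl fun R hR => ?_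
  rw [weight, (Finset.mem_filter.1 hR).2]

section

variable {p : ℝ} {a : DyadicRectangle → ℝ}

/-- The factor `2^{k(p-2)}` turns the Carleson bound `2^{2k} |U_k|` into the summable `2^{kp}
|U_k|`. Small tails of the resulting series are the source of convergence of the truncations. -/
theorem sum_weight_le (hp : 0 < p) (ha : IsConsistent a) (ha' : ∫⁻ z, maximalFun a z ^ p < ⊤)
    (F : Finset DyadicRectangle) :
    ∑ R ∈ F, weight p a R ≤
      8192 * (enlargementConst * geomConst p * ∫⁻ z, maximalFun a z ^ p) := by
  rw [← sum_levels_eq_sum_weight]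
  calc _ ≤ ∑ k ∈ levels a F, 8192 * ((2 : ℝ≥0∞) ^ ((k : ℝ) * p) * volume (enlargement a k)) := by
        refine Finset.sum_le_sum fun k _ => ?_
        have h1 := sum_coeff_sq_le ha (k := k) (F := piece a F k)
          (measurableSet_enlargement a k) fun R hR =>
          ⟨(level_spec_of_mem_piece hp ha' hR).1.subset_enlargement,
            (level_spec_of_mem_piece hp ha' hR).2⟩
        refine (mul_le_mul_right h1 _).trans (le_of_eq ?_)
        rw [show (k : ℝ) * p = k * (p - 2) + k * 2 by ring, two_rpow_add]
        ring
    _ ≤ _ := by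
        rw [← Finset.mul_sum]
        exact mul_le_mul_right ((ENNReal.sum_le_tsum _).trans
          (tsum_volume_enlargement_le a hp)) _

theorem tsum_weight_ne_top (hp : 0 < p) (ha : IsConsistent a)
    (ha' : ∫⁻ z, maximalFun a z ^ p < ⊤) : ∑' R, weight p a R ≠ ⊤ := by
  rw [ENNReal.tsum_eq_iSup_sum]
  refine ne_top_of_le_ne_top ?_ (iSup_le fun F => sum_weight_le hp ha ha' F)
  exact ENNReal.mul_ne_top (by norm_num) (ENNReal.mul_ne_top (ENNReal.mul_ne_top
    enlargementConst_ne_top (geomConst_ne_top hp)) ha'.ne)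

/-- Cauchy–Schwarz for `|f|^q = (|f|²)^{1/2} (|f|^{2q-2})^{1/2}`. The `L²` factor retains the
coefficients actually present in `F`, hence any smallness; the other factor is bounded by the full
size of a piece of level `k`. -/
theorem lintegral_piece_maximalFun_le {q : ℝ} (hq : 2 ≤ q) (hp : 0 < p) (ha : IsConsistent a)
    (ha' : ∫⁻ z, maximalFun a z ^ p < ⊤) (F : Finset DyadicRectangle) (k : ℤ) :
    ∫⁻ z, maximalFun (averages (haarSum (coeff a) (piece a F k))) z ^ q ≤
      2 ^ ((k : ℝ) * q) * (maximalConst q ^ 2 *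
        ((dualityConst (2 * q - 2) * 8192 ^ (1 / 2 : ℝ)) ^ (2 * q - 2)) ^ (1 / 2 : ℝ) *
        (2 ^ (-(k : ℝ)) * ((∑ R ∈ piece a F k, ENNReal.ofReal (coeff a R ^ 2)) ^ (1 / 2 : ℝ) *
          volume (enlargement a k) ^ (1 / 2 : ℝ)))) := by
  have hr0 : 0 < 2 * q - 2 := by linarith
  set f := haarSum (coeff a) (piece a F k) with hf
  have h1 : ∫⁻ z, ‖f z‖ₑ ^ q ≤ (∫⁻ z, ‖f z‖ₑ ^ (2 : ℝ)) ^ (1 / 2 : ℝ) *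
      (∫⁻ z, ‖f z‖ₑ ^ (2 * q - 2)) ^ (1 / 2 : ℝ) := by
    refine le_trans (le_of_eq (lintegral_congr fun z => ?_)) (ENNReal.lintegral_mul_norm_pow_le
      (f.measurable.enorm.pow_const 2).aemeasurable
      (f.measurable.enorm.pow_const (2 * q - 2)).aemeasurable (by norm_num) (by norm_num)
      (by norm_num))
    rw [← ENNReal.rpow_mul, ← ENNReal.rpow_mul,
      ← ENNReal.rpow_add_of_nonneg _ _ (by norm_num) (by linarith)]
    congr 1; ring
  have h2 := lintegral_piece_rpow_le (s := 2 * q - 2) (by linarith) ha (k := k) (F := piece a F k)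
    fun R hR => level_spec_of_mem_piece hp ha' hR
  obtain ⟨K, hK⟩ : ∃ K, K = dualityConst (2 * q - 2) * 8192 ^ (1 / 2 : ℝ) := ⟨_, rfl⟩
  rw [← hf, ← hK] at h2
  rw [← hK]
  have h3 := ENNReal.rpow_le_rpow h2 hr0.le
  rw [← ENNReal.rpow_mul, one_div_mul_cancel hr0.ne', ENNReal.rpow_one,
    ENNReal.mul_rpow_of_nonneg _ _ hr0.le, ENNReal.mul_rpow_of_nonneg _ _ hr0.le,
    ← ENNReal.rpow_mul, ← ENNReal.rpow_mul, one_div_mul_cancel hr0.ne', ENNReal.rpow_one] at h3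
  rw [hf, lintegral_haarSum_sq, ← hf] at h1
  refine (lintegral_maximalFun_averages_rpow_le (by linarith) f).trans ?_
  refine (mul_le_mul_right (h1.trans (mul_le_mul_right
    (ENNReal.rpow_le_rpow h3 (by norm_num)) _)) _).trans (le_of_eq ?_)
  rw [ENNReal.mul_rpow_of_nonneg _ _ (by norm_num), ENNReal.mul_rpow_of_nonneg _ _ (by norm_num),
    ← ENNReal.rpow_mul 2, show (k : ℝ) * (2 * q - 2) * (1 / 2) = k * q + -k by ring, two_rpow_add]
  ring

/-- Haar sums are small in `H^p` when the sum of the weights of their rectangles is small. -/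
theorem exists_lintegral_haarSum_le (hp : 0 < p) (ha : IsConsistent a)
    (ha' : ∫⁻ z, maximalFun a z ^ p < ⊤) :
    ∃ D : ℝ≥0∞, D ≠ ⊤ ∧ ∃ e : ℝ, 0 < e ∧ ∀ F : Finset DyadicRectangle,
      ∫⁻ z, maximalFun (averages (haarSum (coeff a) F)) z ^ p ≤
        D * (∑ R ∈ F, weight p a R) ^ e := by
  obtain ⟨q, hq2, hpq⟩ : ∃ q : ℝ, 2 ≤ q ∧ p < q := ⟨max p 1 + 1, by
    linarith [le_max_right p 1], by linarith [le_max_left p 1]⟩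
  have hq : 0 < q := by linarith
  have hpq1 : p / q < 1 := (div_lt_one hq).2 hpq
  obtain ⟨Y, hY⟩ : ∃ Y, Y = enlargementConst * geomConst p * ∫⁻ z, maximalFun a z ^ p := ⟨_, rfl⟩
  have hYt : Y ≠ ⊤ := hY ▸ ENNReal.mul_ne_top (ENNReal.mul_ne_top
    enlargementConst_ne_top (geomConst_ne_top hp)) ha'.ne
  obtain ⟨K, hK⟩ : ∃ K, K = maximalConst q ^ 2 *
    ((dualityConst (2 * q - 2) * 8192 ^ (1 / 2 : ℝ)) ^ (2 * q - 2)) ^ (1 / 2 : ℝ) := ⟨_, rfl⟩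
  have hKt : K ≠ ⊤ := hK ▸ ENNReal.mul_ne_top (ENNReal.pow_ne_top (maximalConst_ne_top (by linarith)))
    (ENNReal.rpow_ne_top_of_nonneg (by norm_num) (ENNReal.rpow_ne_top_of_nonneg (by linarith)
      (ENNReal.mul_ne_top (dualityConst_ne_top (by linarith))
        (ENNReal.rpow_ne_top_of_nonneg (by norm_num) (by norm_num)))))
  refine ⟨geomConst ((q - p) / q) ^ p * ((K * Y ^ (1 / 2 : ℝ)) ^ (p / q) * Y ^ (1 - p / q)),
    ?_, 1 / 2 * (p / q), by positivity, fun F => ?_⟩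
  · refine ENNReal.mul_ne_top (ENNReal.rpow_ne_top_of_nonneg hp.le
      (geomConst_ne_top (div_pos (by linarith) hq))) (ENNReal.mul_ne_top ?_ ?_)
    · exact ENNReal.rpow_ne_top_of_nonneg (by positivity) (ENNReal.mul_ne_top hKt
        (ENNReal.rpow_ne_top_of_nonneg (by norm_num) hYt))
    · exact ENNReal.rpow_ne_top_of_nonneg (by linarith) hYt
  set S := levels a F with hS
  set σ : ℤ → ℝ≥0∞ := fun k => ∑ R ∈ piece a F k, ENNReal.ofReal (coeff a R ^ 2) with hσ
  have hYS : ∑ k ∈ S, (2 : ℝ≥0∞) ^ ((k : ℝ) * p) * volume (enlargement a k) ≤ Y :=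
    hY ▸ (ENNReal.sum_le_tsum S).trans (tsum_volume_enlargement_le a hp)
  have hsum : ∀ (S : Finset ℤ) z,
      maximalFun (∑ k ∈ S, averages (haarSum (coeff a) (piece a F k))) z ≤
      ∑ k ∈ S, maximalFun (averages (haarSum (coeff a) (piece a F k))) z := by
    intro S z
    induction S using Finset.induction_on with
    | empty => simp [maximalFun]
    | insert k S hk ih =>
      rw [Finset.sum_insert hk, Finset.sum_insert hk]
      exact (maximalFun_add_le _ _ z).trans (by gcongr)
  -- Cauchy–Schwarz in `k`: the power `2^{k(p-1)}` is shared between `2^{k(p-2)} σ k`, which sums to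
  -- the total weight, and `2^{kp} |U_k|`, which sums to at most `Y`.
  have hm : ∑ k ∈ S, 2 ^ ((k : ℝ) * p) * (K * (2 ^ (-(k : ℝ)) *
      (σ k ^ (1 / 2 : ℝ) * volume (enlargement a k) ^ (1 / 2 : ℝ)))) ≤
      K * ((∑ R ∈ F, weight p a R) ^ (1 / 2 : ℝ) * Y ^ (1 / 2 : ℝ)) := by
    calc _ = K * ∑ k ∈ S, (2 ^ ((k : ℝ) * (p - 2)) * σ k) ^ (1 / 2 : ℝ) *
          (2 ^ ((k : ℝ) * p) * volume (enlargement a k)) ^ (1 / 2 : ℝ) := by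
          rw [Finset.mul_sum]
          refine Finset.sum_congr rfl fun k _ => ?_
          rw [ENNReal.mul_rpow_of_nonneg _ _ (by norm_num), ENNReal.mul_rpow_of_nonneg _ _
            (by norm_num), ← ENNReal.rpow_mul 2, ← ENNReal.rpow_mul 2]
          have h1 : (2 : ℝ≥0∞) ^ ((k : ℝ) * p) * 2 ^ (-(k : ℝ)) =
              2 ^ ((k : ℝ) * (p - 2) * (1 / 2)) * 2 ^ ((k : ℝ) * p * (1 / 2)) := by
            rw [← two_rpow_add, ← two_rpow_add]; congr 1; ring
          calc _ = K * ((2 : ℝ≥0∞) ^ ((k : ℝ) * p) * 2 ^ (-(k : ℝ))) *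
                (σ k ^ (1 / 2 : ℝ) * volume (enlargement a k) ^ (1 / 2 : ℝ)) := by ring
            _ = _ := by rw [h1]; ring
      _ ≤ K * ((∑ k ∈ S, (2 ^ ((k : ℝ) * (p - 2)) * σ k)) ^ (1 / 2 : ℝ) *
          (∑ k ∈ S, (2 ^ ((k : ℝ) * p) * volume (enlargement a k))) ^ (1 / 2 : ℝ)) := by
          gcongr
          refine (ENNReal.inner_le_Lp_mul_Lq _ _ _ Real.HolderConjugate.two_two).trans
            (le_of_eq ?_)
          simp_rw [← ENNReal.rpow_mul]
          norm_num
      _ ≤ _ := by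
          rw [hσ, sum_levels_eq_sum_weight]
          gcongr
  rw [haarSum_eq_sum_piece, averages_sum _ fun k _ => dyadicLocallyIntegrable_haarSum _ _]
  refine (lintegral_mono fun z => ENNReal.rpow_le_rpow (hsum _ z) hp.le).trans ?_
  refine (lintegral_sum_rpow_le hp hpq S (U := enlargement a)
    (m := fun k => K * (2 ^ (-(k : ℝ)) *
      (σ k ^ (1 / 2 : ℝ) * volume (enlargement a k) ^ (1 / 2 : ℝ))))
    (fun k _ => measurable_maximalFun _) (fun k _ => measurableSet_enlargement a k)
    (fun k _ z hz => ?_) (fun k _ => ?_)).trans ?_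
  · refine IsHaarSupported.maximalFun_eq_zero (s := 2) (by norm_num)
      (isHaarSupported_haarSum 2 fun R hR _ => ?_) hz
    exact (level_spec_of_mem_piece hp ha' hR).1.subset_enlargement
  · rw [hK]
    exact lintegral_piece_maximalFun_le hq2 hp ha ha' F k
  · calc _ ≤ geomConst ((q - p) / q) ^ p *
        ((K * ((∑ R ∈ F, weight p a R) ^ (1 / 2 : ℝ) * Y ^ (1 / 2 : ℝ))) ^ (p / q) *
          Y ^ (1 - p / q)) := by
          have : 0 ≤ 1 - p / q := by linarith
          gcongr
      _ = _ := by
          rw [mul_left_comm K, ENNReal.mul_rpow_of_nonneg _ _ (by positivity : 0 ≤ p / q),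
            ← ENNReal.rpow_mul]
          ring

/-- Fatou's lemma: as a supremum of values, the maximal function is lower semicontinuous under
pointwise convergence of families. -/
theorem lintegral_maximalFun_rpow_le_of_tendsto {ι : Type*} {l : Filter ι} [l.NeBot]
    [l.IsCountablyGenerated] (hp : 0 < p) {b : ι → DyadicRectangle → ℝ}
    (hb : ∀ R, Tendsto (fun i => b i R) l (𝓝 (a R))) {C : ℝ≥0∞}
    (hC : ∀ᶠ i in l, ∫⁻ z, maximalFun (b i) z ^ p ≤ C) : ∫⁻ z, maximalFun a z ^ p ≤ C := by
  have h1 : ∀ z, maximalFun a z ^ p ≤ liminf (fun i => maximalFun (b i) z ^ p) l := by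
    intro z
    refine le_of_forall_lt fun y hy => ?_
    have h2 : y ^ (1 / p) < maximalFun a z := by
      have := ENNReal.rpow_lt_rpow hy (by positivity : 0 < 1 / p)
      rwa [← ENNReal.rpow_mul, mul_one_div_cancel hp.ne', ENNReal.rpow_one] at this
    obtain ⟨R, hR⟩ := lt_iSup_iff.1 h2
    obtain ⟨hz, hR'⟩ := lt_iSup_iff.1 hR
    obtain ⟨x, hx1, hx2⟩ := exists_between hR'
    have h3 : Tendsto (fun i => ENNReal.ofReal |b i R|) l (𝓝 (ENNReal.ofReal |a R|)) :=
      ENNReal.tendsto_ofReal ((hb R).abs)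
    have h4 : ∀ᶠ i in l, x ^ p ≤ maximalFun (b i) z ^ p := by
      filter_upwards [h3.eventually (lt_mem_nhds hx2)] with i hi
      exact ENNReal.rpow_le_rpow (hi.le.trans (le_iSup₂_of_le R hz le_rfl)) hp.le
    refine lt_of_lt_of_le ?_ (le_liminf_of_le (by isBoundedDefault) h4)
    have := ENNReal.rpow_lt_rpow hx1 hp
    rwa [← ENNReal.rpow_mul, one_div_mul_cancel hp.ne', ENNReal.rpow_one] at this
  calc ∫⁻ z, maximalFun a z ^ p ≤ ∫⁻ z, liminf (fun i => maximalFun (b i) z ^ p) l :=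
        lintegral_mono h1
    _ ≤ liminf (fun i => ∫⁻ z, maximalFun (b i) z ^ p) l :=
        lintegral_liminf_le fun i => (measurable_maximalFun _).pow_const p
    _ ≤ C := liminf_le_of_frequently_le' hC.frequently

theorem ofReal_abs_rpow_mul_volume_le (hp : 0 < p) (a : DyadicRectangle → ℝ)
    (R : DyadicRectangle) :
    ENNReal.ofReal |a R| ^ p * volume R.toSet ≤ ∫⁻ z, maximalFun a z ^ p := by
  rw [← setLIntegral_const]
  refine le_trans ?_ (setLIntegral_le_lintegral R.toSet _)
  exact setLIntegral_mono' R.measurableSet_toSet fun z hz =>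
    ENNReal.rpow_le_rpow (le_iSup₂_of_le R hz le_rfl) hp.le

/-- Since `|a_R|^p |R| ≤ ‖Ma‖_p^p`, a distribution in `H^p_d` has no part that survives on
arbitrarily large rectangles. -/
theorem exists_abs_le_of_area (hp : 0 < p) (ha' : ∫⁻ z, maximalFun a z ^ p < ⊤) {ε : ℝ}
    (hε : 0 < ε) : ∃ M : ℝ, ∀ R : DyadicRectangle, M < R.area → |a R| ≤ ε := by
  have hε' : ENNReal.ofReal ε ^ p ≠ 0 := by
    simp [ENNReal.rpow_eq_zero_iff, hε, hp.not_gt]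
  have hεt : ENNReal.ofReal ε ^ p ≠ ⊤ := ENNReal.rpow_ne_top_of_nonneg hp.le ENNReal.ofReal_ne_top
  refine ⟨((∫⁻ z, maximalFun a z ^ p) / ENNReal.ofReal ε ^ p).toReal, fun R hR => ?_⟩
  by_contra! hcon
  have h1 := ofReal_abs_rpow_mul_volume_le hp a R
  have h2 : ENNReal.ofReal ε ^ p * volume R.toSet ≤ ∫⁻ z, maximalFun a z ^ p :=
    le_trans (mul_le_mul_left (ENNReal.rpow_le_rpow (ENNReal.ofReal_le_ofReal hcon.le) hp.le) _) h1
  rw [mul_comm, ← ENNReal.le_div_iff_mul_le (Or.inl hε') (Or.inl hεt),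
    DyadicRectangle.volume_toSet_eq,
    ENNReal.ofReal_le_iff_le_toReal (ENNReal.div_ne_top ha'.ne hε')] at h2
  linarith

/-- In the four-term telescoping formula, all terms but `a(I, J)` belong to rectangles with a side
of length `2^N` and the other side bounded below, so they tend to zero. -/
theorem tendsto_averages_truncation (hp : 0 < p) (ha : IsConsistent a)
    (ha' : ∫⁻ z, maximalFun a z ^ p < ⊤) (R : DyadicRectangle) :
    Tendsto (fun N => averages (truncation N a) R) atTop (𝓝 (a R)) := by
  obtain ⟨I, J⟩ := R
  rw [Metric.tendsto_nhds]
  intro ε hε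
  obtain ⟨M, hM⟩ := exists_abs_le_of_area hp ha' (by positivity : 0 < ε / 4)
  have hlarge : ∀ c : ℝ, 0 < c → ∀ᶠ N : ℕ in atTop, M < c * 2 ^ N := fun c hc =>
    ((tendsto_pow_atTop_atTop_of_one_lt (by norm_num : (1 : ℝ) < 2)).const_mul_atTop
      hc).eventually_gt_atTop M
  filter_upwards [I.eventually_sum_box_eq, J.eventually_sum_box_eq, hlarge _ I.length_pos,
    hlarge _ J.length_pos] with N hI hJ h1 h2
  obtain ⟨K₀, hK1, hK2, hK3⟩ := hI
  obtain ⟨L₀, hL1, hL2, hL3⟩ := hJ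
  have hKl : K₀.length = 2 ^ N := by rw [DyadicInterval.length, hK2, zpow_natCast]
  have hLl : L₀.length = 2 ^ N := by rw [DyadicInterval.length, hL2, zpow_natCast]
  have hKJ : J.length ≤ L₀.length := by
    rw [DyadicInterval.length, DyadicInterval.length]
    exact zpow_le_zpow_right₀ (by norm_num) (scale_le_of_subset hL1)
  have b1 := hM (I, L₀) (by simp only [DyadicRectangle.area]; rwa [hLl])
  have b2 := hM (K₀, J) (by simp only [DyadicRectangle.area]; rwa [hKl, mul_comm])
  have b3 := hM (K₀, L₀) (by
    simp only [DyadicRectangle.area]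
    have h3 : M < K₀.length * J.length := by rwa [hKl, mul_comm]
    exact h3.trans_le (mul_le_mul_of_nonneg_left hKJ K₀.length_pos.le))
  rw [averages_truncation_eq ha hK3 hL3, Real.dist_eq]
  rw [abs_le] at b1 b2 b3
  rw [abs_lt]
  constructor <;> linarith

/-- Finite Haar sums are dense in `H^p`. -/
theorem tendsto_lintegral_sub_truncation (hp : 0 < p) (ha : IsConsistent a)
    (ha' : ∫⁻ z, maximalFun a z ^ p < ⊤) :
    Tendsto (fun N => ∫⁻ z, maximalFun (a - averages (truncation N a)) z ^ p) atTop (𝓝 0) := by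
  classical
  obtain ⟨D, hD, e, he, hDF⟩ := exists_lintegral_haarSum_le hp ha ha'
  have hboxes : Tendsto boxes atTop atTop :=
    tendsto_atTop_finset_of_monotone boxes_mono fun R => (eventually_mem_boxes R).exists
  have htail := (ENNReal.tendsto_tsum_compl_atTop_zero (tsum_weight_ne_top hp ha ha')).comp hboxes
  have hlim : Tendsto (fun N => D * (∑' R : {R // R ∉ boxes N}, weight p a R) ^ e) atTop (𝓝 0) := by
    have h1 := ENNReal.Tendsto.const_mul (a := D) (htail.ennrpow_const e) (Or.inr hD)
    rwa [ENNReal.zero_rpow_of_pos he, mul_zero] at h1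
  refine tendsto_of_tendsto_of_tendsto_of_le_of_le tendsto_const_nhds hlim (fun _ => zero_le)
    fun N => ?_
  -- The remainder is the pointwise limit of finite Haar sums over `boxes n \ boxes N`, each bounded
  -- by the tail of the weight series.
  refine lintegral_maximalFun_rpow_le_of_tendsto (l := atTop) hp
    (b := fun n => averages (truncation n a) - averages (truncation N a))
    (fun R => (tendsto_averages_truncation hp ha ha' R).sub tendsto_const_nhds) ?_
  filter_upwards [eventually_ge_atTop N] with n hn
  have h1 : averages (truncation n a) - averages (truncation N a) =
      averages (haarSum (coeff a) (boxes n \ boxes N)) := by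
    rw [truncation, truncation, ← averages_sub (dyadicLocallyIntegrable_haarSum _ _)
      (dyadicLocallyIntegrable_haarSum _ _)]
    congr 1
    rw [haarSum, haarSum, haarSum,
      ← Finset.sum_sdiff (boxes_mono hn), add_sub_cancel_right]
  rw [h1]
  refine (hDF _).trans ?_
  gcongr
  rw [← Finset.sum_subtype_of_mem (p := fun R => R ∉ boxes N) _
    fun R hR => (Finset.mem_sdiff.1 hR).2]
  exact ENNReal.sum_le_tsum _

end

end BiparameterHardy

/-! ### Truncations in `H^p_d`, and the operator on functions supported in a fixed set. -/

namespace BiparameterHardy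

open DyadicInterval

section

variable {p : ℝ}

theorem hardyNorm_lt_top_iff (hp : 0 < p) {a : DyadicRectangle → ℝ} :
    hardyNorm p a < ⊤ ↔ ∫⁻ z, maximalFun a z ^ p < ⊤ := by
  rw [hardyNorm, ENNReal.rpow_lt_top_iff_of_pos (by positivity)]

theorem hardyNorm_le_of_lintegral_le (hp : 0 < p) {a b : DyadicRectangle → ℝ} {C : ℝ≥0∞}
    (h : ∫⁻ z, maximalFun b z ^ p ≤ C * ∫⁻ z, maximalFun a z ^ p) :
    hardyNorm p b ≤ C ^ (1 / p) * hardyNorm p a := by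
  rw [hardyNorm, hardyNorm, ← ENNReal.mul_rpow_of_nonneg _ _ (by positivity)]
  exact ENNReal.rpow_le_rpow h (by positivity)

/-- Evaluation at `R` is continuous: `|b_R| ≤ |R|^{-1/p} ‖b‖`. Limits in `H^p_d` are identified
through it. -/
theorem tendsto_zero_of_hardyNorm (hp : 0 < p) {ι : Type*} {l : Filter ι}
    {b : ι → DyadicRectangle → ℝ} (h : Tendsto (fun i => hardyNorm p (b i)) l (𝓝 0))
    (R : DyadicRectangle) : Tendsto (fun i => b i R) l (𝓝 0) := by
  have hV0 : volume R.toSet ^ (1 / p) ≠ 0 := by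
    simp [ENNReal.rpow_eq_zero_iff, R.volume_toSet_ne_zero, R.volume_toSet_ne_top]
  have hVt : volume R.toSet ^ (1 / p) ≠ ⊤ :=
    ENNReal.rpow_ne_top_of_nonneg (by positivity) R.volume_toSet_ne_top
  have h1 : ∀ i, ENNReal.ofReal |b i R| ≤ hardyNorm p (b i) / volume R.toSet ^ (1 / p) := by
    intro i
    rw [ENNReal.le_div_iff_mul_le (Or.inl hV0) (Or.inl hVt), hardyNorm]
    have h2 := ENNReal.rpow_le_rpow (ofReal_abs_rpow_mul_volume_le hp (b i) R)
      (by positivity : 0 ≤ 1 / p)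
    rwa [ENNReal.mul_rpow_of_nonneg _ _ (by positivity), ← ENNReal.rpow_mul,
      mul_one_div_cancel hp.ne', ENNReal.rpow_one] at h2
  have h2 : Tendsto (fun i => hardyNorm p (b i) / volume R.toSet ^ (1 / p)) l (𝓝 0) := by
    have := ENNReal.Tendsto.div_const h (b := volume R.toSet ^ (1 / p)) (Or.inr hV0)
    rwa [ENNReal.zero_div] at this
  have h3 := tendsto_of_tendsto_of_tendsto_of_le_of_le tendsto_const_nhds h2
    (fun _ => zero_le) h1
  rw [tendsto_iff_edist_tendsto_0]
  refine h3.congr fun i => ?_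
  rw [edist_eq_enorm_sub, sub_zero, Real.enorm_eq_ofReal_abs]

theorem tendsto_hardyNorm_sub_truncation (hp : 0 < p) {a : DyadicRectangle → ℝ}
    (ha : IsConsistent a) (ha' : hardyNorm p a < ⊤) :
    Tendsto (fun N => hardyNorm p (a - averages (truncation N a))) atTop (𝓝 0) := by
  have h := (tendsto_lintegral_sub_truncation hp ha
    ((hardyNorm_lt_top_iff hp).1 ha')).ennrpow_const (1 / p)
  rwa [ENNReal.zero_rpow_of_pos (by positivity)] at h

theorem averages_truncation_mem (hp : 0 < p) {a : DyadicRectangle → ℝ} (ha : a ∈ Hardy p hp)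
    (N : ℕ) : averages (truncation N a) ∈ Hardy p hp := by
  refine ⟨isConsistent_averages (dyadicLocallyIntegrable_haarSum _ _), ?_⟩
  rw [hardyNorm_lt_top_iff hp]
  have h1 := (hardyNorm_lt_top_iff hp).1 ha.2
  calc _ ≤ ∫⁻ z, 4 ^ p * maximalFun a z ^ p := by
        refine lintegral_mono fun z => ?_
        rw [← ENNReal.mul_rpow_of_nonneg _ _ hp.le]
        exact ENNReal.rpow_le_rpow (maximalFun_truncation_le ha.1 N z) hp.le
    _ = 4 ^ p * ∫⁻ z, maximalFun a z ^ p := lintegral_const_mul' _ _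
        (ENNReal.rpow_ne_top_of_nonneg hp.le (by norm_num))
    _ < ⊤ := ENNReal.mul_lt_top (ENNReal.rpow_lt_top_of_nonneg hp.le (by norm_num)) h1

end

theorem truncation_add (N : ℕ) (a b : DyadicRectangle → ℝ) :
    truncation N (a + b) = truncation N a + truncation N b := by
  simp only [truncation, haarSum, coeff_add, add_smul, Finset.sum_add_distrib]

theorem truncation_smul (N : ℕ) (c : ℝ) (a : DyadicRectangle → ℝ) :
    truncation N (c • a) = c • truncation N a := by
  simp only [truncation, haarSum, coeff_smul, mul_smul, Finset.smul_sum]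

/-- It rewrites a difference of two truncations as the truncation of a remainder that is small in
`H^p_d`, to which a uniform estimate for truncations applies. -/
theorem truncation_sub_averages_truncation {M N : ℕ} (h : M ≤ N) (a : DyadicRectangle → ℝ) :
    truncation N (a - averages (truncation M a)) = truncation N a - truncation M a := by
  classical
  simp only [truncation, haarSum, coeff_sub, sub_smul, Finset.sum_sub_distrib]
  congr 1
  refine (Finset.sum_subset_zero_on_sdiff (boxes_mono h) (fun R hR => ?_) fun R hR => ?_).symm
  · rw [← haarSum, coeff_averages_haarSum, if_neg (Finset.mem_sdiff.1 hR).2, zero_smul]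
  · rw [← haarSum, coeff_averages_haarSum, if_pos hR]

theorem isAtomMultiple_haarSum (s : ℝ) (c : DyadicRectangle → ℝ) (F : Finset DyadicRectangle) :
    IsAtomMultiple s (haarSum c F) := by
  have h1 : volume (⋃ R ∈ F, R.toSet) < ⊤ :=
    (measure_biUnion_finset_le _ _).trans_lt
      (ENNReal.sum_lt_top.2 fun R _ => R.volume_toSet_ne_top.lt_top)
  obtain ⟨U, hU, hUo, hUv⟩ := Set.exists_isOpen_lt_of_lt _ _ h1
  exact ⟨U, hUo, hUv, isHaarSupported_haarSum s fun R hR _ =>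
    (Set.subset_biUnion_of_mem (u := fun R : DyadicRectangle => R.toSet) hR).trans hU⟩

section

variable {p s q : ℝ} {V : Submodule ℝ PlaneFun} {T : V →ₗ[ℝ] PlaneFun}

/-- Rescaling to an atom makes the hypothesis a continuity statement from `L^s` to `L^q`. The
constant depends on `|Ω|`, which is harmless, because only limits for a fixed `Ω` are taken with it.
-/
theorem exists_eLpNorm_le (hs : 1 < s) (hq : 0 < q)
    (hT : ∀ Ω : Set (ℝ × ℝ), IsOpen Ω → volume Ω < ⊤ → ∀ f : V, IsAtom s Ω f →
      eLpNorm (T f) (ENNReal.ofReal q) volume ≤ volume Ω ^ (1 / q)) {Ω : Set (ℝ × ℝ)}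
    (hΩ : IsOpen Ω) (hΩ' : volume Ω < ⊤) : ∃ D : ℝ≥0∞, D ≠ ⊤ ∧ ∀ f : V, IsHaarSupported s Ω f →
      eLpNorm (T f) (ENNReal.ofReal q) volume ≤
        D * eLpNorm (f : PlaneFun) (ENNReal.ofReal s) volume := by
  have hs0 : 0 < s := by linarith
  have hqt : volume Ω ^ (1 / q) ≠ ⊤ := ENNReal.rpow_ne_top_of_nonneg (by positivity) hΩ'.ne
  refine ⟨(volume Ω ^ (1 / s))⁻¹ * volume Ω ^ (1 / q), ?_, fun f hf => ?_⟩
  · rcases eq_or_ne (volume Ω) 0 with hv | hv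
    · rw [hv, ENNReal.zero_rpow_of_pos (y := 1 / q) (by positivity), mul_zero]
      exact ENNReal.zero_ne_top
    · exact ENNReal.mul_ne_top
        (ENNReal.inv_ne_top.2 (by simp [ENNReal.rpow_eq_zero_iff, hv, hΩ'.ne])) hqt
  by_cases h0 : eLpNorm (f : PlaneFun) (ENNReal.ofReal s) volume = 0
  · have h1 := (eLpNorm_eq_zero_iff (f : PlaneFun).aestronglyMeasurable
      (by simpa using hs0)).1 h0
    have h2 : f = 0 := Subtype.ext (AEEqFun.ext (h1.trans AEEqFun.coeFn_zero.symm))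
    rw [h2, map_zero, eLpNorm_congr_ae AEEqFun.coeFn_zero, eLpNorm_zero]
    exact zero_le
  -- A null set contains no dyadic rectangle, so the Haar expansion would be empty and `f` zero.
  have hv : volume Ω ≠ 0 := by
    intro hv
    apply h0
    have : IsEmpty {R : DyadicRectangle // R.toSet ⊆ Ω} :=
      ⟨fun R => R.1.volume_toSet_ne_zero (measure_mono_null R.2 hv)⟩
    refine tendsto_nhds_unique (tendsto_const_nhds.congr fun F => ?_) hf.2
    rw [Finset.eq_empty_of_isEmpty F]
    simp
  have hvs : volume Ω ^ (1 / s) ≠ 0 := by simp [ENNReal.rpow_eq_zero_iff, hv, hΩ'.ne]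
  have hvt : volume Ω ^ (1 / s) ≠ ⊤ := ENNReal.rpow_ne_top_of_nonneg (by positivity) hΩ'.ne
  have h := (bound_of_isHaarSupported (Φ := fun _ _ => True) hs (fun _ _ _ _ => trivial)
    (fun Ω hΩ hΩ' f hf => ⟨trivial, hT Ω hΩ hΩ' f hf⟩) hΩ hΩ' hf
    (κ := eLpNorm (f : PlaneFun) (ENNReal.ofReal s) volume / volume Ω ^ (1 / s))
    (ENNReal.div_ne_zero.2 ⟨h0, hvt⟩) (ENNReal.div_ne_top hf.1.2.ne hvs)
    (by rw [ENNReal.div_mul_cancel hvs hvt])).2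
  refine h.trans (le_of_eq ?_)
  rw [div_eq_mul_inv]
  ring

theorem memLp_of_isAtomMultiple (hs : 1 < s) (hq : 0 < q)
    (hT : ∀ Ω : Set (ℝ × ℝ), IsOpen Ω → volume Ω < ⊤ → ∀ f : V, IsAtom s Ω f →
      eLpNorm (T f) (ENNReal.ofReal q) volume ≤ volume Ω ^ (1 / q))
    {f : V} (hf : IsAtomMultiple s f) : MemLp (T f) (ENNReal.ofReal q) volume := by
  obtain ⟨Ω, hΩ, hΩ', hf⟩ := hf
  obtain ⟨D, hD, h⟩ := exists_eLpNorm_le hs hq hT hΩ hΩ'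
  exact ⟨(T f).aestronglyMeasurable,
    (h f hf).trans_lt (ENNReal.mul_lt_top hD.lt_top hf.1.2)⟩

end

end BiparameterHardy

/-! ### The extension to `H^p_d` and its uniqueness. -/

namespace BiparameterHardy

open DyadicInterval

section

variable {p s q : ℝ} {V : Submodule ℝ PlaneFun}

/-- The truncation as an element of a space that contains the Haar functions. -/
def truncationIn (hV : haarSpan ≤ V) (N : ℕ) (a : DyadicRectangle → ℝ) : V :=
  ⟨truncation N a, hV (haarSum_mem_haarSpan _ _)⟩

theorem isAtomMultiple_truncationIn (hV : haarSpan ≤ V) (N : ℕ) (a : DyadicRectangle → ℝ) :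
    IsAtomMultiple s (truncationIn hV N a : PlaneFun) :=
  isAtomMultiple_haarSum s _ _

theorem truncationIn_add (hV : haarSpan ≤ V) (N : ℕ) (a b : DyadicRectangle → ℝ) :
    truncationIn hV N (a + b) = truncationIn hV N a + truncationIn hV N b :=
  Subtype.ext (truncation_add N a b)

theorem truncationIn_smul (hV : haarSpan ≤ V) (N : ℕ) (c : ℝ) (a : DyadicRectangle → ℝ) :
    truncationIn hV N (c • a) = c • truncationIn hV N a :=
  Subtype.ext (truncation_smul N c a)

variable {T : V →ₗ[ℝ] PlaneFun}

/-- A linear operator that is bounded in `L^q` on `L^s`-atoms. -/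
def IsBoundedOnAtoms (s q : ℝ) (T : V →ₗ[ℝ] PlaneFun) : Prop :=
  ∀ Ω : Set (ℝ × ℝ), IsOpen Ω → volume Ω < ⊤ → ∀ f : V, IsAtom s Ω f →
    eLpNorm (T f) (ENNReal.ofReal q) volume ≤ volume Ω ^ (1 / q)

/-- The operator satisfies the `H^p_d` estimate, with constant `C`, on the truncations of the
elements of the space. -/
def IsBoundedOnTruncations (p : ℝ) (C : ℝ≥0) (hV : haarSpan ≤ V) (T : V →ₗ[ℝ] PlaneFun) : Prop :=
  ∀ a : DyadicRectangle → ℝ, IsConsistent a → ∫⁻ z, maximalFun a z ^ p < ⊤ → ∀ N,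
    ∫⁻ z, maximalFun (averages (T (truncationIn hV N a))) z ^ p ≤
      C * ∫⁻ z, maximalFun a z ^ p

theorem IsBoundedOnAtoms.dyadicLocallyIntegrable (hT : IsBoundedOnAtoms s q T) (hs : 1 < s)
    (hq : 1 < q) {f : V} (hf : IsAtomMultiple s f) : DyadicLocallyIntegrable (T f) :=
  MemLp.dyadicLocallyIntegrable (by simpa using hq.le)
    (memLp_of_isAtomMultiple hs (by linarith) hT hf)

/-- The truncations of `f` stay supported in the same `Ω` and converge in `L^s`, so their images
converge in `L^q`. This links `T` on infinite expansions, where it is given independently, with its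
values on finite sums. -/
theorem IsBoundedOnAtoms.tendsto_averages (hT : IsBoundedOnAtoms s q T) (hs : 1 < s)
    (hq : 1 < q) (hV : haarSpan ≤ V) {f : V} (hf : IsAtomMultiple s f) (R : DyadicRectangle) :
    Tendsto (fun N => averages (T (truncationIn hV N (averages f))) R) atTop
      (𝓝 (averages (T f) R)) := by
  have hq0 : 0 < q := by linarith
  refine BiparameterHardy.tendsto_averages (r := ENNReal.ofReal q) (by simpa using hq.le)
    (memLp_of_isAtomMultiple hs hq0 hT hf)
    (fun N => memLp_of_isAtomMultiple hs hq0 hT (isAtomMultiple_truncationIn hV N _)) ?_ R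
  obtain ⟨Ω, hΩ, hΩ', hf⟩ := hf
  obtain ⟨D, hD, h⟩ := exists_eLpNorm_le hs hq0 hT hΩ hΩ'
  have h1 := ENNReal.Tendsto.const_mul (a := D) (hf.tendsto_truncation hs) (Or.inr hD)
  rw [mul_zero] at h1
  refine tendsto_of_tendsto_of_tendsto_of_le_of_le tendsto_const_nhds h1
    (fun _ => zero_le) fun N => ?_
  simp only [← map_sub]
  exact h (f - truncationIn hV N (averages f)) (hf.sub hs (hf.truncation hs N))

variable (hV : haarSpan ≤ V)

theorem IsBoundedOnTruncations.hardyNorm_le {C : ℝ≥0} (hC : IsBoundedOnTruncations p C hV T)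
    (hp : 0 < p) {a : DyadicRectangle → ℝ} (ha : a ∈ Hardy p hp) (N : ℕ) :
    hardyNorm p (averages (T (truncationIn hV N a))) ≤
      (C : ℝ≥0∞) ^ (1 / p) * hardyNorm p a :=
  hardyNorm_le_of_lintegral_le hp (hC a ha.1 ((hardyNorm_lt_top_iff hp).1 ha.2) N)

theorem exists_tendsto_averages_truncationIn (hs : 1 < s) (hq : 1 < q) (hp : 0 < p)
    (hT : IsBoundedOnAtoms s q T) {C : ℝ≥0} (hC : IsBoundedOnTruncations p C hV T)
    {a : DyadicRectangle → ℝ} (ha : a ∈ Hardy p hp) (R : DyadicRectangle) :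
    ∃ x, Tendsto (fun N => averages (T (truncationIn hV N a)) R) atTop (𝓝 x) := by
  refine cauchySeq_tendsto_of_complete ?_
  have hd : ∀ M N, averages (T (truncationIn hV N a)) - averages (T (truncationIn hV M a)) =
      averages (T (truncationIn hV N a - truncationIn hV M a)) := fun M N => by
    rw [map_sub, averages_sub (hT.dyadicLocallyIntegrable hs hq (isAtomMultiple_truncationIn hV _ _))
      (hT.dyadicLocallyIntegrable hs hq (isAtomMultiple_truncationIn hV _ _))]
  have hb : ∀ n : ℕ × ℕ, n.2 ≤ n.1 → hardyNorm p (averages (T (truncationIn hV n.1 a)) -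
      averages (T (truncationIn hV n.2 a))) ≤
      (C : ℝ≥0∞) ^ (1 / p) * hardyNorm p (a - averages (truncation n.2 a)) := by
    rintro ⟨N, M⟩ hMN
    have h : truncationIn hV N (a - averages (truncation M a)) =
        truncationIn hV N a - truncationIn hV M a :=
      Subtype.ext (truncation_sub_averages_truncation hMN a)
    rw [hd, ← h]
    exact hC.hardyNorm_le hV hp (sub_mem ha (averages_truncation_mem hp ha M)) N
  have h0 := ENNReal.Tendsto.const_mul (a := (C : ℝ≥0∞) ^ (1 / p))
    (tendsto_hardyNorm_sub_truncation hp ha.1 ha.2)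
    (Or.inr (ENNReal.rpow_ne_top_of_nonneg (by positivity) ENNReal.coe_ne_top))
  rw [mul_zero] at h0
  -- The second coordinate is the increment of the index, and the factor `𝓟 Set.univ` makes the
  -- convergence uniform in it, as the Cauchy property requires.
  have h1 : Tendsto (fun n : ℕ × ℕ => hardyNorm p (averages (T (truncationIn hV (n.1 + n.2) a)) -
      averages (T (truncationIn hV n.1 a)))) (atTop ×ˢ 𝓟 Set.univ) (𝓝 0) :=
    tendsto_of_tendsto_of_tendsto_of_le_of_le tendsto_const_nhds (h0.comp tendsto_fst)
      (fun _ => zero_le) fun n => hb (n.1 + n.2, n.1) (Nat.le_add_right _ _)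
  refine Metric.cauchySeq_iff'.2 fun ε hε => ?_
  have h2 := Metric.tendsto_nhds.1 (tendsto_zero_of_hardyNorm hp h1 R) ε hε
  rw [eventually_prod_principal_iff] at h2
  obtain ⟨N, hN⟩ := h2.exists
  refine ⟨N, fun n hn => ?_⟩
  have h3 := hN (n - N) (Set.mem_univ _)
  rwa [Nat.add_sub_cancel' hn, Pi.sub_apply, dist_zero_right, ← dist_eq_norm] at h3

/-- The limit is taken rectangle by rectangle, so completeness of `H^p_d` is not needed: linearity
and consistency pass to pointwise limits, and Fatou's lemma preserves the norm bound. -/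
theorem exists_limit_operator (hs : 1 < s) (hq : 1 < q) (hp : 0 < p)
    (hT : IsBoundedOnAtoms s q T) {C : ℝ≥0} (hC : IsBoundedOnTruncations p C hV T) :
    ∃ T' : Hardy p hp →ₗ[ℝ] Hardy p hp,
      (∀ a, hardyNorm p (T' a) ≤ (C : ℝ≥0∞) ^ (1 / p) * hardyNorm p a) ∧
      ∀ (a : Hardy p hp) (R : DyadicRectangle),
        Tendsto (fun N => averages (T (truncationIn hV N a)) R) atTop
          (𝓝 ((T' a : DyadicRectangle → ℝ) R)) := by
  have hI : ∀ N a, DyadicLocallyIntegrable (T (truncationIn hV N a)) := fun N a =>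
    hT.dyadicLocallyIntegrable hs hq (isAtomMultiple_truncationIn hV N a)
  choose! L hL using fun (a : Hardy p hp) R =>
    exists_tendsto_averages_truncationIn hV hs hq hp hT hC a.2 R
  have hb : ∀ a : Hardy p hp, hardyNorm p (L a) ≤ (C : ℝ≥0∞) ^ (1 / p) * hardyNorm p a :=
    fun a => hardyNorm_le_of_lintegral_le hp (lintegral_maximalFun_rpow_le_of_tendsto hp (hL a)
      (Eventually.of_forall fun N => hC a a.2.1 ((hardyNorm_lt_top_iff hp).1 a.2.2) N))
  have hmem : ∀ a : Hardy p hp, L a ∈ Hardy p hp := fun a =>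
    ⟨fun I J => by
      have h1 := fun N => isConsistent_averages (hI N a) I J
      refine ⟨tendsto_nhds_unique (hL a (I, J)) ?_, tendsto_nhds_unique (hL a (I, J)) ?_⟩
      · exact (((hL a (I.left, J)).add (hL a (I.right, J))).div_const 2).congr
          fun N => (h1 N).1.symm
      · exact (((hL a (I, J.left)).add (hL a (I, J.right))).div_const 2).congr
          fun N => (h1 N).2.symm,
     (hb a).trans_lt (ENNReal.mul_lt_top
       (ENNReal.rpow_lt_top_of_nonneg (by positivity) ENNReal.coe_ne_top) a.2.2)⟩
  refine ⟨{ toFun := fun a => ⟨L a, hmem a⟩, map_add' := fun a b => ?_, map_smul' := fun c a => ?_ },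
    hb, hL⟩
  · refine Subtype.ext (funext fun R => tendsto_nhds_unique (hL (a + b) R) ?_)
    refine ((hL a R).add (hL b R)).congr fun N => ?_
    rw [Submodule.coe_add, truncationIn_add, map_add, averages_add (hI N _) (hI N _), Pi.add_apply]
  · refine Subtype.ext (funext fun R => tendsto_nhds_unique (hL (c • a) R) ?_)
    refine ((hL a R).const_mul c).congr fun N => ?_
    rw [Submodule.coe_smul, truncationIn_smul, map_smul, averages_smul, Pi.smul_apply, smul_eq_mul]

theorem isBoundedOnHardy_of_truncations (hs : 1 < s) (hq : 1 < q) (hp : 0 < p)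
    (hT : IsBoundedOnAtoms s q T) {C : ℝ≥0} (hC0 : C ≠ 0)
    (hC : IsBoundedOnTruncations p C hV T) : IsBoundedOnHardy p hp s (C ^ (1 / p)) V T := by
  have hCp : ((C ^ (1 / p) : ℝ≥0) : ℝ≥0∞) = (C : ℝ≥0∞) ^ (1 / p) :=
    (ENNReal.coe_rpow_of_nonneg _ (by positivity))
  have hmem : ∀ f : V, IsAtomMultiple s f → hardyNorm p (averages f) < ⊤ →
      averages f ∈ Hardy p hp := fun f hf h => by
    obtain ⟨Ω, -, -, hf⟩ := hf
    exact ⟨isConsistent_averages (hf.locallyIntegrable hs), h⟩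
  rw [IsBoundedOnHardy, hCp]
  constructor
  · refine fun f hf => ⟨hT.dyadicLocallyIntegrable hs hq hf, ?_⟩
    -- A multiple of an atom need not lie in `H^p_d`. In that case the right-hand side is `⊤`, but
    -- only because `C ≠ 0`, since `0 * ⊤ = 0`.
    rcases eq_or_ne (hardyNorm p (averages f)) ⊤ with h | h
    · rw [h, ENNReal.mul_top (by simp [ENNReal.rpow_eq_zero_iff, hC0])]
      exact le_top
    · have ha := hmem f hf h.lt_top
      exact hardyNorm_le_of_lintegral_le hp (lintegral_maximalFun_rpow_le_of_tendsto hp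
        (hT.tendsto_averages hs hq hV hf) (Eventually.of_forall fun N =>
          hC _ ha.1 ((hardyNorm_lt_top_iff hp).1 ha.2) N))
  obtain ⟨T', hb, hL⟩ := exists_limit_operator hV hs hq hp hT hC
  refine ⟨T', ⟨hb, fun f a hf ha => funext fun R => ?_⟩, fun S ⟨hS, hS'⟩ => ?_⟩
  · have h := hL a R
    rw [ha] at h
    exact tendsto_nhds_unique h (hT.tendsto_averages hs hq hV hf R)
  -- Uniqueness: a competitor `S` agrees with `T` on truncations, which are multiples of atoms. Its
  -- bound, applied to `a` minus a truncation, forces `S a` to be the same limit.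
  refine LinearMap.ext fun a => Subtype.ext (funext fun R => ?_)
  have h0 := ENNReal.Tendsto.const_mul (a := (C : ℝ≥0∞) ^ (1 / p))
    (tendsto_hardyNorm_sub_truncation hp a.2.1 a.2.2)
    (Or.inr (ENNReal.rpow_ne_top_of_nonneg (by positivity) ENNReal.coe_ne_top))
  rw [mul_zero] at h0
  have h1 : Tendsto (fun N => hardyNorm p
      ((S a : DyadicRectangle → ℝ) - averages (T (truncationIn hV N a)))) atTop (𝓝 0) := by
    refine tendsto_of_tendsto_of_tendsto_of_le_of_le tendsto_const_nhds h0
      (fun _ => zero_le) fun N => ?_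
    have h2 := hS (a - ⟨_, averages_truncation_mem hp a.2 N⟩)
    rw [map_sub, Submodule.coe_sub, hS' (truncationIn hV N a) ⟨_, averages_truncation_mem hp a.2 N⟩
      (isAtomMultiple_truncationIn hV N _) rfl] at h2
    exact h2
  have h2 := tendsto_zero_of_hardyNorm hp h1 R
  have h3 := (tendsto_const_nhds (x := (S a : DyadicRectangle → ℝ) R)).sub h2
  rw [sub_zero] at h3
  exact tendsto_nhds_unique (h3.congr fun N => by simp) (hL a R)

end

end BiparameterHardy

end

theorem mainTheorem3 (p s q : ℝ) (hp : 0 < p) (hs : 1 < s) (hq : 1 < q) (hpq : p < q) :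
    (∃ C : ℝ≥0, ∀ (V : Submodule ℝ BiparameterHardy.PlaneFun)
        (T : V →ₗ[ℝ] BiparameterHardy.PlaneFun),
      BiparameterHardy.haarSpan ≤ V →
      (∀ Ω : Set (ℝ × ℝ), IsOpen Ω → volume Ω < ⊤ → ∀ f : V,
        BiparameterHardy.IsAtom s Ω f → BiparameterHardy.IsAtom q Ω (T f)) →
      BiparameterHardy.IsBoundedOnHardy p hp s C V T) ∧
    (1 < p → ∃ C : ℝ≥0, ∀ (V : Submodule ℝ BiparameterHardy.PlaneFun)
        (T : V →ₗ[ℝ] BiparameterHardy.PlaneFun),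
      BiparameterHardy.haarSpan ≤ V →
      (∀ Ω : Set (ℝ × ℝ), IsOpen Ω → volume Ω < ⊤ → ∀ f : V,
        BiparameterHardy.IsAtom s Ω f →
          (∀ᵐ z : ℝ × ℝ, z ∉ Ω → T f z = 0) ∧
          eLpNorm (T f) (ENNReal.ofReal q) volume ≤ volume Ω ^ (1 / q)) →
      BiparameterHardy.IsBoundedOnHardy p hp s C V T) := by
  -- Adding `1` to the constants makes them non-zero, as `isBoundedOnHardy_of_truncations` requires.
  have key : ∀ {K : ℝ≥0∞}, K ≠ ⊤ → K ≤ ((K.toNNReal + 1 : ℝ≥0) : ℝ≥0∞) := fun hK => by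
    rw [ENNReal.coe_add, ENNReal.coe_toNNReal hK]
    exact le_self_add
  refine ⟨⟨_, fun V T hV hT => BiparameterHardy.isBoundedOnHardy_of_truncations
      (C := (BiparameterHardy.atomConst p s q).toNNReal + 1) hV hs hq hp
      (fun Ω hΩ hΩ' f hf => (hT Ω hΩ hΩ' f hf).2) (by positivity) fun a ha ha' N => ?_⟩,
    fun hp1 => ⟨_, fun V T hV hT => BiparameterHardy.isBoundedOnHardy_of_truncations
      (C := (BiparameterHardy.supportConst p s q).toNNReal + 1) hV hs hq hp
      (fun Ω hΩ hΩ' f hf => (hT Ω hΩ hΩ' f hf).2) (by positivity) fun a ha ha' N => ?_⟩⟩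
  · refine (BiparameterHardy.lintegral_maximalFun_le_of_isAtom hp hs hq hpq hV hT ha ha'
      (BiparameterHardy.boxes N)).trans ?_
    gcongr
    exact key (BiparameterHardy.atomConst_ne_top hp hs hq hpq)
  · refine (BiparameterHardy.lintegral_maximalFun_le_of_support hp1 hs hq hpq hV hT ha ha'
      (BiparameterHardy.boxes N)).trans ?_
    gcongr
    exact key (BiparameterHardy.supportConst_ne_top hp1 hs hq hpq)
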